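/- **Definitions.** A row of a $0$-$1$ matrix $M$ with finitely many rows and columns is identified with the set of columns in which it has a $1$. A sequence of rows has the *consecutive-ones property* if there is an ordering of all columns in which every row is consecutive (a *consecutive-ones ordering*). A *Tucker submatrix* of $M$ is a submatrix which, up to permutations of its rows and columns, is one of the following (columns numbered from $0$, rows listed as sets): * $M_I$ with $n\ge 3$ rows and columns $0,\dots,n-1$: $\{i,i+1 \bmod n\}$ for $0\le i\le n-1$; * $M_{II}$ with $n\ge 4$ rows and columns $0,\dots,n-1$: $\{i,i+1\}$ for $0\le i\le n-3$, $\{0,\dots,n-1\}\setminus\{n-2\}$, $\{1,\dots,n-1\}$; * $M_{III}$ with $n\ge 3$ rows and columns $0,\dots,n$: $\{i,i+1\}$ for $0\le i\le n-2$, and $\{0,\dots,n\}\setminus\{0,n-1\}$; * $M_{IV}$ with columns $0,\dots,5$: $\{0,1\},\{2,3\},\{4,5\},\{1,3,5\}$; * $M_V$ with columns $0,\dots,4$: $\{0,1\},\{0,1,2,3\},\{2,3\},\{0,3,4\}$. The procedure $\mathrm{initialRows}(M,k)$ starts with $i=1$ and the row sequence of $M$. While $i\le k+1$ and the current sequence has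 at least $i-1$ rows, it performs iteration $i$: it finds the minimal prefix $(R_1,\dots,R_r,Z)$ of the current sequence that does not have the consecutive-ones property, replaces the current sequence by $(Z,R_1,\dots,R_r)$, and increases $i$ by $1$. Write ${\cal R}'=\{R_1,\dots,R_r\}$. A *PQ tree* for ${\cal R}'$ is a rooted tree with ordered children whose leaves are the columns, whose internal nodes are P nodes (at least two children) and Q nodes (at least three children), and such that the leaf orders obtained by permuting the children of each P node arbitrarily and keeping or reversing the order of the children of each Q node are exactly the consecutive-ones orderings of ${\cal R}'$. Each node is regarded as the set of its leaf descendants. If $X_1,\dots,X_s$ are the children of a Q node in order, $(X_h,X_i,X_j)$ with $h<i<j$ is a *1-0-1 configuration for $Z$* if $X_h\cap Z\ne\emptyset$, $X_i\not\subseteq Z$ and $X_j\cap Z\neq\emptyset$. Two sets *overlap* if they intersect and neither contains the other; the *overlap graph* of ${\cal R}'$ has vertex set ${\cal R}'$, with $R,S$ adjacent iff they overlap. **Statement.** Let $M$ be a $0$-$1$ matrix that does not have the consecutive-ones property and has no Tucker submatrix with fewer than five rows. Then one of the (at most five) iterations of $\mathrm{initialRows}(M,4)$ yields ${\cal R}'$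 and $Z$ with the following property. A PQ tree for ${\cal R}'$ exists, and every PQ tree for ${\cal R}'$ has a Q node $Q$ such that * $Q$ has a 1-0-1 configuration $(X_h,X_i,X_j)$ for $Z$; * there is a connected component of the overlap graph of ${\cal R}'$ whose union is $Q$ and which has members $A,B\in{\cal R}'$ such that $A$ contains $X_h$ and is disjoint from $X_i$ and $X_j$, and $B$ contains $X_j$ and is disjoint from $X_h$ and $X_i$. Here $(X_h,X_i,X_j)$ in the second item is the configuration of the first. -/

import Mathlib

namespace TuckerPQ

/-! ### Tucker matrices

Each family is given up to permutations of rows and columns. -/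

/-- `M_I` on `k + 3` rows: row `i` is `{i, i + 1}`, cyclically. -/
def tuckerI (k : ℕ) : Matrix (Fin (k + 3)) (Fin (k + 3)) Bool :=
  fun i j => decide (j = i ∨ j = i + 1)

/-- `M_II` on `k + 4` rows and columns (numbered from `0`): row `i` is `{i, i + 1}` for `i ≤ k + 1`,
row `k + 2` has its only `0` in column `k + 2`, row `k + 3` has its only `0` in column `0`. -/
def tuckerII (k : ℕ) : Matrix (Fin (k + 4)) (Fin (k + 4)) Bool :=
  fun i j =>
    if i.val ≤ k + 1 then decide (j.val = i.val ∨ j.val = i.val + 1)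
    else if i.val = k + 2 then decide (j.val ≠ k + 2)
    else decide (j.val ≠ 0)

/-- `M_III` on `k + 3` rows and `k + 4` columns (numbered from `0`): row `i` is `{i, i + 1}` for
`i ≤ k + 1`, and row `k + 2` has its only `0`s in columns `0` and `k + 2`. -/
def tuckerIII (k : ℕ) : Matrix (Fin (k + 3)) (Fin (k + 4)) Bool :=
  fun i j =>
    if i.val ≤ k + 1 then decide (j.val = i.val ∨ j.val = i.val + 1)
    else decide (j.val ≠ 0 ∧ j.val ≠ k + 2)

/-- `M_IV`. -/
def tuckerIV : Matrix (Fin 4) (Fin 6) Bool :=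
  !![true,  true,  false, false, false, false;
     false, false, true,  true,  false, false;
     false, false, false, false, true,  true;
     false, true,  false, true,  false, true]

/-- `M_V`. -/
def tuckerV : Matrix (Fin 4) (Fin 5) Bool :=
  !![true,  true,  false, false, false;
     true,  true,  true,  true,  false;
     false, false, true,  true,  false;
     true,  false, false, true,  true]

/-- The Tucker matrices, each with one fixed order of its rows and columns. -/
inductive IsTuckerMatrix : ∀ {p q : ℕ}, Matrix (Fin p) (Fin q) Bool → Prop
  | I (k : ℕ) : IsTuckerMatrix (tuckerI k)
  | II (k : ℕ) : IsTuckerMatrix (tuckerII k)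
  | III (k : ℕ) : IsTuckerMatrix (tuckerIII k)
  | IV : IsTuckerMatrix tuckerIV
  | V : IsTuckerMatrix tuckerV

/-- The rows `r` and columns `c` of `M` form a Tucker submatrix of `M`. As `r` and `c` are arbitrary
injections, rows and columns may be permuted. -/
def IsTuckerSubmatrix {n m p q : ℕ} (M : Matrix (Fin n) (Fin m) Bool)
    (r : Fin p ↪ Fin n) (c : Fin q ↪ Fin m) : Prop :=
  IsTuckerMatrix (M.submatrix r c)

/-! ### Rows as sets of columns, and the consecutive-ones property -/

/-- The sequence of rows of a matrix, each row being the set of columns in which it has a `1`. -/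
def rowList {n m : ℕ} (M : Matrix (Fin n) (Fin m) Bool) : List (Finset (Fin m)) :=
  List.ofFn fun i => Finset.univ.filter fun j => M i j = true

section

variable {C : Type*} [DecidableEq C]

/-- `l` is an ordering of all columns in which every row of `S` is consecutive. -/
def IsConsecutiveOrdering (S : List (Finset C)) (l : List C) : Prop :=
  l.Nodup ∧ (∀ c : C, c ∈ l) ∧ ∀ R ∈ S, ∃ t : List C, t <:+: l ∧ t.toFinset = R

/-- The consecutive-ones property. -/
def HasC1P (S : List (Finset C)) : Prop :=
  ∃ l : List C, IsConsecutiveOrdering S l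

/-! ### The loop of `initialRows` -/

/-- `(R₁, …, Rᵣ, Z)`, with `R' = (R₁, …, Rᵣ)`, is the minimal initial segment of the row sequence `M`
that does not have the consecutive-ones property. -/
structure IsFirstFailure (M R' : List (Finset C)) (Z : Finset C) : Prop where
  initial : R' ++ [Z] <+: M
  fails : ¬ HasC1P (R' ++ [Z])
  minimal : ∀ L : List (Finset C), L <+: M → ¬ HasC1P L → R' ++ [Z] <+: L

/-- In the run of `initialRows(M₀, k)`, the loop counter takes the value `i` and the current row
sequence is then `M`. The loop body is executed while `i ≤ k + 1` and `M` has at least `i - 1` rows;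
it replaces `M` by `(Z, R₁, …, Rᵣ)` and increments `i`. -/
inductive LoopState (k : ℕ) (M₀ : List (Finset C)) : ℕ → List (Finset C) → Prop
  | start : LoopState k M₀ 1 M₀
  | step {i : ℕ} {M R' : List (Finset C)} {Z : Finset C} :
      LoopState k M₀ i M → i ≤ k + 1 → i - 1 ≤ M.length → IsFirstFailure M R' Z →
      LoopState k M₀ (i + 1) (Z :: R')

/-- The `i`-th iteration of the loop of `initialRows(M₀, k)` takes place, and it finds the rows
`R' = (R₁, …, Rᵣ)` and `Z`. -/
def IsIteration (k : ℕ) (M₀ : List (Finset C)) (i : ℕ) (R' : List (Finset C)) (Z : Finset C) :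
    Prop :=
  ∃ M : List (Finset C),
    LoopState k M₀ i M ∧ i ≤ k + 1 ∧ i - 1 ≤ M.length ∧ IsFirstFailure M R' Z

/-! ### The overlap graph -/

/-- Two sets overlap if they intersect and neither contains the other. -/
def Overlap (R S : Finset C) : Prop :=
  (R ∩ S).Nonempty ∧ ¬ R ⊆ S ∧ ¬ S ⊆ R

/-- The overlap graph of a collection of rows. -/
def overlapGraph (S : List (Finset C)) : SimpleGraph {R : Finset C // R ∈ S} where
  Adj R₁ R₂ := Overlap R₁.1 R₂.1
  symm := ⟨fun R₁ R₂ h => ⟨by rw [Finset.inter_comm]; exact h.1, h.2.2, h.2.1⟩⟩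
  loopless := ⟨fun _ h => h.2.1 (Finset.Subset.refl _)⟩

end

/-! ### PQ trees -/

/-- Ordered rooted trees with leaves labelled by columns and internal nodes labelled P or Q. -/
inductive PQTree (C : Type*) : Type _
  | leaf (c : C) : PQTree C
  | pnode {n : ℕ} (child : Fin n → PQTree C) : PQTree C
  | qnode {n : ℕ} (child : Fin n → PQTree C) : PQTree C

namespace PQTree

variable {C : Type*}

/-- P nodes have at least two and Q nodes at least three children. -/
def Proper : PQTree C → Prop
  | leaf _ => True
  | @pnode _ n child => 2 ≤ n ∧ ∀ i, (child i).Proper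
  | @qnode _ n child => 3 ≤ n ∧ ∀ i, (child i).Proper

/-- `T.IsLeafOrder l`: the word `l` is a left-to-right order of the leaves of `T` that is obtained by
permuting the children of each P node arbitrarily and by keeping or reversing the order of the
children of each Q node. -/
def IsLeafOrder : PQTree C → List C → Prop
  | leaf c, l => l = [c]
  | @pnode _ n child, l =>
      ∃ (σ : Equiv.Perm (Fin n)) (w : Fin n → List C),
        (∀ i, (child i).IsLeafOrder (w i)) ∧ l = (List.ofFn fun i => w (σ i)).flatten
  | @qnode _ n child, l =>
      ∃ w : Fin n → List C, (∀ i, (child i).IsLeafOrder (w i)) ∧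
        (l = (List.ofFn w).flatten ∨ l = (List.ofFn fun i => w i.rev).flatten)

/-- A node regarded as a set of columns: the union of its leaf descendants. -/
def leafSet [DecidableEq C] : PQTree C → Finset C
  | leaf c => {c}
  | @pnode _ n child => (Finset.univ : Finset (Fin n)).biUnion fun i => (child i).leafSet
  | @qnode _ n child => (Finset.univ : Finset (Fin n)).biUnion fun i => (child i).leafSet

/-- `IsNode s T`: `s` is the subtree of `T` rooted at some node of `T`. -/
inductive IsNode (s : PQTree C) : PQTree C → Prop
  | root : IsNode s s
  | below_pnode {n : ℕ} {child : Fin n → PQTree C} (i : Fin n) :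
      IsNode s (child i) → IsNode s (pnode child)
  | below_qnode {n : ℕ} {child : Fin n → PQTree C} (i : Fin n) :
      IsNode s (child i) → IsNode s (qnode child)

/-- `T` is a PQ tree for the rows `S`: its leaf orders are exactly the consecutive-ones orderings of
`S`. In particular every column is the label of exactly one leaf. -/
def IsPQTreeOf [DecidableEq C] (T : PQTree C) (S : List (Finset C)) : Prop :=
  T.Proper ∧ ∀ l : List C, T.IsLeafOrder l ↔ IsConsecutiveOrdering S l

/-- `(X h, X i, X j)` is a 1-0-1 configuration for the row `Z`, where `X` is the sequence of children
of a Q node. -/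
def Is101 [DecidableEq C] {n : ℕ} (X : Fin n → PQTree C) (Z : Finset C) (h i j : Fin n) : Prop :=
  h < i ∧ i < j ∧
    (∃ c ∈ (X h).leafSet, c ∈ Z) ∧ (∃ c ∈ (X i).leafSet, c ∉ Z) ∧ ∃ c ∈ (X j).leafSet, c ∈ Z

end PQTree

end TuckerPQ

/-!
The proof combines a structure theorem for minimal families of rows without the consecutive-ones
property with an analysis of the loop and of PQ trees.

*Splits.* Adding to the columns a point `none` that lies in no row turns every row into a split of a
set into two sides, and linear orders of the columns into circular orders (`Arcs`). In the circular
setting the base point can be moved (`Arcs.rebase`), which unifies the five Tucker families. Let `J`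
be a minimal family of at least four splits without a common circular order; three rows that cannot
be ordered are a Tucker matrix by themselves (`Avoids.arcs_three`). The family is overlap-connected
(`linked_of_minimal`), and two members can be removed so that the rest stays so
(`Linked.exists_erase`). Orders of an overlap-connected family are unique up to reversal
(`Linked.order_unique`). Hence an order without the first and an order without the second of the two
members can be added up unless they conflict in a pair of points (`exists_conflict`), and a shortest
chain of intersecting splits around the conflict gives one of two patterns (`exists_pattern`): three
splits that each cut off one of three pairs, while a fourth split cuts through all of these pairs
(`StarPattern`), or a cycle in which the `a`-th split cuts off the `a`-th and the next point
(`CyclePattern`). According to the position of `none`, the star is `M_IV` or `M_V` or contains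
`M_I`, and the cycle is `M_I`, `M_II` or `M_III`. If there is no Tucker submatrix with fewer than
five rows, then `J` is a cycle of length at least five in which `none` lies in no split, in one
split, or in two consecutive splits (`Avoids.exists_cyclePattern`).

*The row `Z`.* Remove from such a cycle a split `Z` such that neither `Z` nor a neighbour of `Z`
contains `none`; at most four members are excluded. The other rows are overlap-connected, and in
each of their orders a column outside `Z` lies between the two columns that `Z` shares with its
neighbours (`Wedge`). In the loop, each row found so far belongs to every family of current rows
without the consecutive-ones property, and the five rows found are distinct. So a minimal family
that is left after five iterations contains all of them, and one of them is a suitable `Z`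
(`Avoids.exists_isIteration`).

*PQ trees.* A PQ tree is built by recursion on sets of columns: the root is a P node on the classes
of columns that are joined by rows, and if all columns are joined, it is a Q node on the atoms of
the overlap component that covers them (`exists_isLeafOrder_iff`). In an arbitrary PQ tree, rows do
not overlap nodes, because a node can be reversed on its own. So the children of the lowest node
that contains the overlap component of the wedge are not cut by the rows of the component. The node
is not a P node, as its children cannot be permuted freely, and it is the union of the component, as
this union could otherwise be reversed within the node. The children that contain the three columns
of the wedge form the 1-0-1 configuration (`PQTree.IsPQTreeOf.exists_qnode`).
-/

namespace TuckerPQ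

/-! ### Overlapping sets and convex rank functions -/

/-- Two sets overlap if they intersect and neither contains the other. -/
def SetOverlap {α : Type*} (A B : Set α) : Prop :=
  (A ∩ B).Nonempty ∧ (A \ B).Nonempty ∧ (B \ A).Nonempty

/-- `A` is an interval of the weak order given by the rank function `f`; in particular `A` is a
union of fibres of `f`. -/
def RankConvex {α : Type*} (f : α → ℕ) (A : Set α) : Prop :=
  ∀ ⦃x y z⦄, x ∈ A → z ∈ A → f x ≤ f y → f y ≤ f z → y ∈ A

/-- The members of the family `s` with index in `J` induce a connected overlap graph. -/
def Linked {ι α : Type*} (s : ι → Set α) (J : Set ι) : Prop :=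
  ∀ i ∈ J, ∀ j ∈ J, Relation.ReflTransGen (fun a b => b ∈ J ∧ SetOverlap (s a) (s b)) i j

/-- Some member of the family separates `x` from `y`. -/
def Separated {ι α : Type*} (s : ι → Set α) (J : Set ι) (x y : α) : Prop :=
  ∃ i ∈ J, ¬ (x ∈ s i ↔ y ∈ s i)

/-- In the order given by `f`, the set `A` starts before `B` does. -/
def LeftOf {α : Type*} (f : α → ℕ) (A B : Set α) : Prop :=
  ∀ x ∈ A \ B, ∀ y ∈ B, f x < f y

section Order

variable {ι α : Type*} {A B D : Set α} {f f₁ f₂ : α → ℕ} {s : ι → Set α} {J : Set ι}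

lemma SetOverlap.symm (h : SetOverlap A B) : SetOverlap B A :=
  ⟨by rw [Set.inter_comm]; exact h.1, h.2.2, h.2.1⟩

lemma Separated.symm {x y : α} (h : Separated s J x y) : Separated s J y x := by
  obtain ⟨i, hi, h⟩ := h
  exact ⟨i, hi, fun h' => h h'.symm⟩

/-- Being unseparated is transitive, in contrapositive form. -/
lemma Separated.trans_left {x y z : α} (h : Separated s J x z) (h' : ¬ Separated s J x y) :
    Separated s J y z := by
  obtain ⟨i, hi, h⟩ := h
  refine ⟨i, hi, fun h2 => h' ⟨i, hi, fun h3 => h (h3.trans h2)⟩⟩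

lemma RankConvex.lt_iff_of_notMem {x x' y : α} (hA : RankConvex f A) (hx : x ∈ A) (hx' : x' ∈ A)
    (hy : y ∉ A) : f x < f y ↔ f x' < f y := by
  constructor <;> intro h <;> by_contra h'
  · exact hy (hA hx hx' h.le (not_lt.1 h'))
  · exact hy (hA hx' hx h.le (not_lt.1 h'))

lemma RankConvex.ne {x y : α} (hA : RankConvex f A) (hx : x ∈ A) (hy : y ∉ A) : f x ≠ f y :=
  fun h => hy (hA hx hx h.le h.ge)

lemma RankConvex.ne_of_separated {x y : α} (hf : ∀ i ∈ J, RankConvex f (s i))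
    (h : Separated s J x y) : f x ≠ f y := by
  obtain ⟨i, hi, h⟩ := h
  by_cases hx : x ∈ s i
  · exact (hf i hi).ne hx fun hy => h ⟨fun _ => hy, fun _ => hx⟩
  · have hy : y ∈ s i := by tauto
    exact ((hf i hi).ne hy hx).symm

lemma RankConvex.sub {N : ℕ} (hA : RankConvex f A) (hN : ∀ x, f x ≤ N) :
    RankConvex (fun x => N - f x) A := by
  intro x y z hx hz h1 h2
  have := hN x; have := hN y; have := hN z
  simp only at h1 h2
  exact hA hz hx (by omega) (by omega)

lemma leftOf_or_leftOf (hA : RankConvex f A) (hB : RankConvex f B) (h : SetOverlap A B) :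
    LeftOf f A B ∨ LeftOf f B A := by
  obtain ⟨⟨c, hcA, hcB⟩, ⟨a, haA, haB⟩, ⟨b, hb⟩⟩ := h
  have key : ∀ x ∈ A \ B, ∀ z ∈ B \ A, (f x < f c ↔ f c < f z) := by
    intro x hx z hz
    have h1 := hB.ne hcB hx.2
    have h2 := hA.ne hcA hz.2
    constructor <;> intro h <;> by_contra h'
    · rcases le_total (f x) (f z) with h3 | h3
      · exact hz.2 (hA hx.1 hcA h3 (by omega))
      · exact hx.2 (hB hz.1 hcB h3 (by omega))
    · rcases le_total (f x) (f z) with h3 | h3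
      · exact hx.2 (hB hcB hz.1 (by omega) h3)
      · exact hz.2 (hA hcA hx.1 (by omega) h3)
  by_cases hac : f a < f c
  · left
    intro x hx y hy
    have hx' : f x < f c := by
      by_contra hxc
      have h1 := hB.ne hcB hx.2
      exact hxc ((key x hx b hb).2 ((key a ⟨haA, haB⟩ b hb).1 hac))
    by_contra h3
    exact hx.2 (hB hy hcB (not_lt.1 h3) hx'.le)
  · right
    intro x hx y hy
    have hx' : f x < f c := by
      have h1 := hA.ne hcA hx.2
      have := (key a ⟨haA, haB⟩ x hx).not.1 hac
      omega
    by_contra h3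
    exact hx.2 (hA hy hcA (not_lt.1 h3) hx'.le)

lemma LeftOf.not_leftOf (h : LeftOf f A B) (ho : SetOverlap A B) : ¬ LeftOf f B A := by
  obtain ⟨-, ⟨a, ha⟩, ⟨b, hb⟩⟩ := ho
  intro h'
  exact (h a ha b hb.1).asymm (h' b hb a ha.1)

lemma LeftOf.lt_right (h : LeftOf f A B) (ho : SetOverlap A B) (hA : RankConvex f A) {x y : α}
    (hx : x ∈ A) (hy : y ∈ B \ A) : f x < f y := by
  obtain ⟨-, ⟨a, ha⟩, -⟩ := ho
  by_contra h'
  exact hy.2 (hA ha.1 hx (h a ha y hy.1).le (not_lt.1 h'))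

/-- Whether two sets that overlap `B` stick out of `B` on the same side does not depend on the
order: they do if and only if they have a common point outside `B`. -/
lemma leftOf_iff_of_common (hA : RankConvex f A) (hB : RankConvex f B) (hD : RankConvex f D)
    (hAB : SetOverlap A B) (hDB : SetOverlap D B) (h : ∃ v, v ∈ A ∧ v ∈ D ∧ v ∉ B) :
    LeftOf f A B ↔ LeftOf f D B := by
  obtain ⟨v, hvA, hvD, hvB⟩ := h
  have key : ∀ {A D : Set α}, RankConvex f D → SetOverlap D B → v ∈ A → v ∈ D →
      LeftOf f A B → LeftOf f D B := by
    intro A D hD hDB hvA hvD h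
    refine (leftOf_or_leftOf hD hB hDB).resolve_right fun h' => ?_
    obtain ⟨-, -, ⟨b, hb⟩⟩ := hDB
    exact (h v ⟨hvA, hvB⟩ b hb.1).asymm (h' b hb v hvD)
  exact ⟨key hD hDB hvA hvD, key hA hAB hvD hvA⟩

lemma leftOf_iff_of_not_common (hA : RankConvex f A) (hB : RankConvex f B) (hD : RankConvex f D)
    (hAB : SetOverlap A B) (hDB : SetOverlap D B) (h : ¬ ∃ v, v ∈ A ∧ v ∈ D ∧ v ∉ B) :
    LeftOf f A B ↔ LeftOf f B D := by
  obtain ⟨⟨c, hcA, hcB⟩, ⟨a, ha⟩, hBA⟩ := id hAB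
  obtain ⟨⟨d, hdD, hdB⟩, ⟨b, hb⟩, hBD⟩ := id hDB
  constructor
  · intro h1
    refine (leftOf_or_leftOf hB hD hDB.symm).resolve_right fun h2 => h ?_
    rcases le_total (f a) (f b) with h3 | h3
    · exact ⟨b, hA ha.1 hcA h3 (h2 b hb c hcB).le, hb.1, hb.2⟩
    · exact ⟨a, ha.1, hD hb.1 hdD h3 (h1 a ha d hdB).le, ha.2⟩
  · intro h1
    refine (leftOf_or_leftOf hA hB hAB).resolve_right fun h2 => h ?_
    have hca := h2.lt_right hAB.symm hB hcB ha
    have hda := h2.lt_right hAB.symm hB hdB ha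
    have hcb := h1.lt_right hDB.symm hB hcB hb
    have hdb := h1.lt_right hDB.symm hB hdB hb
    rcases le_total (f a) (f b) with h3 | h3
    · exact ⟨a, ha.1, hD hdD hb.1 hda.le h3, ha.2⟩
    · exact ⟨b, hA hcA ha.1 hcb.le h3, hb.1, hb.2⟩

/-- Two orders in which all members of a linked family are intervals, and which agree on the
relative position of one overlapping pair, agree on all of them. -/
lemma leftOf_iff_of_linked (hJ : Linked s J) (h₁ : ∀ i ∈ J, RankConvex f₁ (s i))
    (h₂ : ∀ i ∈ J, RankConvex f₂ (s i)) {a b : ι} (ha : a ∈ J) (hb : b ∈ J)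
    (hab : SetOverlap (s a) (s b)) (hl₁ : LeftOf f₁ (s a) (s b)) (hl₂ : LeftOf f₂ (s a) (s b))
    {i j : ι} (hi : i ∈ J) (hj : j ∈ J) (hij : SetOverlap (s i) (s j)) :
    LeftOf f₁ (s i) (s j) ↔ LeftOf f₂ (s i) (s j) := by
  have flip : ∀ {i j}, i ∈ J → j ∈ J → SetOverlap (s i) (s j) →
      (LeftOf f₁ (s i) (s j) ↔ LeftOf f₂ (s i) (s j)) →
      (LeftOf f₁ (s j) (s i) ↔ LeftOf f₂ (s j) (s i)) := by
    intro i j hi hj hij h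
    have e₁ : LeftOf f₁ (s j) (s i) ↔ ¬ LeftOf f₁ (s i) (s j) :=
      ⟨fun h' => h'.not_leftOf hij.symm,
        fun h' => (leftOf_or_leftOf (h₁ i hi) (h₁ j hj) hij).resolve_left h'⟩
    have e₂ : LeftOf f₂ (s j) (s i) ↔ ¬ LeftOf f₂ (s i) (s j) :=
      ⟨fun h' => h'.not_leftOf hij.symm,
        fun h' => (leftOf_or_leftOf (h₂ i hi) (h₂ j hj) hij).resolve_left h'⟩
    rw [e₁, e₂, h]
  have step : ∀ {i j}, i ∈ J → j ∈ J → SetOverlap (s j) (s i) →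
      (LeftOf f₁ (s j) (s i) ↔ LeftOf f₂ (s j) (s i)) →
      ∀ k ∈ J, SetOverlap (s i) (s k) → (LeftOf f₁ (s i) (s k) ↔ LeftOf f₂ (s i) (s k)) := by
    intro i j hi hj hji h k hk hik
    by_cases hc : ∃ v, v ∈ s j ∧ v ∈ s k ∧ v ∉ s i
    · apply flip hk hi hik.symm
      rw [← leftOf_iff_of_common (h₁ j hj) (h₁ i hi) (h₁ k hk) hji hik.symm hc, h,
        leftOf_iff_of_common (h₂ j hj) (h₂ i hi) (h₂ k hk) hji hik.symm hc]
    · rw [← leftOf_iff_of_not_common (h₁ j hj) (h₁ i hi) (h₁ k hk) hji hik.symm hc, h,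
        leftOf_iff_of_not_common (h₂ j hj) (h₂ i hi) (h₂ k hk) hji hik.symm hc]
  have main : ∀ i, Relation.ReflTransGen (fun a b => b ∈ J ∧ SetOverlap (s a) (s b)) a i →
      i ∈ J ∧ ∀ k ∈ J, SetOverlap (s i) (s k) →
        (LeftOf f₁ (s i) (s k) ↔ LeftOf f₂ (s i) (s k)) := by
    intro i h
    induction h with
    | refl =>
      exact ⟨ha, step ha hb hab.symm (flip ha hb hab ⟨fun _ => hl₂, fun _ => hl₁⟩)⟩
    | tail _ h ih => exact ⟨h.1, step h.1 ih.1 h.2 (ih.2 _ h.1 h.2)⟩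
  exact (main i (hJ a ha i hi)).2 j hj hij

/-- A point outside a linked family lies on one side of its whole union. -/
lemma Linked.lt_iff_of_notMem (hJ : Linked s J) (hf : ∀ i ∈ J, RankConvex f (s i)) {w : α}
    (hw : ∀ i ∈ J, w ∉ s i) {i j : ι} (hi : i ∈ J) (hj : j ∈ J) {x y : α} (hx : x ∈ s i)
    (hy : y ∈ s j) : f x < f w ↔ f y < f w := by
  have h := hJ i hi j hj
  induction h generalizing y with
  | refl => exact (hf i hi).lt_iff_of_notMem hx hy (hw i hi)
  | @tail b c hb h ih =>
    have hbJ : b ∈ J := by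
      rcases Relation.ReflTransGen.cases_tail hb with rfl | ⟨_, _, h⟩
      · exact hi
      · exact h.1
    obtain ⟨⟨z, hz, hz'⟩, -⟩ := h.2
    refine (ih hbJ hz).trans ?_
    exact (hf c hj).lt_iff_of_notMem hz' hy (hw c hj)

/-- The order of two points that are separated by a linked family covering them is determined by the
relative positions of its overlapping members. -/
lemma lt_iff_of_leftOf_iff (hJ : Linked s J) (h₁ : ∀ i ∈ J, RankConvex f₁ (s i))
    (h₂ : ∀ i ∈ J, RankConvex f₂ (s i))
    (h : ∀ i ∈ J, ∀ j ∈ J, SetOverlap (s i) (s j) →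
      (LeftOf f₁ (s i) (s j) ↔ LeftOf f₂ (s i) (s j)))
    {x y : α} (hx : ∃ i ∈ J, x ∈ s i) (hy : ∃ i ∈ J, y ∈ s i) (hxy : Separated s J x y) :
    f₁ x < f₁ y ↔ f₂ x < f₂ y := by
  have main : ∀ {i j}, i ∈ J → j ∈ J → ∀ {x y : α}, x ∈ s i → y ∉ s i → y ∈ s j →
      (f₁ x < f₁ y ↔ f₂ x < f₂ y) := by
    intro i j hi hj x y hx hy hyj
    have hp := hJ i hi j hj
    induction hp using Relation.ReflTransGen.head_induction_on generalizing x with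
    | refl => exact absurd hyj hy
    | @head i k h' _ ih =>
      by_cases hyk : y ∈ s k
      · have e : ∀ {f}, RankConvex f (s i) → RankConvex f (s k) →
            (f x < f y ↔ LeftOf f (s i) (s k)) := by
          intro f hfi hfk
          constructor
          · intro hlt
            refine (leftOf_or_leftOf hfi hfk h'.2).resolve_right fun hl => ?_
            exact hlt.asymm (hl y ⟨hyk, hy⟩ x hx)
          · intro hl
            exact hl.lt_right h'.2 hfi hx ⟨hyk, hy⟩
        rw [e (h₁ i hi) (h₁ k h'.1), e (h₂ i hi) (h₂ k h'.1)]
        exact h i hi k h'.1 h'.2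
      · obtain ⟨⟨z, hz, hz'⟩, -⟩ := h'.2
        rw [(h₁ i hi).lt_iff_of_notMem hx hz hy, (h₂ i hi).lt_iff_of_notMem hx hz hy]
        exact ih h'.1 hz' hyk
  obtain ⟨i, hi, hxi⟩ := hx
  obtain ⟨j, hj, hyj⟩ := hy
  obtain ⟨k, hk, hs⟩ := id hxy
  by_cases hxk : x ∈ s k
  · exact main hk hj hxk (fun hyk => hs ⟨fun _ => hyk, fun _ => hxk⟩) hyj
  · have hyk : y ∈ s k := by tauto
    have := main hk hi hyk hxk hxi
    have := RankConvex.ne_of_separated h₁ hxy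
    have := RankConvex.ne_of_separated h₂ hxy
    omega

/-- Two orders in which all members of a linked family are intervals agree up to reversal on the
points that the family covers and separates. -/
theorem Linked.order_unique [Finite α] (hJ : Linked s J) (h₁ : ∀ i ∈ J, RankConvex f₁ (s i))
    (h₂ : ∀ i ∈ J, RankConvex f₂ (s i)) {a b : ι} (ha : a ∈ J) (hb : b ∈ J)
    (hab : SetOverlap (s a) (s b)) :
    (∀ x y, (∃ i ∈ J, x ∈ s i) → (∃ i ∈ J, y ∈ s i) → Separated s J x y →
      (f₁ x < f₁ y ↔ f₂ x < f₂ y)) ∨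
    (∀ x y, (∃ i ∈ J, x ∈ s i) → (∃ i ∈ J, y ∈ s i) → Separated s J x y →
      (f₁ x < f₁ y ↔ f₂ y < f₂ x)) := by
  obtain ⟨N, hN⟩ : ∃ N, ∀ x, f₂ x ≤ N := by
    obtain ⟨N, hN⟩ := (Set.finite_range f₂).bddAbove
    exact ⟨N, fun x => hN ⟨x, rfl⟩⟩
  have main : ∀ {f₂ : α → ℕ}, (∀ i ∈ J, RankConvex f₂ (s i)) → ∀ {a b}, a ∈ J → b ∈ J →
      SetOverlap (s a) (s b) → LeftOf f₁ (s a) (s b) → LeftOf f₂ (s a) (s b) →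
      ∀ x y, (∃ i ∈ J, x ∈ s i) → (∃ i ∈ J, y ∈ s i) → Separated s J x y →
        (f₁ x < f₁ y ↔ f₂ x < f₂ y) :=
    fun h₂ _ _ ha hb hab hl₁ hl₂ x y hx hy hxy =>
      lt_iff_of_leftOf_iff hJ h₁ h₂
        (fun _ hi _ hj hij => leftOf_iff_of_linked hJ h₁ h₂ ha hb hab hl₁ hl₂ hi hj hij) hx hy hxy
  have opp : ∀ {a b}, a ∈ J → b ∈ J → SetOverlap (s a) (s b) → LeftOf f₁ (s a) (s b) →
      LeftOf f₂ (s b) (s a) →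
      ∀ x y, (∃ i ∈ J, x ∈ s i) → (∃ i ∈ J, y ∈ s i) → Separated s J x y →
        (f₁ x < f₁ y ↔ f₂ y < f₂ x) := by
    intro a b ha hb hab hl₁ hl₂ x y hx hy hxy
    have h₂' : ∀ i ∈ J, RankConvex (fun x => N - f₂ x) (s i) := fun i hi => (h₂ i hi).sub hN
    rw [main h₂' ha hb hab hl₁ ?_ x y hx hy hxy]
    · have := hN x; have := hN y
      omega
    · refine (leftOf_or_leftOf (h₂' a ha) (h₂' b hb) hab).resolve_right fun hl => ?_
      obtain ⟨-, ⟨u, hu⟩, ⟨v, hv⟩⟩ := hab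
      have : N - f₂ v < N - f₂ u := hl v hv u hu.1
      have := hl₂ v hv u hu.1
      have := hN u; have := hN v
      omega
  rcases leftOf_or_leftOf (h₁ a ha) (h₁ b hb) hab with hl₁ | hl₁ <;>
    rcases leftOf_or_leftOf (h₂ a ha) (h₂ b hb) hab with hl₂ | hl₂
  · exact Or.inl (main h₂ ha hb hab hl₁ hl₂)
  · exact Or.inr (opp ha hb hab hl₁ hl₂)
  · exact Or.inr (opp hb ha hab.symm hl₁ hl₂)
  · exact Or.inl (main h₂ hb ha hab.symm hl₁ hl₂)

/-- A set that overlaps no member of a linked family contains their union, or each member contains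
it or is disjoint from it. -/
lemma Linked.union_subset_or (hJ : Linked s J) {R : Set α}
    (hR : ∀ i ∈ J, ¬ SetOverlap (s i) R) :
    (∀ i ∈ J, s i ⊆ R) ∨ ∀ i ∈ J, R ⊆ s i ∨ Disjoint R (s i) := by
  by_cases h : ∃ i ∈ J, s i ⊆ R ∧ (s i).Nonempty
  · left
    obtain ⟨i, hi, hiR, hine⟩ := h
    intro j hj
    have hp := hJ i hi j hj
    induction hp with
    | refl => exact hiR
    | @tail b c hb h ih =>
      have hbJ : b ∈ J := by
        rcases Relation.ReflTransGen.cases_tail hb with rfl | ⟨_, _, h⟩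
        · exact hi
        · exact h.1
      have hbR := ih hbJ
      intro v hv
      by_contra hvR
      refine hR c hj ⟨?_, ⟨v, hv, hvR⟩, ?_⟩
      · obtain ⟨z, hz, hz'⟩ := h.2.1
        exact ⟨z, hz', hbR hz⟩
      · obtain ⟨z, hz, hz'⟩ := h.2.2.1
        exact ⟨z, hbR hz, hz'⟩
  · right
    intro i hi
    by_contra hc
    rw [not_or, Set.not_disjoint_iff, Set.not_subset] at hc
    obtain ⟨⟨v, hvR, hvi⟩, w, hwR, hwi⟩ := hc
    refine hR i hi ⟨⟨w, hwi, hwR⟩, ?_, ⟨v, hvR, hvi⟩⟩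
    by_contra hs
    rw [Set.not_nonempty_iff_eq_empty, Set.sdiff_eq_empty] at hs
    exact h ⟨i, hi, hs, ⟨w, hwi⟩⟩

/-- A function into a linear order can be replaced by a rank function with the same comparisons. -/
lemma exists_rank {β : Type*} [LinearOrder β] [Finite α] (f : α → β) :
    ∃ g : α → ℕ, ∀ x y, g x ≤ g y ↔ f x ≤ f y := by
  classical
  have := Fintype.ofFinite α
  refine ⟨fun x => (Finset.univ.filter fun y => f y < f x).card,
    fun x y => ⟨fun h => ?_, fun h => ?_⟩⟩
  · by_contra h'
    rw [not_le] at h'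
    refine absurd h (not_le.2 (Finset.card_lt_card ?_))
    rw [Finset.ssubset_iff_of_subset]
    · exact ⟨y, by simpa using h', by simp⟩
    · intro z hz
      simp only [Finset.mem_filter, Finset.mem_univ, true_and] at hz ⊢
      exact hz.trans h'
  · refine Finset.card_le_card fun z hz => ?_
    simp only [Finset.mem_filter, Finset.mem_univ, true_and] at hz ⊢
    exact hz.trans_le h

/-- A rank function can be chosen to vanish exactly outside the union of the family and to be
constant on points that the family does not separate. -/
lemma exists_tight_rank (hf : ∀ i ∈ J, RankConvex f (s i)) :
    ∃ g : α → ℕ, (∀ i ∈ J, RankConvex g (s i)) ∧ (∀ x, g x = 0 ↔ ∀ i ∈ J, x ∉ s i) ∧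
      ∀ x y, ¬ Separated s J x y → g x = g y := by
  classical
  let S : Setoid α := ⟨fun x y => ¬ Separated s J x y, fun x h => by
      obtain ⟨i, _, h⟩ := h; exact h Iff.rfl, fun h h' => h h'.symm,
      fun h h' h'' => h' (h''.trans_left h)⟩
  let rep : α → α := fun x => (Quotient.mk S x).out
  have hrep : ∀ x, ∀ i ∈ J, (rep x ∈ s i ↔ x ∈ s i) := by
    intro x i hi
    have : S (rep x) x := Quotient.exact (Quotient.out_eq (Quotient.mk S x))
    by_contra h
    exact this ⟨i, hi, h⟩
  have hrep' : ∀ x y, ¬ Separated s J x y → rep x = rep y := by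
    intro x y h
    have : Quotient.mk S x = Quotient.mk S y := Quotient.sound h
    simp only [rep, this]
  refine ⟨fun x => if ∀ i ∈ J, x ∉ s i then 0 else f (rep x) + 1, ?_, ?_, ?_⟩
  · intro i hi x y z hx hz h1 h2
    have hx' : ¬ ∀ i ∈ J, x ∉ s i := fun h => h i hi hx
    have hz' : ¬ ∀ i ∈ J, z ∉ s i := fun h => h i hi hz
    simp only [if_neg hx', if_neg hz'] at h1 h2
    split_ifs at h1 h2 with h
    · omega
    · rw [← hrep y i hi]
      exact hf i hi ((hrep x i hi).2 hx) ((hrep z i hi).2 hz) (by omega) (by omega)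
  · intro x
    simp only
    split_ifs with h
    · exact ⟨fun _ => h, fun _ => rfl⟩
    · exact ⟨fun h' => h'.elim, fun h' => absurd h' h⟩
  · intro x y h
    simp only [hrep' x y h]
    congr 1
    refine propext ⟨fun h' i hi hy => h ⟨i, hi, ?_⟩, fun h' i hi hx => h ⟨i, hi, ?_⟩⟩
    · exact fun h'' => h' i hi (h''.2 hy)
    · exact fun h'' => h' i hi (h''.1 hx)

/-- Two families with no overlaps between them, the first of them linked, can be ordered together if
each can be ordered: contract the union of the first family to a point of an order of the second,
and refine the order of the first inside it by that of the second. -/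
lemma exists_rank_union [Finite α] {J' : Set ι} (hJ : Linked s J)
    (h₁ : ∃ f : α → ℕ, ∀ i ∈ J, RankConvex f (s i))
    (h₂ : ∃ f : α → ℕ, ∀ i ∈ J', RankConvex f (s i))
    (h : ∀ i ∈ J, ∀ j ∈ J', ¬ SetOverlap (s i) (s j)) :
    ∃ f : α → ℕ, ∀ i ∈ J ∪ J', RankConvex f (s i) := by
  classical
  obtain ⟨f, hf⟩ := h₂
  obtain ⟨f₀, hf₀⟩ := h₁
  obtain ⟨k, hk, hk0, hkt⟩ := exists_tight_rank hf₀
  by_cases hU : ∃ u, ∃ i ∈ J, u ∈ s i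
  swap
  · refine ⟨f, fun i hi => hi.elim (fun hi x y z hx => (hU ⟨x, i, hi, hx⟩).elim) (hf i)⟩
  obtain ⟨u, hu⟩ := hU
  let rep : α → α := fun v => if ∃ i ∈ J, v ∈ s i then u else v
  obtain ⟨g, hg⟩ := exists_rank (fun v => toLex (f (rep v), toLex (k v, f v)))
  have hlex : ∀ x y, g x ≤ g y ↔
      f (rep x) < f (rep y) ∨ f (rep x) = f (rep y) ∧
        (k x < k y ∨ k x = k y ∧ f x ≤ f y) := by
    intro x y
    rw [hg, Prod.Lex.toLex_le_toLex, Prod.Lex.toLex_le_toLex]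
  have hrepU : ∀ {v}, (∃ i ∈ J, v ∈ s i) → rep v = u := fun h => if_pos h
  refine ⟨g, fun i hi => ?_⟩
  intro x y z hx hz hxy hyz
  rw [hlex] at hxy hyz
  rcases hi with hi | hi
  · have e1 := hrepU ⟨i, hi, hx⟩
    have e2 := hrepU ⟨i, hi, hz⟩
    rw [e1] at hxy
    rw [e2] at hyz
    exact hk i hi hx hz (by omega) (by omega)
  · rcases hJ.union_subset_or (R := s i) (fun j hj => h j hj i hi) with hs | hs
    · have hr : ∀ v, rep v ∈ s i ↔ v ∈ s i := by
        intro v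
        by_cases hv : ∃ j ∈ J, v ∈ s j
        · rw [hrepU hv]
          obtain ⟨j, hj, hvj⟩ := hv
          obtain ⟨j', hj', huj⟩ := hu
          exact ⟨fun _ => hs j hj hvj, fun _ => hs j' hj' huj⟩
        · simp only [rep, if_neg hv]
      rw [← hr] at hx hz ⊢
      exact hf i hi hx hz (by omega) (by omega)
    · have hsep : ∀ {v w}, v ∈ s i → w ∈ s i → ¬ Separated s J v w := by
        rintro v w hv hw ⟨j, hj, hc⟩
        rcases hs j hj with h' | h'
        · exact hc ⟨fun _ => h' hw, fun _ => h' hv⟩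
        · rw [Set.disjoint_left] at h'
          exact hc ⟨fun h'' => (h' hv h'').elim, fun h'' => (h' hw h'').elim⟩
      have hkxz := hkt x z (hsep hx hz)
      by_cases hxU : ∃ j ∈ J, x ∈ s j
      · obtain ⟨j, hj, hxj⟩ := hxU
        have hzj : z ∈ s j := by
          by_contra hc
          exact hsep hx hz ⟨j, hj, fun h' => hc (h'.1 hxj)⟩
        rw [hrepU ⟨j, hj, hxj⟩] at hxy
        rw [hrepU ⟨j, hj, hzj⟩] at hyz
        exact hf i hi hx hz (by omega) (by omega)
      · have hzU : ¬ ∃ j ∈ J, z ∈ s j := by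
          rintro ⟨j, hj, hzj⟩
          exact hsep hx hz ⟨j, hj, fun h' => hxU ⟨j, hj, h'.2 hzj⟩⟩
        simp only [rep, if_neg hxU, if_neg hzU] at hxy hyz
        by_cases hyU : ∃ j ∈ J, y ∈ s j
        · have hky : k y ≠ 0 := fun h0 => by
            obtain ⟨j, hj, hyj⟩ := hyU
            exact (hk0 y).1 h0 j hj hyj
          have hkz : k z = 0 := (hk0 z).2 fun j hj hzj => hzU ⟨j, hj, hzj⟩
          -- `y` lies in the contracted union, which would be tied with `z`.
          rw [if_pos hyU] at hxy hyz
          have hui : u ∈ s i := hf i hi hx hz (by omega) (by omega)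
          obtain ⟨j, hj, huj⟩ := hu
          rcases hs j hj with h' | h'
          · exact (hxU ⟨j, hj, h' hx⟩).elim
          · exact (Set.disjoint_left.1 h' hui huj).elim
        · rw [if_neg hyU] at hxy hyz
          exact hf i hi hx hz (by omega) (by omega)

end Order

/-! ### Rows as splits, and circular orders -/

section Splits

variable {ι V : Type*} (r : ι → V → Bool)

/-- The side of the split `r i` that does not contain the base point `e`. -/
def side (e : V) (i : ι) : Set V := {v | r i v ≠ r i e}

/-- Two splits cross if all four of their quadrants are nonempty. -/
def Crossing (i j : ι) : Prop := ∀ a b : Bool, ∃ v, r i v = a ∧ r j v = b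

/-- The splits in `J` are arcs of a common circular order, which is given as a linear order of the
points other than `e`. This does not depend on `e`: see `Arcs.rebase`. -/
def Arcs (e : V) (J : Set ι) : Prop := ∃ f : V → ℕ, ∀ i ∈ J, RankConvex f (side r e i)

variable {r}

lemma mem_side {e v : V} {i : ι} : v ∈ side r e i ↔ r i v ≠ r i e := Iff.rfl

lemma notMem_side {e v : V} {i : ι} : v ∉ side r e i ↔ r i v = r i e := by simp [mem_side]

lemma base_notMem_side {e : V} {i : ι} : e ∉ side r e i := by simp [mem_side]

lemma mem_side_iff_mem_side {e x y : V} {i : ι} :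
    (x ∈ side r e i ↔ y ∈ side r e i) ↔ r i x = r i y := by
  simp only [mem_side]
  cases r i x <;> cases r i y <;> cases r i e <;> simp

lemma separated_side {e x y : V} {J : Set ι} :
    Separated (side r e) J x y ↔ ∃ i ∈ J, r i x ≠ r i y := by
  simp only [Separated, mem_side_iff_mem_side, ne_eq]

lemma separated_side_base {e e' x y : V} {J : Set ι} :
    Separated (side r e) J x y ↔ Separated (side r e') J x y := by
  rw [separated_side, separated_side]

lemma setOverlap_side {e : V} {i j : ι} :
    SetOverlap (side r e i) (side r e j) ↔ Crossing r i j := by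
  constructor
  · rintro ⟨⟨c, hc, hc'⟩, ⟨a, ha, ha'⟩, ⟨b, hb, hb'⟩⟩ p q
    rw [mem_side] at hc hc' ha hb
    rw [notMem_side] at ha' hb'
    by_cases hp : p = r i e <;> by_cases hq : q = r j e
    · exact ⟨e, hp.symm, hq.symm⟩
    · refine ⟨b, by rw [hb', hp], ?_⟩
      revert hb hq; cases r j b <;> cases q <;> cases r j e <;> simp
    · refine ⟨a, ?_, by rw [ha', hq]⟩
      revert ha hp; cases r i a <;> cases p <;> cases r i e <;> simp
    · refine ⟨c, ?_, ?_⟩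
      · revert hc hp; cases r i c <;> cases p <;> cases r i e <;> simp
      · revert hc' hq; cases r j c <;> cases q <;> cases r j e <;> simp
  · intro h
    obtain ⟨c, hc, hc'⟩ := h (!r i e) (!r j e)
    obtain ⟨a, ha, ha'⟩ := h (!r i e) (r j e)
    obtain ⟨b, hb, hb'⟩ := h (r i e) (!r j e)
    refine ⟨⟨c, ?_, ?_⟩, ⟨a, ?_, ?_⟩, ⟨b, ?_, ?_⟩⟩ <;> simp [mem_side, *]

lemma linked_side_base {e e' : V} {J : Set ι} (h : Linked (side r e) J) :
    Linked (side r e') J := by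
  intro i hi j hj
  have := h i hi j hj
  simp only [setOverlap_side] at this ⊢
  exact this

lemma Arcs.mono {e : V} {J J' : Set ι} (h : Arcs r e J) (hJ : J' ⊆ J) : Arcs r e J' := by
  obtain ⟨f, hf⟩ := h
  exact ⟨f, fun i hi => hf i (hJ hi)⟩

/-- The circular order given by `f`, cut open at `x`; the points tied with `x` come first. -/
def rotate (f : V → ℕ) (N : ℕ) (x v : V) : ℕ :=
  if f v = f x then 0 else if f x < f v then f v - f x else f v + N

lemma RankConvex.rotate {f : V → ℕ} {N : ℕ} {e x : V} {i : ι}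
    (hf : RankConvex f (side r e i)) (hN : ∀ v, f v < N) :
    RankConvex (TuckerPQ.rotate f N x) (side r x i) := by
  intro u v w hu hw h1 h2
  have hNu := hN u; have hNv := hN v; have hNw := hN w
  by_cases hx : x ∈ side r e i
  · have hmem : ∀ {p}, p ∈ side r x i ↔ p ∉ side r e i := by
      intro p
      simp only [mem_side] at hx ⊢
      revert hx
      cases r i x <;> cases r i e <;> cases r i p <;> simp
    rw [hmem] at hu hw ⊢
    intro hv
    have := hf.ne hx hu
    have := hf.ne hx hw
    have e1 : f x < f u ↔ ¬ f u < f x := by omega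
    have a1 : ¬ (f x ≤ f u ∧ f u ≤ f v) := fun h => hu (hf hx hv h.1 h.2)
    have a2 : ¬ (f v ≤ f w ∧ f w ≤ f x) := fun h => hw (hf hv hx h.1 h.2)
    unfold TuckerPQ.rotate at h1 h2
    split_ifs at h1 h2 <;> omega
  · have hmem : ∀ {p}, p ∈ side r x i ↔ p ∈ side r e i := by
      intro p
      simp only [mem_side] at hx ⊢
      revert hx
      cases r i x <;> cases r i e <;> cases r i p <;> simp
    rw [hmem] at hu hw ⊢
    have := hf.lt_iff_of_notMem hu hw hx
    have := hf.ne hu hx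
    have := hf.ne hw hx
    unfold TuckerPQ.rotate at h1 h2
    refine hf hu hw ?_ ?_ <;> split_ifs at h1 h2 <;> omega

lemma exists_bound [Finite V] (f : V → ℕ) : ∃ N, ∀ v, f v < N := by
  obtain ⟨N, hN⟩ := (Set.finite_range f).bddAbove
  exact ⟨N + 1, fun x => Nat.lt_succ_of_le (hN ⟨x, rfl⟩)⟩

/-- Whether splits are arcs of a circular order does not depend on the base point. -/
lemma Arcs.rebase [Finite V] {e e' : V} {J : Set ι} (h : Arcs r e J) : Arcs r e' J := by
  obtain ⟨f, hf⟩ := h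
  obtain ⟨N, hN⟩ := exists_bound f
  exact ⟨rotate f N e', fun i hi => (hf i hi).rotate hN⟩

/-! ### Three rows -/

/-- An order of the Venn regions of three sets of which the first two meet only inside the third;
`p` is the place of the points that are in the third set only. -/
def vennRank (p : ℕ) : Bool × Bool × Bool → ℕ
  | (false, false, false) => 0
  | (true, false, false) => 1
  | (true, false, true) => 2
  | (true, true, _) => 3
  | (false, true, true) => 4
  | (false, true, false) => 5
  | (false, false, true) => p

set_option synthInstance.maxHeartbeats 400000 in
set_option synthInstance.maxSize 4096 in
/-- The three sets become intervals when one region, lying in an odd number of them, is empty and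
the points of the third set only are placed accordingly. -/
lemma vennRank_convex : ∀ q ∈ [(3, true, true, true), (1, true, false, false),
      (5, false, true, false), (1, false, false, true)],
    ∀ u v w : Bool × Bool × Bool, u ∉ [q.2, (true, true, false)] →
      v ∉ [q.2, (true, true, false)] → w ∉ [q.2, (true, true, false)] →
      vennRank q.1 u ≤ vennRank q.1 v → vennRank q.1 v ≤ vennRank q.1 w →
      (u.1 = true → w.1 = true → v.1 = true) ∧ (u.2.1 = true → w.2.1 = true → v.2.1 = true) ∧
      (u.2.2 = true → w.2.2 = true → v.2.2 = true) := by
  decide +kernel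

lemma exists_rank_of_inter_subset {A B D : Set V} (h : A ∩ B ⊆ D)
    (h' : A ∩ B ∩ D = ∅ ∨ A ⊆ B ∪ D ∨ B ⊆ A ∪ D ∨ D ⊆ A ∪ B) :
    ∃ f : V → ℕ, RankConvex f A ∧ RankConvex f B ∧ RankConvex f D := by
  classical
  have main : ∀ q ∈ [(3, true, true, true), (1, true, false, false),
      (5, false, true, false), (1, false, false, true)],
      (∀ v, (decide (v ∈ A), decide (v ∈ B), decide (v ∈ D)) ≠ q.2) →
      ∃ f : V → ℕ, RankConvex f A ∧ RankConvex f B ∧ RankConvex f D := by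
    intro q hq hv
    have hv' : ∀ v, (decide (v ∈ A), decide (v ∈ B), decide (v ∈ D)) ∉
        [q.2, (true, true, false)] := by
      intro v hc
      rcases List.mem_pair.1 hc with hc | hc
      · exact hv v hc
      · simp only [Prod.mk.injEq, decide_eq_true_eq, decide_eq_false_iff_not] at hc
        exact hc.2.2 (h ⟨hc.1, hc.2.1⟩)
    refine ⟨fun v => vennRank q.1 (decide (v ∈ A), decide (v ∈ B), decide (v ∈ D)), ?_, ?_, ?_⟩ <;>
      intro x y z hx hz h1 h2 <;>
      have := vennRank_convex q hq _ _ _ (hv' x) (hv' y) (hv' z) h1 h2 <;>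
      simp only [decide_eq_true_eq] at this
    · exact this.1 hx hz
    · exact this.2.1 hx hz
    · exact this.2.2 hx hz
  rcases h' with h' | h' | h' | h'
  · refine main (3, (true, true, true)) (by simp) fun v hc => ?_
    simp only [Prod.mk.injEq, decide_eq_true_eq] at hc
    have : v ∈ A ∩ B ∩ D := ⟨⟨hc.1, hc.2.1⟩, hc.2.2⟩
    rw [h'] at this
    exact this
  · refine main (1, (true, false, false)) (by simp) fun v hc => ?_
    simp only [Prod.mk.injEq, decide_eq_true_eq, decide_eq_false_iff_not] at hc
    exact (h' hc.1).elim hc.2.1 hc.2.2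
  · refine main (5, (false, true, false)) (by simp) fun v hc => ?_
    simp only [Prod.mk.injEq, decide_eq_true_eq, decide_eq_false_iff_not] at hc
    exact (h' hc.2.1).elim hc.1 hc.2.2
  · refine main (1, (false, false, true)) (by simp) fun v hc => ?_
    simp only [Prod.mk.injEq, decide_eq_true_eq, decide_eq_false_iff_not] at hc
    exact (h' hc.2.2).elim hc.1 hc.2.1

/-- Three sets that are not intervals of a common order have all three regions lying in exactly two
of them, or all four regions lying in an odd number of them. -/
theorem venn_of_not_exists_rank {A B D : Set V}
    (h : ¬ ∃ f : V → ℕ, RankConvex f A ∧ RankConvex f B ∧ RankConvex f D) :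
    ((∃ v, v ∈ A ∧ v ∈ B ∧ v ∉ D) ∧ (∃ v, v ∈ B ∧ v ∈ D ∧ v ∉ A) ∧ ∃ v, v ∈ D ∧ v ∈ A ∧ v ∉ B) ∨
    ((∃ v, v ∈ A ∧ v ∈ B ∧ v ∈ D) ∧ (∃ v, v ∈ A ∧ v ∉ B ∧ v ∉ D) ∧
      (∃ v, v ∈ B ∧ v ∉ D ∧ v ∉ A) ∧ ∃ v, v ∈ D ∧ v ∉ A ∧ v ∉ B) := by
  by_contra hc
  rw [not_or] at hc
  obtain ⟨h1, h2⟩ := hc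
  have odd : A ∩ B ∩ D = ∅ ∨ A ⊆ B ∪ D ∨ B ⊆ A ∪ D ∨ D ⊆ A ∪ B := by
    by_contra hc
    simp only [not_or, ← Set.nonempty_iff_ne_empty, Set.not_subset, Set.mem_union] at hc
    obtain ⟨⟨a, ⟨ha, ha'⟩, ha''⟩, ⟨b, hb⟩, ⟨c, hc⟩, ⟨d, hd⟩⟩ := hc
    exact h2 ⟨⟨a, ha, ha', ha''⟩, ⟨b, hb.1, hb.2.1, hb.2.2⟩, ⟨c, hc.1, hc.2.2, hc.2.1⟩,
      d, hd.1, hd.2.1, hd.2.2⟩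
  have ev : A ∩ B ⊆ D ∨ B ∩ D ⊆ A ∨ D ∩ A ⊆ B := by
    by_contra hc
    simp only [not_or, Set.not_subset] at hc
    obtain ⟨⟨a, ⟨ha, ha'⟩, ha''⟩, ⟨b, ⟨hb, hb'⟩, hb''⟩, ⟨c, ⟨hc, hc'⟩, hc''⟩⟩ := hc
    exact h1 ⟨⟨a, ha, ha', ha''⟩, ⟨b, hb, hb', hb''⟩, c, hc, hc', hc''⟩
  rcases ev with he | he | he
  · exact h (exists_rank_of_inter_subset he odd)
  · obtain ⟨f, h3, h4, h5⟩ := exists_rank_of_inter_subset he (by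
      rw [Set.inter_comm (B ∩ D), ← Set.inter_assoc, Set.union_comm D A, Set.union_comm B A]
      tauto)
    exact h ⟨f, h5, h3, h4⟩
  · obtain ⟨f, h3, h4, h5⟩ := exists_rank_of_inter_subset he (by
      rw [Set.inter_comm D A, Set.inter_right_comm, Set.union_comm D B]
      rcases odd with h | h | h | h
      · exact Or.inl h
      · rw [Set.union_comm] at h
        exact Or.inr (Or.inr (Or.inl (by rwa [Set.union_comm])))
      · exact Or.inr (Or.inr (Or.inr (by rwa [Set.union_comm])))
      · exact Or.inr (Or.inl h))
    exact h ⟨f, h4, h5, h3⟩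

end Splits

/-! ### Inserting two rows into a linked family -/

section Conflict

variable {ι V : Type*} {r : ι → V → Bool}

/-- The reversal of a tight rank function, in which the points outside the union still come first.
-/
lemma exists_tight_rank_rev {s : ι → Set V} {J : Set ι} [Finite V] {f : V → ℕ}
    (hf : ∀ i ∈ J, RankConvex f (s i)) (h0 : ∀ x, f x = 0 ↔ ∀ i ∈ J, x ∉ s i)
    (ht : ∀ x y, ¬ Separated s J x y → f x = f y) :
    ∃ g : V → ℕ, (∀ i ∈ J, RankConvex g (s i)) ∧ (∀ x, g x = 0 ↔ ∀ i ∈ J, x ∉ s i) ∧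
      (∀ x y, ¬ Separated s J x y → g x = g y) ∧
      ∀ x y, f x ≠ 0 → f y ≠ 0 → (g x < g y ↔ f y < f x) := by
  obtain ⟨N, hN⟩ := exists_bound f
  refine ⟨fun x => if f x = 0 then 0 else N - f x, ?_, ?_, ?_, ?_⟩
  · intro i hi x y z hx hz h1 h2
    have hx0 : f x ≠ 0 := fun h => (h0 x).1 h i hi hx
    have hz0 : f z ≠ 0 := fun h => (h0 z).1 h i hi hz
    have := hN x; have := hN y; have := hN z
    simp only [if_neg hx0, if_neg hz0] at h1 h2
    split_ifs at h1 h2 with h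
    · omega
    · exact hf i hi hz hx (by omega) (by omega)
  · intro x
    rw [← h0 x]
    have := hN x
    simp only
    split_ifs <;> omega
  · intro x y h
    simp only [ht x y h]
  · intro x y hx hy
    have := hN x; have := hN y
    simp only [if_neg hx, if_neg hy]
    omega

/-- One of the four quadrants of two crossing splits does not meet both sides of a third split, if
the three are arcs of a circular order. -/
lemma exists_pure_quadrant {e₀ : V} {A B W : ι} (h : Arcs r e₀ {A, B, W}) (hAB : Crossing r A B) :
    ∃ e, ∀ v, r A v = r A e → r B v = r B e → r W v = r W e := by
  by_contra hc
  push Not at hc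
  obtain ⟨f, hf⟩ := h
  have part : ∀ p, (∃ q, (q ∈ side r e₀ A ↔ p ∈ side r e₀ A) ∧
      (q ∈ side r e₀ B ↔ p ∈ side r e₀ B) ∧ q ∈ side r e₀ W) ∧
      ∃ q, (q ∈ side r e₀ A ↔ p ∈ side r e₀ A) ∧
      (q ∈ side r e₀ B ↔ p ∈ side r e₀ B) ∧ q ∉ side r e₀ W := by
    intro p
    obtain ⟨q, h1, h2, h3⟩ := hc p
    by_cases hp : p ∈ side r e₀ W
    · refine ⟨⟨p, Iff.rfl, Iff.rfl, hp⟩, q, by simp [mem_side, h1], by simp [mem_side, h2], ?_⟩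
      rw [mem_side] at hp ⊢
      revert h3 hp
      cases r W p <;> cases r W q <;> cases r W e₀ <;> simp
    · refine ⟨⟨q, by simp [mem_side, h1], by simp [mem_side, h2], ?_⟩, p, Iff.rfl, Iff.rfl, hp⟩
      rw [mem_side] at hp ⊢
      revert h3 hp
      cases r W p <;> cases r W q <;> cases r W e₀ <;> simp
  have main : ∀ {A B : ι}, RankConvex f (side r e₀ A) →
      SetOverlap (side r e₀ A) (side r e₀ B) → LeftOf f (side r e₀ A) (side r e₀ B) →
      (∀ p, (∃ q, (q ∈ side r e₀ A ↔ p ∈ side r e₀ A) ∧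
        (q ∈ side r e₀ B ↔ p ∈ side r e₀ B) ∧ q ∈ side r e₀ W) ∧
        ∃ q, (q ∈ side r e₀ A ↔ p ∈ side r e₀ A) ∧
        (q ∈ side r e₀ B ↔ p ∈ side r e₀ B) ∧ q ∉ side r e₀ W) → False := by
    intro A B hA ho hl part
    obtain ⟨⟨c, hc⟩, ⟨a, ha⟩, ⟨b, hb⟩⟩ := id ho
    obtain ⟨a', ha1, ha2, ha3⟩ := (part a).1
    obtain ⟨c', hc1, hc2, hc3⟩ := (part c).2
    obtain ⟨b', hb1, hb2, hb3⟩ := (part b).1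
    refine hc3 (hf W (by simp) ha3 hb3 (hl a' ?_ c' (hc2.2 hc.2)).le
      (hl.lt_right ho hA (hc1.2 hc.1) ?_).le)
    · exact ⟨ha1.2 ha.1, fun h => ha.2 (ha2.1 h)⟩
    · exact ⟨hb2.2 hb.1, fun h => hb.2 (hb1.1 h)⟩
  have ho := (setOverlap_side (e := e₀)).2 hAB
  have hA := hf A (by simp)
  have hB := hf B (by simp)
  rcases leftOf_or_leftOf hA hB ho with hl | hl
  · exact main hA ho hl part
  · refine main hB ho.symm hl fun p => ?_
    obtain ⟨⟨q, h1, h2, h3⟩, q', h1', h2', h3'⟩ := part p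
    exact ⟨⟨q, h2, h1, h3⟩, q', h2', h1', h3'⟩

/-- Suppose that either of the splits `W`, `W'` can be added to the linked family `K`, but not both.
Seen from a suitable base point `x`, there is a point `y` outside the union of `K` that lies in `W`
and in `W'`, while `W` meets the union in an initial and `W'` in a final segment of its order. The
reason: the tight orders of `K ∪ {W}` and `K ∪ {W'}` can be added unless they disagree on a pair
`x`, `y`, which then lies in a single atom of `K` and is split by both `W` and `W'`. -/
theorem exists_conflict [Finite V] {e₀ : V} {K : Set ι} {W W' A B : ι}
    (hK₀ : Linked (side r e₀) K) (hA : A ∈ K) (hB : B ∈ K) (hAB : Crossing r A B)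
    (hW' : ∃ i ∈ K, Crossing r W' i) (h1 : Arcs r e₀ (insert W K)) (h2 : Arcs r e₀ (insert W' K))
    (h3 : ¬ Arcs r e₀ (insert W (insert W' K))) :
    ∃ (x y : V) (g : V → ℕ), (∀ i ∈ K, RankConvex g (side r x i)) ∧ (∀ i ∈ K, y ∉ side r x i) ∧
      y ∈ side r x W ∧ y ∈ side r x W' ∧
      (∀ p q, (∃ i ∈ K, p ∈ side r x i) → (∃ i ∈ K, q ∈ side r x i) → p ∈ side r x W →
        q ∉ side r x W → g p < g q) ∧
      ∀ q s, (∃ i ∈ K, q ∈ side r x i) → (∃ i ∈ K, s ∈ side r x i) → q ∉ side r x W' →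
        s ∈ side r x W' → Separated (side r x) K q s → g q < g s := by
  obtain ⟨e, he⟩ := exists_pure_quadrant (W := W)
    (h1.mono (by rintro i (rfl | rfl | rfl) <;> simp [*])) hAB
  have hK : Linked (side r e) K := linked_side_base hK₀
  have h3' : ¬ Arcs r e (insert W (insert W' K)) := fun h => h3 h.rebase
  have hWU : ∀ v ∈ side r e W, ∃ i ∈ K, v ∈ side r e i := by
    intro v hv
    by_contra hc
    push Not at hc
    exact hv (he v (notMem_side.1 (hc A hA)) (notMem_side.1 (hc B hB)))
  have hK1 : K ⊆ insert W K := Set.subset_insert _ _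
  have hK2 : K ⊆ insert W' K := Set.subset_insert _ _
  -- An order of `K ∪ {W'}` in which the points outside the union of `K` come first.
  obtain ⟨f₂, hf₂, h0₂, ht₂, hout⟩ : ∃ f₂ : V → ℕ,
      (∀ i ∈ insert W' K, RankConvex f₂ (side r e i)) ∧
      (∀ x, f₂ x = 0 ↔ ∀ i ∈ insert W' K, x ∉ side r e i) ∧
      (∀ x y, ¬ Separated (side r e) (insert W' K) x y → f₂ x = f₂ y) ∧
      ∀ w u, (∀ i ∈ K, w ∉ side r e i) → (∃ i ∈ K, u ∈ side r e i) → f₂ w < f₂ u := by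
    obtain ⟨f, hf⟩ := h2.rebase (e' := e)
    obtain ⟨f, hf, h0, ht⟩ := exists_tight_rank hf
    have hside : ∀ w, (∀ i ∈ K, w ∉ side r e i) → ∀ u u', (∃ i ∈ K, u ∈ side r e i) →
        (∃ i ∈ K, u' ∈ side r e i) → (f u < f w ↔ f u' < f w) := by
      rintro w hw u u' ⟨i, hi, hu⟩ ⟨j, hj, hu'⟩
      exact hK.lt_iff_of_notMem (fun i hi => hf i (hK2 hi)) hw hi hj hu hu'
    have hne : ∀ w, (∀ i ∈ K, w ∉ side r e i) → ∀ u, (∃ i ∈ K, u ∈ side r e i) → f u ≠ f w := by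
      rintro w hw u ⟨i, hi, hu⟩
      exact (hf i (hK2 hi)).ne hu (hw i hi)
    by_cases hall : ∀ w u, (∀ i ∈ K, w ∉ side r e i) → (∃ i ∈ K, u ∈ side r e i) → f w < f u
    · exact ⟨f, hf, h0, ht, hall⟩
    push Not at hall
    obtain ⟨w₀, u₀, hw₀, hu₀, hlt⟩ := hall
    obtain ⟨g, hg, hg0, hgt, hgr⟩ := exists_tight_rank_rev hf h0 ht
    refine ⟨g, hg, hg0, hgt, fun w u hw hu => ?_⟩
    have hu0 : f u ≠ 0 := by
      obtain ⟨i, hi, hu⟩ := hu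
      exact fun h => (h0 u).1 h i (hK2 hi) hu
    by_cases hfw : f w = 0
    · rw [(hg0 w).2 ((h0 w).1 hfw), Nat.pos_iff_ne_zero]
      rw [ne_eq, h0, ← hg0] at hu0
      exact hu0
    · rw [hgr w u hfw hu0]
      by_contra hc
      have inW' : ∀ v, (∀ i ∈ K, v ∉ side r e i) → f v ≠ 0 → v ∈ side r e W' := by
        intro v hv hv0
        by_contra hv'
        refine hv0 ((h0 v).2 fun i hi => ?_)
        rcases hi with rfl | hi
        · exact hv'
        · exact hv i hi
      obtain ⟨i, hi, hcr⟩ := hW'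
      obtain ⟨-, -, ⟨z, hz, hz'⟩⟩ := (setOverlap_side (e := e)).2 hcr
      have hzU : ∃ i ∈ K, z ∈ side r e i := ⟨i, hi, hz⟩
      have a1 := hside w hw u z hu hzU
      have a2 := hside w₀ hw₀ u₀ z hu₀ hzU
      have a3 := hne w₀ hw₀ u₀ hu₀
      exact hz' (hf W' (by simp) (inW' w hw hfw) (inW' w₀ hw₀ (by omega)) (by omega) (by omega))
  -- An order of `K ∪ {W}` that agrees with it on `K`.
  obtain ⟨f₁, hf₁, h0₁, ht₁, hagree⟩ : ∃ f₁ : V → ℕ,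
      (∀ i ∈ insert W K, RankConvex f₁ (side r e i)) ∧
      (∀ x, f₁ x = 0 ↔ ∀ i ∈ insert W K, x ∉ side r e i) ∧
      (∀ x y, ¬ Separated (side r e) (insert W K) x y → f₁ x = f₁ y) ∧
      ∀ x y, (∃ i ∈ K, x ∈ side r e i) → (∃ i ∈ K, y ∈ side r e i) →
        Separated (side r e) K x y → (f₁ x < f₁ y ↔ f₂ x < f₂ y) := by
    obtain ⟨f, hf⟩ := h1.rebase (e' := e)
    obtain ⟨f, hf, h0, ht⟩ := exists_tight_rank hf
    rcases hK.order_unique (fun i hi => hf i (hK1 hi)) (fun i hi => hf₂ i (hK2 hi)) hA hB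
      (setOverlap_side.2 hAB) with h | h
    · exact ⟨f, hf, h0, ht, h⟩
    · obtain ⟨g, hg, hg0, hgt, hgr⟩ := exists_tight_rank_rev hf h0 ht
      refine ⟨g, hg, hg0, hgt, fun x y hx hy hxy => ?_⟩
      have hne : ∀ {x}, (∃ i ∈ K, x ∈ side r e i) → f x ≠ 0 := by
        rintro x ⟨i, hi, hx⟩ h'
        exact (h0 x).1 h' i (hK1 hi) hx
      rw [hgr x y (hne hx) (hne hy), h y x hy hx hxy.symm]
  have hzero : ∀ v, (∀ i ∈ K, v ∉ side r e i) → f₁ v = 0 := by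
    intro v hv
    refine (h0₁ v).2 fun i hi => ?_
    rcases hi with rfl | hi
    · intro hvi
      obtain ⟨i, hi, h⟩ := hWU v hvi
      exact hv i hi h
    · exact hv i hi
  have agree : ∀ u v, (∃ i ∈ K, u ∈ side r e i) → Separated (side r e) K u v →
      (f₁ u < f₁ v ↔ f₂ u < f₂ v) := by
    intro u v hu huv
    by_cases hv : ∃ i ∈ K, v ∈ side r e i
    · exact hagree u v hu hv huv
    · push Not at hv
      have := hout v u hv hu
      have := hzero v hv
      omega
  have ne₁ : ∀ u v, Separated (side r e) K u v → f₁ u ≠ f₁ v := fun u v h =>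
    RankConvex.ne_of_separated (fun i hi => hf₁ i (hK1 hi)) h
  have ne₂ : ∀ u v, Separated (side r e) K u v → f₂ u ≠ f₂ v := fun u v h =>
    RankConvex.ne_of_separated (fun i hi => hf₂ i (hK2 hi)) h
  obtain ⟨x, y, hxy₁, hxy₂⟩ : ∃ x y, f₁ x < f₁ y ∧ f₂ y < f₂ x := by
    by_contra hc
    push Not at hc
    refine h3' ⟨fun v => f₁ v + f₂ v, fun i hi x y z hx hz h h' => ?_⟩
    have hc1 := hc x y; have hc2 := hc y x; have hc3 := hc y z; have hc4 := hc z y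
    simp only at h h'
    by_cases hiW : i = W
    · exact hf₁ i (by simp [hiW]) hx hz (by omega) (by omega)
    · exact hf₂ i (by simpa [hiW] using hi) hx hz (by omega) (by omega)
  have hyU : ∃ i ∈ K, y ∈ side r e i := by
    by_contra hc
    push Not at hc
    have := hzero y hc
    omega
  have hxU : ∃ i ∈ K, x ∈ side r e i := by
    by_contra hc
    push Not at hc
    have := hout x y hc hyU
    omega
  have hns : ¬ Separated (side r e) K x y := by
    intro h
    have := agree x y hxU h
    omega
  have hWxy : r W y ≠ r W x := by
    intro h
    refine hxy₁.ne (ht₁ x y fun hs => ?_)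
    rw [separated_side] at hs hns
    obtain ⟨i, hi, hs⟩ := hs
    rcases hi with rfl | hi
    · exact hs h.symm
    · exact hns ⟨i, hi, hs⟩
  have hWxy' : r W' y ≠ r W' x := by
    intro h
    refine hxy₂.ne' (ht₂ x y fun hs => ?_)
    rw [separated_side] at hs hns
    obtain ⟨i, hi, hs⟩ := hs
    rcases hi with rfl | hi
    · exact hs h.symm
    · exact hns ⟨i, hi, hs⟩
  obtain ⟨N₁, hN₁⟩ := exists_bound f₁
  obtain ⟨N₂, hN₂⟩ := exists_bound f₂
  have hy0 : ∀ i ∈ K, y ∉ side r x i := by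
    intro i hi hy
    exact hns (separated_side.2 ⟨i, hi, fun h => hy h.symm⟩)
  -- Points of the union, seen from `x`, are separated from `x` and `y` and not between them.
  have far : ∀ v, (∃ i ∈ K, v ∈ side r x i) →
      (f₁ x < f₁ v ↔ f₂ x < f₂ v) ∧ (f₁ y < f₁ v ↔ f₂ y < f₂ v) ∧
      f₁ v ≠ f₁ x ∧ f₁ v ≠ f₁ y ∧ f₂ v ≠ f₂ x ∧ f₂ v ≠ f₂ y := by
    rintro v ⟨i, hi, hv⟩
    have hs : Separated (side r e) K x v := separated_side.2 ⟨i, hi, fun h => hv h.symm⟩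
    have hs' := hs.trans_left hns
    exact ⟨agree x v hxU hs, agree y v hyU hs', (ne₁ _ _ hs).symm, (ne₁ _ _ hs').symm,
      (ne₂ _ _ hs).symm, (ne₂ _ _ hs').symm⟩
  have conv₁ : ∀ i ∈ insert W K, RankConvex (rotate f₁ N₁ x) (side r x i) :=
    fun i hi => (hf₁ i hi).rotate hN₁
  have conv₂ : ∀ i ∈ insert W' K, RankConvex (rotate f₂ N₂ x) (side r x i) :=
    fun i hi => (hf₂ i hi).rotate hN₂
  refine ⟨x, y, rotate f₁ N₁ x, fun i hi => conv₁ i (hK1 hi), hy0, hWxy, hWxy', ?_, ?_⟩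
  · intro p q hp hq hpW hqW
    by_contra hc
    refine hqW (conv₁ W (by simp) (show y ∈ side r x W from hWxy) hpW ?_ (not_lt.1 hc))
    obtain ⟨a1, a2, a3, a4, a5, a6⟩ := far q hq
    have := hN₁ y
    unfold rotate
    split_ifs <;> omega
  · intro q t hq ht hqW htW hs
    obtain ⟨a1, a2, a3, a4, a5, a6⟩ := far q hq
    obtain ⟨b1, b2, b3, b4, b5, b6⟩ := far t ht
    have hs' : Separated (side r e) K q t := separated_side_base.1 hs
    have key : rotate f₂ N₂ x q < rotate f₂ N₂ x t := by
      by_contra hc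
      refine hqW (conv₂ W' (by simp) htW (show y ∈ side r x W' from hWxy') (not_lt.1 hc) ?_)
      have := hN₂ q
      unfold rotate
      split_ifs <;> omega
    have n1 := ne₁ _ _ hs'
    have ag : (f₁ q < f₁ t ↔ f₂ q < f₂ t) := by
      by_cases hqU : ∃ i ∈ K, q ∈ side r e i
      · exact agree q t hqU hs'
      · have htU : ∃ i ∈ K, t ∈ side r e i := by
          obtain ⟨i, hi, hc⟩ := hs'
          have : q ∉ side r e i := fun h => hqU ⟨i, hi, h⟩
          exact ⟨i, hi, by tauto⟩
        have := agree t q htU hs'.symm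
        have := ne₂ _ _ hs'
        omega
    have := hN₁ q; have := hN₁ t; have := hN₂ q; have := hN₂ t
    have n2 := ne₂ _ _ hs'
    unfold rotate at key ⊢
    split_ifs at key ⊢ <;> omega

end Conflict

/-! ### The two obstructions to a circular order -/

section Patterns

variable {ι V : Type*} {r : ι → V → Bool}

variable (r) in
/-- The splits `R 0, …, R (n - 1)` separate cyclically consecutive pairs of the points
`p 0, …, p (n - 1)` from the other ones and from `e`. -/
def CyclePattern (n : ℕ) (R : ℕ → ι) (p : ℕ → V) (e : V) : Prop :=
  ∀ a < n, ∀ b < n, p b ∈ side r e (R a) ↔ b = a ∨ b = a + 1 ∨ (a + 1 = n ∧ b = 0)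

variable (r) in
/-- Each of the splits `T 0`, `T 1`, `T 2` separates the pair `a k`, `b k` from the other two pairs,
and `B` separates the points `a k` from the points `b k`. -/
def StarPattern (T : Fin 3 → ι) (B : ι) (a b : Fin 3 → V) : Prop :=
  ∃ (t : Fin 3 → Bool) (t' : Bool), ∀ k, r B (a k) = t' ∧ r B (b k) = !t' ∧
    ∀ l, r (T k) (a l) = (t k ^^ decide (k = l)) ∧ r (T k) (b l) = (t k ^^ decide (k = l))

/-- A shortest chain of intersecting members of a linked family from a member that meets `P` to one
that meets `S`. -/
lemma Linked.exists_minimal_chain {s : ι → Set V} {K : Set ι} (hK : Linked s K) {P S : Set V}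
    (hP : ∃ i ∈ K, (s i ∩ P).Nonempty) (hS : ∃ i ∈ K, (s i ∩ S).Nonempty) :
    ∃ (k : ℕ) (b : ℕ → ι), (∀ i ≤ k, b i ∈ K) ∧ (s (b 0) ∩ P).Nonempty ∧ (s (b k) ∩ S).Nonempty ∧
      (∀ i < k, (s (b i) ∩ s (b (i + 1))).Nonempty) ∧
      (∀ i j, i + 1 < j → j ≤ k → Disjoint (s (b i)) (s (b j))) ∧
      (∀ i, 0 < i → i ≤ k → Disjoint (s (b i)) P) ∧ ∀ i < k, Disjoint (s (b i)) S := by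
  classical
  let Q : ℕ → Prop := fun k => ∃ b : ℕ → ι, (∀ i ≤ k, b i ∈ K) ∧ (s (b 0) ∩ P).Nonempty ∧
    (s (b k) ∩ S).Nonempty ∧ ∀ i < k, (s (b i) ∩ s (b (i + 1))).Nonempty
  have hQ : ∃ k, Q k := by
    obtain ⟨i, hi, hiP⟩ := hP
    obtain ⟨j, hj, hjS⟩ := hS
    have h : ∃ (k : ℕ) (b : ℕ → ι), (∀ i ≤ k, b i ∈ K) ∧ b 0 = i ∧ b k = j ∧
        ∀ i < k, (s (b i) ∩ s (b (i + 1))).Nonempty := by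
      have := hK i hi j hj
      clear hjS hj
      induction this with
      | refl => exact ⟨0, fun _ => i, by simp [hi], rfl, rfl, by simp⟩
      | @tail c d _ h ih =>
        obtain ⟨k, b, h1, h2, h3, h4⟩ := ih
        refine ⟨k + 1, fun m => if m ≤ k then b m else d, ?_, by simp [h2], by simp, ?_⟩
        · intro m _
          simp only
          split_ifs with hm
          · exact h1 m hm
          · exact h.1
        · intro m hm
          rcases Nat.lt_or_ge m k with hm' | hm'
          · simpa [hm'.le, Nat.succ_le_of_lt hm'] using h4 m hm'
          · obtain rfl : m = k := by omega
            simpa [h3] using h.2.1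
    obtain ⟨k, b, h1, h2, h3, h4⟩ := h
    exact ⟨k, b, h1, by rwa [h2], by rwa [h3], h4⟩
  obtain ⟨b, h1, h2, h3, h4⟩ := Nat.find_spec hQ
  have hmin : ∀ m, m < Nat.find hQ → ¬ Q m := fun m hm => Nat.find_min hQ hm
  generalize Nat.find hQ = k at *
  refine ⟨k, b, h1, h2, h3, h4, ?_, ?_, ?_⟩
  · intro i j hij hj
    rw [Set.disjoint_iff_inter_eq_empty]
    by_contra hne
    rw [← ne_eq, ← Set.nonempty_iff_ne_empty] at hne
    refine hmin (k - (j - i - 1)) (by omega)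
      ⟨fun m => if m ≤ i then b m else b (m + (j - i - 1)), ?_, by simpa using h2, ?_, ?_⟩
    · intro m hm
      simp only
      split_ifs <;> exact h1 _ (by omega)
    · simp only
      rw [if_neg (by omega), Nat.sub_add_cancel (by omega)]
      exact h3
    · intro m hm
      simp only
      rcases lt_trichotomy m i with hm' | rfl | hm'
      · rw [if_pos (by omega), if_pos (by omega)]
        exact h4 m (by omega)
      · rw [if_pos (by omega), if_neg (by omega),
          show m + 1 + (j - m - 1) = j by omega]
        exact hne
      · rw [if_neg (by omega), if_neg (by omega),
          show m + 1 + (j - i - 1) = m + (j - i - 1) + 1 by omega]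
        exact h4 _ (by omega)
  · intro i hi hik
    rw [Set.disjoint_iff_inter_eq_empty]
    by_contra hne
    rw [← ne_eq, ← Set.nonempty_iff_ne_empty] at hne
    refine hmin (k - i) (by omega) ⟨fun m => b (m + i), fun m hm => h1 _ (by omega),
      by simpa using hne,
      by simpa [Nat.sub_add_cancel hik] using h3, fun m hm => ?_⟩
    simp only
    rw [show m + 1 + i = m + i + 1 by omega]
    exact h4 _ (by omega)
  · intro i hik
    rw [Set.disjoint_iff_inter_eq_empty]
    by_contra hne
    rw [← ne_eq, ← Set.nonempty_iff_ne_empty] at hne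
    exact hmin i hik ⟨b, fun m hm => h1 _ (by omega), h2, hne, fun m hm => h4 _ (by omega)⟩

/-- A chain of splits, closed up by two splits `C` and `D` that share a point `z` outside the chain.
-/
lemma cyclePattern_of_chain {e z p q : V} {b : ℕ → ι} {k : ℕ} {t : ℕ → V} {C D : ι}
    (hb : ∀ i j, i + 1 < j → j ≤ k → Disjoint (side r e (b i)) (side r e (b j)))
    (ht : ∀ i < k, t i ∈ side r e (b i) ∧ t i ∈ side r e (b (i + 1)) ∧ t i ∉ side r e C ∧
      t i ∉ side r e D)
    (hp : p ∈ side r e (b 0) ∧ p ∈ side r e D ∧ p ∉ side r e C)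
    (hp' : ∀ i, 0 < i → i ≤ k → p ∉ side r e (b i))
    (hq : q ∈ side r e (b k) ∧ q ∈ side r e C ∧ q ∉ side r e D)
    (hq' : ∀ i < k, q ∉ side r e (b i))
    (hz : z ∈ side r e C ∧ z ∈ side r e D) (hz' : ∀ i ≤ k, z ∉ side r e (b i)) :
    CyclePattern r (k + 3) (fun a => if a ≤ k then b a else if a = k + 1 then C else D)
      (fun j => if j = 0 then p else if j ≤ k then t (j - 1) else if j = k + 1 then q else z)
      e := by
  intro a ha j hj
  have htb : ∀ i < k, ∀ a ≤ k, (t i ∈ side r e (b a) ↔ i = a ∨ i + 1 = a) := by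
    intro i hi a ha
    obtain ⟨h1, h2, -, -⟩ := ht i hi
    constructor
    · intro h
      by_contra hc
      rcases lt_or_ge a i with hai | hai
      · exact Set.disjoint_left.1 (hb a (i + 1) (by omega) (by omega)) h h2
      · exact Set.disjoint_left.1 (hb i a (by omega) ha) h1 h
    · rintro (rfl | rfl)
      · exact h1
      · exact h2
  rcases Nat.eq_zero_or_pos j with rfl | hj0
  · simp only [if_true, and_true]
    split_ifs with h1 h2
    · rcases Nat.eq_zero_or_pos a with rfl | ha0
      · simp [hp.1]
      · simp only [hp' a ha0 h1, false_iff, false_or]; omega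
    · simp only [hp.2.2, false_iff, false_or]; omega
    · simp only [hp.2.1, true_iff]; omega
  · simp only [if_neg hj0.ne']
    by_cases hjk : j ≤ k
    · simp only [if_pos hjk]
      have h := ht (j - 1) (by omega)
      split_ifs with h1 h2
      · rw [htb _ (by omega) a h1]; omega
      · simp only [h.2.2.1, false_iff]; omega
      · simp only [h.2.2.2, false_iff]; omega
    · simp only [if_neg hjk]
      by_cases hjk' : j = k + 1
      · simp only [if_pos hjk']
        split_ifs with h1 h2
        · by_cases hak : a = k
          · rw [hak]; simp only [hq.1, true_iff]; omega
          · simp only [hq' a (by omega), false_iff]; omega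
        · simp only [hq.2.1, true_iff]; omega
        · simp only [hq.2.2, false_iff]; omega
      · simp only [if_neg hjk']
        split_ifs with h1 h2
        · simp only [hz' a h1, false_iff]; omega
        · simp only [hz.1, true_iff]; omega
        · simp only [hz.2, true_iff]; omega

/-- The degenerate case of a conflict: if `W` meets the union of `K` only inside `W'`, both splits
end in the first atom of `K`. -/
lemma exists_starPattern {x y : V} {K : Set ι} {W W' : ι} {g : V → ℕ}
    (hcr : ∀ i ∈ K, ∃ j ∈ K, Crossing r i j) (hg : ∀ i ∈ K, RankConvex g (side r x i))
    (hy : ∀ i ∈ K, y ∉ side r x i) (hyW : y ∈ side r x W) (hyW' : y ∈ side r x W')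
    (hP : ∀ p q, (∃ i ∈ K, p ∈ side r x i) → (∃ i ∈ K, q ∈ side r x i) → p ∈ side r x W →
      q ∉ side r x W → Separated (side r x) K p q → g p < g q)
    (hS : ∀ q s, (∃ i ∈ K, q ∈ side r x i) → (∃ i ∈ K, s ∈ side r x i) → q ∉ side r x W' →
      s ∈ side r x W' → Separated (side r x) K q s → g q < g s)
    (hPne : ∃ p, (∃ i ∈ K, p ∈ side r x i) ∧ p ∈ side r x W)
    (hSne : ∃ q, (∃ i ∈ K, q ∈ side r x i) ∧ q ∉ side r x W')
    (hsub : ∀ v, (∃ i ∈ K, v ∈ side r x i) → v ∈ side r x W → v ∈ side r x W') :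
    ∃ (B D : ι) (a b : Fin 3 → V), B ∈ K ∧ D ∈ K ∧ StarPattern r ![W, W', D] B a b := by
  obtain ⟨p, hpU, hpW⟩ := hPne
  obtain ⟨q, hqU, hqW'⟩ := hSne
  have near : ∀ p q, (∃ i ∈ K, p ∈ side r x i) → (∃ i ∈ K, q ∈ side r x i) → p ∈ side r x W →
      q ∉ side r x W' → ¬ Separated (side r x) K p q := by
    intro p q hp hq hpW hqW' hs
    exact (hP p q hp hq hpW (fun h => hqW' (hsub q hq h)) hs).asymm
      (hS q p hq hp hqW' (hsub p hp hpW) hs.symm)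
  have hpq := near p q hpU hqU hpW hqW'
  have outW : ∀ v, (∃ i ∈ K, v ∈ side r x i) → Separated (side r x) K p v → v ∉ side r x W :=
    fun v hv hs hvW => near v q hv hqU hvW hqW' (hs.trans_left hpq).symm |>.elim
  have inW' : ∀ v, (∃ i ∈ K, v ∈ side r x i) → Separated (side r x) K p v → v ∈ side r x W' := by
    intro v hv hs
    by_contra hvW'
    exact near p v hpU hv hpW hvW' hs
  obtain ⟨B, hB, hpB⟩ := id hpU
  obtain ⟨D, hD, hBD⟩ := hcr B hB
  obtain ⟨⟨d₁, hd₁B, hd₁D⟩, ⟨b, hbB, hbD⟩, ⟨d₂, hd₂D, hd₂B⟩⟩ :=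
    (setOverlap_side (e := x)).2 hBD
  -- All points separated from `p` come after it, so two crossing intervals cannot both contain it.
  have hpD : p ∉ side r x D := by
    intro hpD
    have h1 : Separated (side r x) K p b := ⟨D, hD, fun h => hbD (h.1 hpD)⟩
    have h2 : Separated (side r x) K p d₂ := ⟨B, hB, fun h => hd₂B (h.1 hpB)⟩
    have h3 := hP p b hpU ⟨B, hB, hbB⟩ hpW (outW b ⟨B, hB, hbB⟩ h1) h1
    have h4 := hP p d₂ hpU ⟨D, hD, hd₂D⟩ hpW (outW d₂ ⟨D, hD, hd₂D⟩ h2) h2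
    rcases le_total (g b) (g d₂) with h | h
    · exact hbD (hg D hD hpD hd₂D h3.le h)
    · exact hd₂B (hg B hB hpB hbB h4.le h)
  have sep : ∀ d, d ∈ side r x D → Separated (side r x) K p d :=
    fun d hd => ⟨D, hD, fun h => hpD (h.2 hd)⟩
  have h1 := outW d₁ ⟨D, hD, hd₁D⟩ (sep d₁ hd₁D)
  have h2 := inW' d₁ ⟨D, hD, hd₁D⟩ (sep d₁ hd₁D)
  have h3 := outW d₂ ⟨D, hD, hd₂D⟩ (sep d₂ hd₂D)
  have h4 := inW' d₂ ⟨D, hD, hd₂D⟩ (sep d₂ hd₂D)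
  have hpW' := hsub p hpU hpW
  have hqW : q ∉ side r x W := fun h => hqW' (hsub q hqU h)
  have hqs : ∀ i ∈ K, r i p = r i q := by
    intro i hi
    by_contra h
    exact hpq (separated_side.2 ⟨i, hi, h⟩)
  have hqB := hqs B hB
  have hqD := hqs D hD
  have hyB := hy B hB
  have hyD := hy D hD
  rw [notMem_side] at hqW hqW' hpD h1 h3 hd₂B hyB hyD
  rw [mem_side, ← Bool.eq_not] at hyW hyW' hpW hpW' hpB h2 h4 hd₁B hd₁D hd₂D
  rw [hpB] at hqB
  rw [hpD] at hqD
  refine ⟨B, D, ![y, x, d₂], ![p, q, d₁], hB, hD, ![r W x, !(r W' x), r D x], r B x, ?_⟩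
  intro k
  fin_cases k <;> refine ⟨?_, ?_, fun l => ?_⟩ <;> (try fin_cases l) <;>
    simp [hyW, hyW', hpW, hpW', hpB, h2, h4, hd₁B, hd₁D, hd₂D, hqW, hqW', hpD, h1, h3, hd₂B, hyB,
      hyD, ← hqB, ← hqD]

/-- If either of two splits can be added to a linked family but not both, then one of the two
patterns occurs. -/
theorem exists_pattern [Finite V] {e₀ : V} {K : Set ι} {W W' A B : ι}
    (hK₀ : Linked (side r e₀) K) (hA : A ∈ K) (hB : B ∈ K) (hAB : Crossing r A B)
    (hW : ∃ i ∈ K, Crossing r W i) (hW' : ∃ i ∈ K, Crossing r W' i)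
    (h1 : Arcs r e₀ (insert W K)) (h2 : Arcs r e₀ (insert W' K))
    (h3 : ¬ Arcs r e₀ (insert W (insert W' K))) :
    (∃ (T : Fin 3 → ι) (B : ι) (a b : Fin 3 → V), (∀ k, T k ∈ insert W (insert W' K)) ∧
      B ∈ insert W (insert W' K) ∧ StarPattern r T B a b) ∨
    ∃ (n : ℕ) (R : ℕ → ι) (p : ℕ → V) (e : V), 3 ≤ n ∧
      (∀ a < n, R a ∈ insert W (insert W' K)) ∧ CyclePattern r n R p e := by
  obtain ⟨x, y, g, hg, hy, hyW, hyW', hP, hS⟩ := exists_conflict hK₀ hA hB hAB hW' h1 h2 h3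
  have : Nonempty V := ⟨x⟩
  have hK : Linked (side r x) K := linked_side_base hK₀
  have hcr : ∀ i ∈ K, ∃ j ∈ K, Crossing r i j := by
    intro i hi
    rcases Relation.ReflTransGen.cases_head (hK i hi A hA) with rfl | ⟨j, hj, -⟩
    · exact ⟨B, hB, hAB⟩
    · exact ⟨j, hj.1, setOverlap_side.1 hj.2⟩
  have meets : ∀ {C}, (∃ i ∈ K, Crossing r C i) →
      (∃ p, (∃ i ∈ K, p ∈ side r x i) ∧ p ∈ side r x C) ∧
      ∃ q, (∃ i ∈ K, q ∈ side r x i) ∧ q ∉ side r x C := by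
    rintro C ⟨i, hi, h⟩
    obtain ⟨⟨c, hc, hc'⟩, -, ⟨b, hb, hb'⟩⟩ := (setOverlap_side (e := x)).2 h
    exact ⟨⟨c, ⟨i, hi, hc'⟩, hc⟩, b, ⟨i, hi, hb⟩, hb'⟩
  by_cases hsub : ∀ v, (∃ i ∈ K, v ∈ side r x i) → v ∈ side r x W → v ∈ side r x W'
  · obtain ⟨B', D, a, b, hB', hD, h⟩ := exists_starPattern hcr hg hy hyW hyW'
      (fun p q hp hq hpW hqW _ => hP p q hp hq hpW hqW) hS (meets hW).1 (meets hW').2 hsub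
    refine Or.inl ⟨_, B', a, b, fun k => ?_, by simp [hB'], h⟩
    fin_cases k <;> simp [hD]
  by_cases hsub' : ∀ v, (∃ i ∈ K, v ∈ side r x i) → v ∈ side r x W' → v ∈ side r x W
  · obtain ⟨N, hN⟩ := exists_bound g
    obtain ⟨B', D, a, b, hB', hD, h⟩ := exists_starPattern (g := fun v => N - g v) hcr
      (fun i hi => (hg i hi).sub fun v => (hN v).le) hy hyW' hyW
      (fun p q hp hq hpW hqW hs => by
        have := hS q p hq hp hqW hpW hs.symm
        have := hN p; have := hN q
        omega)
      (fun q s hq hs' hqW hsW _ => by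
        have := hP s q hs' hq hsW hqW
        have := hN s; have := hN q
        omega) (meets hW').1 (meets hW).2 hsub'
    refine Or.inl ⟨_, B', a, b, fun k => ?_, by simp [hB'], h⟩
    fin_cases k <;> simp [hD]
  push Not at hsub hsub'
  right
  obtain ⟨k, b, hbK, ⟨p, hpb, hpW, hpW'⟩, ⟨q, hqb, hqW', hqW⟩, hbb, hdis, hbP, hbS⟩ :=
    hK.exists_minimal_chain (P := side r x W \ side r x W') (S := side r x W' \ side r x W)
    (by
      obtain ⟨v, ⟨i, hi, hv⟩, hvW, hvW'⟩ := hsub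
      exact ⟨i, hi, v, hv, hvW, hvW'⟩)
    (by
      obtain ⟨v, ⟨i, hi, hv⟩, hvW, hvW'⟩ := hsub'
      exact ⟨i, hi, v, hv, hvW, hvW'⟩)
  have hp' : ∀ i, 0 < i → i ≤ k → p ∉ side r x (b i) :=
    fun i hi hik h => Set.disjoint_left.1 (hbP i hi hik) h ⟨hpW, hpW'⟩
  have hq' : ∀ i < k, q ∉ side r x (b i) :=
    fun i hik h => Set.disjoint_left.1 (hbS i hik) h ⟨hqW', hqW⟩
  have hmem : ∀ C D, C ∈ insert W (insert W' K) → D ∈ insert W (insert W' K) → ∀ a < k + 3,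
      (if a ≤ k then b a else if a = k + 1 then C else D) ∈ insert W (insert W' K) := by
    intro C D hC hD a _
    split_ifs with h
    · exact Set.mem_insert_of_mem _ (Set.mem_insert_of_mem _ (hbK a h))
    · exact hC
    · exact hD
  -- A common point of consecutive chain members lies in both or in none of `W` and `W'`.
  have hboth : ∀ i < k, ∀ v, v ∈ side r x (b i) → v ∈ side r x (b (i + 1)) →
      (v ∈ side r x W ↔ v ∈ side r x W') := by
    intro i hi v hv hv'
    have h1 : ¬ (v ∈ side r x W ∧ v ∉ side r x W') :=
      fun h => Set.disjoint_left.1 (hbP (i + 1) (by omega) hi) hv' h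
    have h2 : ¬ (v ∈ side r x W' ∧ v ∉ side r x W) :=
      fun h => Set.disjoint_left.1 (hbS i hi) hv h
    tauto
  by_cases hout : ∀ i < k, ∃ v, v ∈ side r x (b i) ∧ v ∈ side r x (b (i + 1)) ∧ v ∉ side r x W
  · choose! t ht using hout
    refine ⟨k + 3, _, _, x, by omega, ?_, cyclePattern_of_chain (t := t) (C := W') (D := W) hdis
      (fun i hi => ⟨(ht i hi).1, (ht i hi).2.1, ?_, (ht i hi).2.2⟩) ⟨hpb, hpW, hpW'⟩ hp'
      ⟨hqb, hqW', hqW⟩ hq' ⟨hyW', hyW⟩ (fun i hi => hy _ (hbK i hi))⟩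
    · exact hmem _ _ (by simp) (by simp)
    · rw [← hboth i hi _ (ht i hi).1 (ht i hi).2.1]
      exact (ht i hi).2.2
  · -- No point of the union is outside both, and the roles of `x` and `y` can be exchanged.
    push Not at hout
    obtain ⟨i₀, hi₀, hin⟩ := hout
    have hcov : ∀ v, (∃ i ∈ K, v ∈ side r x i) → v ∉ side r x W → v ∉ side r x W' → False := by
      intro v hv hvW hvW'
      obtain ⟨t, ht, ht'⟩ := hbb i₀ hi₀
      have htW := hin t ht ht'
      have htW' := (hboth i₀ hi₀ t ht ht').1 htW
      have htU : ∃ i ∈ K, t ∈ side r x i := ⟨_, hbK i₀ hi₀.le, ht⟩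
      have hns : ¬ Separated (side r x) K t v := fun hs =>
        (hP t v htU hv htW hvW).asymm (hS v t hv htU hvW' htW' hs.symm)
      refine hvW (hin v ?_ ?_)
      · by_contra h
        exact hns ⟨_, hbK i₀ hi₀.le, fun h' => h (h'.1 ht)⟩
      · by_contra h
        exact hns ⟨_, hbK (i₀ + 1) hi₀, fun h' => h (h'.1 ht')⟩
    have hKy : ∀ i ∈ K, side r y i = side r x i := by
      intro i hi
      have := notMem_side.1 (hy i hi)
      ext v
      simp only [mem_side, this]
    have flip : ∀ {C v}, y ∈ side r x C → (v ∈ side r y C ↔ v ∉ side r x C) := by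
      intro C v h
      simp only [mem_side] at h ⊢
      revert h
      cases r C v <;> cases r C x <;> cases r C y <;> simp
    choose! t ht using hbb
    have htW : ∀ i < k, t i ∈ side r x W ∧ t i ∈ side r x W' := by
      intro i hi
      have h1 := hboth i hi (t i) (ht i hi).1 (ht i hi).2
      have h2 := hcov (t i) ⟨_, hbK i hi.le, (ht i hi).1⟩
      tauto
    refine ⟨k + 3, _, _, y, by omega, ?_, cyclePattern_of_chain (p := p) (q := q) (z := x) (b := b)
      (t := t) (C := W) (D := W') (fun i j hij hj => ?_) (fun i hi => ?_) ?_ (fun i hi hik => ?_) ?_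
      (fun i hi => ?_) ?_ (fun i hi => ?_)⟩
    · exact hmem _ _ (by simp) (by simp)
    · rw [hKy _ (hbK i (by omega)), hKy _ (hbK j hj)]
      exact hdis i j hij hj
    · rw [hKy _ (hbK i hi.le), hKy _ (hbK (i + 1) hi), flip hyW, flip hyW', not_not, not_not]
      exact ⟨(ht i hi).1, (ht i hi).2, (htW i hi).1, (htW i hi).2⟩
    · rw [hKy _ (hbK 0 (by omega)), flip hyW, flip hyW', not_not]
      exact ⟨hpb, hpW', hpW⟩
    · rw [hKy _ (hbK i hik)]
      exact hp' i hi hik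
    · rw [hKy _ (hbK k le_rfl), flip hyW, flip hyW', not_not]
      exact ⟨hqb, hqW, hqW'⟩
    · rw [hKy _ (hbK i hi.le)]
      exact hq' i hi
    · rw [flip hyW, flip hyW']
      exact ⟨base_notMem_side, base_notMem_side⟩
    · rw [hKy _ (hbK i hi)]
      exact base_notMem_side

end Patterns

/-! ### Minimal families without a common order -/

section Minimal

variable {ι α : Type*} {s : ι → Set α}

lemma not_setOverlap_self {A : Set α} : ¬ SetOverlap A A := fun h => by
  obtain ⟨x, hx, hx'⟩ := h.2.1
  exact hx' hx

lemma Linked.insert_of_overlap {H : Set ι} (hH : Linked s H) {h b : ι} (hh : h ∈ H)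
    (hb : SetOverlap (s h) (s b)) : Linked s (insert b H) := by
  have up : ∀ i ∈ H, ∀ j ∈ H,
      Relation.ReflTransGen (fun c d => d ∈ insert b H ∧ SetOverlap (s c) (s d)) i j :=
    fun i hi j hj => Relation.ReflTransGen.mono
      (fun _ _ hcd => ⟨Set.mem_insert_of_mem _ hcd.1, hcd.2⟩) _ _ (hH i hi j hj)
  rintro i (rfl | hi) j (rfl | hj)
  · exact .refl
  · exact .head ⟨Set.mem_insert_of_mem _ hh, hb.symm⟩ (up h hh j hj)
  · exact .tail (up i hi h hh) ⟨Set.mem_insert _ _, hb⟩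
  · exact up i hi j hj

/-- A connected component of the overlap graph is linked. -/
lemma linked_component (s : ι → Set α) (J : Set ι) {i : ι} (hi : i ∈ J) :
    Linked s {k ∈ J | Relation.ReflTransGen (fun a b => b ∈ J ∧ SetOverlap (s a) (s b)) i k} := by
  set K := {k ∈ J | Relation.ReflTransGen (fun a b => b ∈ J ∧ SetOverlap (s a) (s b)) i k} with hK
  have both : ∀ k, Relation.ReflTransGen (fun a b => b ∈ J ∧ SetOverlap (s a) (s b)) i k →
      k ∈ K ∧ Relation.ReflTransGen (fun a b => b ∈ K ∧ SetOverlap (s a) (s b)) i k ∧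
        Relation.ReflTransGen (fun a b => b ∈ K ∧ SetOverlap (s a) (s b)) k i := by
    intro k hk
    induction hk with
    | refl => exact ⟨⟨hi, .refl⟩, .refl, .refl⟩
    | @tail c d hc h ih =>
      have hd : d ∈ K := ⟨h.1, hc.tail h⟩
      exact ⟨hd, ih.2.1.tail ⟨hd, h.2⟩, ih.2.2.head ⟨ih.1, h.2.symm⟩⟩
  intro a ha b hb
  exact (both a ha.2).2.2.trans (both b hb.2).2.1

lemma Linked.exists_overlap {J : Set ι} (hJ : Linked s J) {i j : ι} (hi : i ∈ J) (hj : j ∈ J)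
    (hij : i ≠ j) : ∃ k ∈ J, SetOverlap (s i) (s k) := by
  rcases Relation.ReflTransGen.cases_head (hJ i hi j hj) with h | ⟨k, hk, -⟩
  · exact (hij h).elim
  · exact ⟨k, hk⟩

/-- A linked family with at least two members remains linked after the removal of a suitable member
other than a given one. -/
lemma Linked.exists_erase [DecidableEq ι] {J : Finset ι} (hJ : Linked s J) {a : ι} (ha : a ∈ J)
    (h2 : 2 ≤ J.card) : ∃ w ∈ J, w ≠ a ∧ Linked s (J.erase w : Finset ι) := by
  classical
  let F := J.powerset.filter fun H => a ∈ H ∧ H ≠ J ∧ Linked s (H : Set ι)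
  have hF : F.Nonempty := by
    refine ⟨{a}, ?_⟩
    simp only [F, Finset.mem_filter, Finset.mem_powerset, Finset.singleton_subset_iff]
    refine ⟨ha, by simp, fun h => ?_, ?_⟩
    · rw [← h] at h2
      simp at h2
    · intro i hi j hj
      obtain rfl : i = a := by simpa using hi
      obtain rfl : j = i := by simpa using hj
      exact .refl
  -- A largest linked proper subfamily containing `a` misses a single member.
  obtain ⟨H, hH, hmax⟩ := F.exists_max_image Finset.card hF
  simp only [F, Finset.mem_filter, Finset.mem_powerset] at hH hmax
  obtain ⟨hHJ, haH, hne, hl⟩ := hH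
  obtain ⟨b, hb, hbH⟩ : ∃ b ∈ J, b ∉ H := by
    by_contra hc
    push Not at hc
    exact hne (Finset.Subset.antisymm hHJ hc)
  obtain ⟨c, hc, d, hd, hdJ, hcd⟩ : ∃ c ∈ H, ∃ d, d ∉ H ∧ d ∈ J ∧ SetOverlap (s c) (s d) := by
    have hp := hJ a ha b hb
    clear hb
    induction hp with
    | refl => exact (hbH haH).elim
    | @tail c d _ h ih =>
      by_cases hcH : c ∈ H
      · exact ⟨c, hcH, d, hbH, h.1, h.2⟩
      · exact ih hcH
  have hins : insert d H = J := by
    by_contra hne'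
    have := hmax (insert d H) ⟨Finset.insert_subset hdJ hHJ, by simp [haH], hne', by
      rw [Finset.coe_insert]
      exact hl.insert_of_overlap hc hcd⟩
    rw [Finset.card_insert_of_notMem hd] at this
    omega
  refine ⟨d, hdJ, fun h => hd (h ▸ haH), ?_⟩
  rw [← hins, Finset.erase_insert hd]
  exact hl

/-- A minimal family without a common order is linked. -/
lemma linked_of_minimal [Finite α] [DecidableEq ι] {J : Finset ι}
    (hJ : ¬ ∃ f : α → ℕ, ∀ i ∈ J, RankConvex f (s i))
    (hmin : ∀ i ∈ J, ∃ f : α → ℕ, ∀ j ∈ J.erase i, RankConvex f (s j)) : Linked s J := by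
  intro i hi j hj
  by_contra hc
  have hi' : i ∈ J := hi
  have hj' : j ∈ J := hj
  set K := {k ∈ (J : Set ι) | Relation.ReflTransGen
    (fun a b => b ∈ (J : Set ι) ∧ SetOverlap (s a) (s b)) i k} with hK
  obtain ⟨f₁, h₁⟩ := hmin j hj'
  obtain ⟨f₂, h₂⟩ := hmin i hi'
  obtain ⟨f, hf⟩ := exists_rank_union (linked_component s (J : Set ι) hi) (J' := (J : Set ι) \ K)
    ⟨f₁, fun k hk => h₁ k (Finset.mem_erase.2 ⟨fun h => hc (h ▸ hk.2), hk.1⟩)⟩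
    ⟨f₂, fun k hk => h₂ k (Finset.mem_erase.2 ⟨fun h => hk.2 (h ▸ ⟨hi, .refl⟩), hk.1⟩)⟩
    (fun k hk l hl ho => hl.2 ⟨hl.1, hk.2.tail ⟨hl.1, ho⟩⟩)
  refine hJ ⟨f, fun k hk => hf k ?_⟩
  by_cases hkK : k ∈ K
  · exact Or.inl hkK
  · exact Or.inr ⟨hk, hkK⟩

end Minimal

section MinimalSplits

variable {ι V : Type*} [DecidableEq ι] {r : ι → V → Bool}

lemma exists_minimal_not_arcs {e : V} (J : Finset ι) (hJ : ¬ Arcs r e J) :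
    ∃ J' ⊆ J, ¬ Arcs r e J' ∧ ∀ i ∈ J', Arcs r e (J'.erase i : Finset ι) := by
  induction J using Finset.strongInduction with
  | H J ih =>
    by_cases h : ∀ i ∈ J, Arcs r e (J.erase i : Finset ι)
    · exact ⟨J, Finset.Subset.refl _, hJ, h⟩
    · push Not at h
      obtain ⟨i, hi, h⟩ := h
      obtain ⟨J', hJ', h'⟩ := ih _ (Finset.erase_ssubset hi) h
      exact ⟨J', hJ'.trans (Finset.erase_subset _ _), h'⟩

/-- A minimal family without a common circular order contains one of the two patterns, if it has at
least four members. -/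
theorem exists_pattern_of_minimal [Finite V] {e : V} {J : Finset ι} (hJ : ¬ Arcs r e J)
    (hmin : ∀ i ∈ J, Arcs r e (J.erase i : Finset ι)) (h4 : 4 ≤ J.card) :
    (∃ (T : Fin 3 → ι) (B : ι) (a b : Fin 3 → V), (∀ k, T k ∈ J) ∧ B ∈ J ∧
      StarPattern r T B a b) ∨
    ∃ (n : ℕ) (R : ℕ → ι) (p : ℕ → V) (e : V), 3 ≤ n ∧ (∀ a < n, R a ∈ J) ∧
      CyclePattern r n R p e := by
  have hl : Linked (side r e) J := linked_of_minimal hJ hmin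
  obtain ⟨c, hc⟩ := Finset.card_pos.1 (by omega : 0 < J.card)
  obtain ⟨W, hW, -, hlW⟩ := hl.exists_erase hc (by omega)
  have hcW := Finset.card_erase_of_mem hW
  obtain ⟨j, hj⟩ := Finset.card_pos.1 (by omega : 0 < (J.erase W).card)
  obtain ⟨a, ha, hWa⟩ := hl.exists_overlap hW (Finset.mem_of_mem_erase hj)
    (Finset.ne_of_mem_erase hj).symm
  have haW : a ∈ J.erase W :=
    Finset.mem_erase.2 ⟨fun h => not_setOverlap_self (h ▸ hWa), ha⟩
  obtain ⟨W', hW', hW'a, hlK⟩ := hlW.exists_erase haW (by omega)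
  have hcW' := Finset.card_erase_of_mem hW'
  have haK : a ∈ (J.erase W).erase W' := Finset.mem_erase.2 ⟨hW'a.symm, haW⟩
  obtain ⟨b, hb, hW'b⟩ := hlW.exists_overlap hW' haW hW'a
  have hbK : b ∈ (J.erase W).erase W' :=
    Finset.mem_erase.2 ⟨fun h => not_setOverlap_self (h ▸ hW'b), hb⟩
  obtain ⟨d, hd, hda⟩ := Finset.exists_mem_ne (by omega : 1 < ((J.erase W).erase W').card) a
  obtain ⟨B, hB, haB⟩ := hlK.exists_overlap haK hd hda.symm
  have hins : insert W (insert W' (((J.erase W).erase W' : Finset ι) : Set ι)) = (J : Set ι) := by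
    rw [← Finset.coe_insert, ← Finset.coe_insert, Finset.insert_erase hW', Finset.insert_erase hW]
  have hW'J := Finset.mem_of_mem_erase hW'
  have hWW' := Finset.ne_of_mem_erase hW'
  have := exists_pattern hlK haK hB (setOverlap_side.1 haB) (W := W) (W' := W')
    ⟨a, haK, setOverlap_side.1 hWa⟩ ⟨b, hbK, setOverlap_side.1 hW'b⟩
    ((hmin W' hW'J).mono (by
      rintro i (rfl | hi)
      · simpa [hW] using hWW'.symm
      · simp only [Finset.coe_erase, Set.mem_sdiff, Set.mem_singleton_iff, Finset.mem_coe] at hi ⊢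
        exact ⟨hi.1.1, hi.2⟩))
    ((hmin W hW).mono (by
      rintro i (rfl | hi)
      · exact hW'
      · exact Finset.mem_of_mem_erase hi))
    (by rwa [hins])
  rw [hins] at this
  exact this

end MinimalSplits

/-! ### Cycle patterns and an additional point -/

section Cycle

variable {ι V : Type*} {r : ι → V → Bool} {n : ℕ} {R : ℕ → ι} {p : ℕ → V} {e v : V}

lemma CyclePattern.rotate (h : CyclePattern r n R p e) {j : ℕ} (hj : j < n) :
    CyclePattern r n (fun a => R ((a + j) % n)) (fun a => p ((a + j) % n)) e := by
  have mod : ∀ a < n, (a + j < n ∧ (a + j) % n = a + j) ∨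
      (n ≤ a + j ∧ (a + j) % n = a + j - n) := by
    intro a ha
    rcases lt_or_ge (a + j) n with h | h
    · exact Or.inl ⟨h, Nat.mod_eq_of_lt h⟩
    · refine Or.inr ⟨h, ?_⟩
      rw [Nat.mod_eq_sub_mod h, Nat.mod_eq_of_lt (by omega)]
  intro a ha b hb
  have ha' := mod a ha
  have hb' := mod b hb
  have := h ((a + j) % n) (Nat.mod_lt _ (by omega)) ((b + j) % n) (Nat.mod_lt _ (by omega))
  rw [this]
  omega

lemma CyclePattern.injOn (h : CyclePattern r n R p e) (h3 : 3 ≤ n) {a b : ℕ} (ha : a < n)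
    (hb : b < n) (hab : R a = R b) : a = b := by
  have h1 := h a ha a ha
  have h2 := h b hb b hb
  have h3 := h a ha b hb
  have h4 := h b hb a ha
  rw [hab] at h1 h3
  simp only [true_or, iff_true] at h1 h2
  simp only [h2, true_iff] at h3
  simp only [h1, true_iff] at h4
  omega

/-- The points of the pattern would have to be linearly ordered, although its last split contains
the first and the last of them only. -/
lemma CyclePattern.not_arcs [Finite V] (h : CyclePattern r n R p e) (h3 : 3 ≤ n) :
    ¬ Arcs r e (R '' {a | a < n}) := by
  rintro ⟨f, hf⟩
  have hf : ∀ a < n, RankConvex f (side r e (R a)) := fun a ha => hf _ ⟨a, ha, rfl⟩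
  have main : ∀ f : V → ℕ, (∀ a < n, RankConvex f (side r e (R a))) → f (p 0) < f (p 1) →
      False := by
    intro f hf h01
    have up : ∀ i, i + 1 < n → f (p i) < f (p (i + 1)) ∧ f (p 1) ≤ f (p (i + 1)) := by
      intro i
      induction i with
      | zero => exact fun _ => ⟨h01, le_rfl⟩
      | succ i ih =>
        intro hi
        have ih := ih (by omega)
        have m1 : p i ∈ side r e (R i) := (h i (by omega) i (by omega)).2 (by omega)
        have m2 : p (i + 1) ∈ side r e (R i) :=
          (h i (by omega) (i + 1) (by omega)).2 (by omega)
        have m3 : p (i + 1) ∈ side r e (R (i + 1)) :=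
          (h (i + 1) (by omega) (i + 1) (by omega)).2 (by omega)
        have m4 : p (i + 1 + 1) ∈ side r e (R (i + 1)) :=
          (h (i + 1) (by omega) (i + 1 + 1) (by omega)).2 (by omega)
        have m5 : p (i + 1 + 1) ∉ side r e (R i) := fun hc => by
          have := (h i (by omega) (i + 1 + 1) (by omega)).1 hc
          omega
        have m6 : p i ∉ side r e (R (i + 1)) := fun hc => by
          have := (h (i + 1) (by omega) i (by omega)).1 hc
          omega
        have : f (p (i + 1)) < f (p (i + 1 + 1)) := by
          by_contra hc
          rcases le_total (f (p i)) (f (p (i + 1 + 1))) with h' | h'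
          · exact m5 (hf i (by omega) m1 m2 h' (by omega))
          · exact m6 (hf (i + 1) (by omega) m4 m3 h' (by omega))
        exact ⟨this, by omega⟩
    have h1 := up (n - 2) (by omega)
    rw [show n - 2 + 1 = n - 1 by omega] at h1
    have m1 : p 0 ∈ side r e (R (n - 1)) := (h _ (by omega) 0 (by omega)).2 (by omega)
    have m2 : p (n - 1) ∈ side r e (R (n - 1)) := (h _ (by omega) _ (by omega)).2 (by omega)
    have m3 := hf (n - 1) (by omega) m1 m2 h01.le h1.2
    have := (h (n - 1) (by omega) 1 (by omega)).1 m3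
    omega
  obtain ⟨N, hN⟩ := exists_bound f
  have m1 : p 0 ∉ side r e (R 1) := fun hc => by
    have := (h 1 (by omega) 0 (by omega)).1 hc
    omega
  have m2 : p 1 ∈ side r e (R 1) := (h 1 (by omega) 1 (by omega)).2 (by omega)
  have := (hf 1 (by omega)).ne m2 m1
  rcases lt_or_ge (f (p 0)) (f (p 1)) with h' | h'
  · exact main f hf h'
  · have := hN (p 0); have := hN (p 1)
    exact main (fun v => N - f v) (fun a ha => (hf a ha).sub fun v => (hN v).le) (by omega)

/-- A point that lies in `R 0`, not in `R 1`, and next in `R d`, closes a shorter cycle. -/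
lemma CyclePattern.shorten (h : CyclePattern r n R p e) {d : ℕ} (hd : 2 ≤ d) (hdn : d + 1 < n)
    (h0 : v ∈ side r e (R 0)) (hvd : v ∈ side r e (R d))
    (hv : ∀ a, 0 < a → a < d → v ∉ side r e (R a)) :
    CyclePattern r (d + 1) R (fun j => if j = 0 then v else p j) e := by
  intro a ha b hb
  by_cases hb0 : b = 0
  · simp only [if_pos hb0]
    rcases Nat.eq_zero_or_pos a with rfl | ha0
    · simp only [h0, true_iff]; omega
    · by_cases had : a = d
      · subst had
        simp only [hvd, true_iff, true_and]; omega
      · simp only [hv a ha0 (by omega), false_iff]; omega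
  · simp only [if_neg hb0]
    rw [h a (by omega) b (by omega)]
    omega

/-- In a minimal cycle pattern on at least five splits, no point lies in all of them. -/
lemma CyclePattern.false_of_forall_mem [Finite V] (h : CyclePattern r n R p e) (h5 : 5 ≤ n)
    (hv : ∀ a < n, v ∈ side r e (R a)) (harc : Arcs r e (R '' {a | a < 4})) : False := by
  obtain ⟨f, hf⟩ := harc
  have hf : ∀ a < 4, RankConvex f (side r e (R a)) := fun a ha => hf _ ⟨a, ha, rfl⟩
  have main : ∀ f : V → ℕ, (∀ a < 4, RankConvex f (side r e (R a))) → f (p 1) < f (p 2) →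
      False := by
    intro f hf h12
    have inn : ∀ a b, a < 4 → b ≤ 4 → (b = a ∨ b = a + 1) → p b ∈ side r e (R a) :=
      fun a b ha hb hab => (h a (by omega) b (by omega)).2 (by omega)
    have out : ∀ a b, a < 4 → b ≤ 4 → ¬ (b = a ∨ b = a + 1) → p b ∉ side r e (R a) :=
      fun a b ha hb hab hc => by
        have := (h a (by omega) b (by omega)).1 hc
        omega
    have hv' : ∀ a < 4, v ∈ side r e (R a) := fun a ha => hv a (by omega)
    -- A common point of two overlapping intervals lies between two points of the differences.
    have mid : ∀ {A B : Set V}, RankConvex f A → RankConvex f B → ∀ {x y z}, x ∈ A → x ∉ B →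
        y ∈ A → y ∈ B → z ∈ B → z ∉ A → (f x < f y ↔ f y < f z) := by
      intro A B hA hB x y z h1 h2 h3 h4 h5 h6
      have := hB.ne h4 h2
      have := hA.ne h3 h6
      have a1 : ¬ (f x ≤ f z ∧ f z ≤ f y) := fun h' => h6 (hA h1 h3 h'.1 h'.2)
      have a2 : ¬ (f y ≤ f z ∧ f z ≤ f x) := fun h' => h6 (hA h3 h1 h'.1 h'.2)
      have a3 : ¬ (f z ≤ f x ∧ f x ≤ f y) := fun h' => h2 (hB h5 h4 h'.1 h'.2)
      have a4 : ¬ (f y ≤ f x ∧ f x ≤ f z) := fun h' => h2 (hB h4 h5 h'.1 h'.2)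
      omega
    have c0 := hf 0 (by omega); have c1 := hf 1 (by omega)
    have c2 := hf 2 (by omega); have c3 := hf 3 (by omega)
    have b1 := mid c0 c1 (inn 0 0 (by omega) (by omega) (by omega))
      (out 1 0 (by omega) (by omega) (by omega)) (inn 0 1 (by omega) (by omega) (by omega))
      (inn 1 1 (by omega) (by omega) (by omega)) (inn 1 2 (by omega) (by omega) (by omega))
      (out 0 2 (by omega) (by omega) (by omega))
    have b2 := mid c0 c1 (inn 0 0 (by omega) (by omega) (by omega))
      (out 1 0 (by omega) (by omega) (by omega)) (hv' 0 (by omega)) (hv' 1 (by omega))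
      (inn 1 2 (by omega) (by omega) (by omega)) (out 0 2 (by omega) (by omega) (by omega))
    have b3 := mid c1 c2 (inn 1 1 (by omega) (by omega) (by omega))
      (out 2 1 (by omega) (by omega) (by omega)) (inn 1 2 (by omega) (by omega) (by omega))
      (inn 2 2 (by omega) (by omega) (by omega)) (inn 2 3 (by omega) (by omega) (by omega))
      (out 1 3 (by omega) (by omega) (by omega))
    have b4 := mid c2 c3 (inn 2 2 (by omega) (by omega) (by omega))
      (out 3 2 (by omega) (by omega) (by omega)) (inn 2 3 (by omega) (by omega) (by omega))
      (inn 3 3 (by omega) (by omega) (by omega)) (inn 3 4 (by omega) (by omega) (by omega))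
      (out 2 4 (by omega) (by omega) (by omega))
    have b5 := mid c2 c3 (inn 2 2 (by omega) (by omega) (by omega))
      (out 3 2 (by omega) (by omega) (by omega)) (hv' 2 (by omega)) (hv' 3 (by omega))
      (inn 3 4 (by omega) (by omega) (by omega)) (out 2 4 (by omega) (by omega) (by omega))
    have d1 := c0.ne (hv' 0 (by omega)) (out 0 2 (by omega) (by omega) (by omega))
    omega
  obtain ⟨N, hN⟩ := exists_bound f
  have m1 : p 1 ∉ side r e (R 2) := fun hc => by
    have := (h 2 (by omega) 1 (by omega)).1 hc
    omega
  have m2 : p 2 ∈ side r e (R 2) := (h 2 (by omega) 2 (by omega)).2 (by omega)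
  have := (hf 2 (by omega)).ne m2 m1
  rcases lt_or_ge (f (p 1)) (f (p 2)) with h' | h'
  · exact main f hf h'
  · have := hN (p 1); have := hN (p 2)
    exact main (fun v => N - f v) (fun a ha => (hf a ha).sub fun v => (hN v).le) (by omega)

/-- In a minimal cycle pattern, a point lies in no split, in all of them, or in one or two
consecutive ones, which can be numbered `1` and `2`. -/
lemma CyclePattern.trichotomy [Finite V] (h : CyclePattern r n R p e) (h4 : 4 ≤ n) (v : V)
    (hmin : ∀ a < n, Arcs r e (R '' {b | b < n ∧ b ≠ a})) :
    (∀ a < n, v ∉ side r e (R a)) ∨ (∀ a < n, v ∈ side r e (R a)) ∨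
      ∃ j < n, v ∈ side r e (R ((1 + j) % n)) ∧
        ∀ a < n, v ∈ side r e (R ((a + j) % n)) → a = 1 ∨ a = 2 := by
  by_cases hnone : ∀ a < n, v ∉ side r e (R a)
  · exact Or.inl hnone
  by_cases hall : ∀ a < n, v ∈ side r e (R a)
  · exact Or.inr (Or.inl hall)
  right; right
  -- some split containing the point is followed by one that does not contain it
  obtain ⟨i, hi, hvi, hvi'⟩ : ∃ i < n, v ∈ side r e (R i) ∧ v ∉ side r e (R ((1 + i) % n)) := by
    by_contra hc
    push Not at hc
    push Not at hnone
    obtain ⟨a, ha, hva⟩ := hnone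
    refine hall fun b hb => ?_
    have : ∀ k, v ∈ side r e (R ((k + a) % n)) := by
      intro k
      induction k with
      | zero => rwa [Nat.zero_add, Nat.mod_eq_of_lt ha]
      | succ k ih =>
        have := hc _ (Nat.mod_lt _ (by omega)) ih
        rwa [Nat.add_mod_mod, ← Nat.add_assoc, Nat.add_comm 1 k] at this
    have := this (b + n - a)
    rwa [show b + n - a + a = b + n by omega, Nat.add_mod_right, Nat.mod_eq_of_lt hb] at this
  have hrot := h.rotate hi
  have key : ∀ d, 0 < d → d + 1 < n → v ∉ side r e (R ((d + i) % n)) := by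
    intro d
    induction d using Nat.strong_induction_on with
    | _ d ih =>
      intro hd hdn hvd
      have hd2 : 2 ≤ d := by
        by_contra hc
        obtain rfl : d = 1 := by omega
        exact hvi' hvd
      refine (hrot.shorten (v := v) hd2 hdn ?_ hvd fun a ha had => ih a had ha (by omega)).not_arcs
        (by omega) ((hmin ((n - 1 + i) % n) (Nat.mod_lt _ (by omega))).mono ?_)
      · simpa [Nat.mod_eq_of_lt hi] using hvi
      · rintro _ ⟨a, ha, rfl⟩
        have ha : a < d + 1 := ha
        refine ⟨_, ⟨Nat.mod_lt _ (by omega), fun hc => ?_⟩, rfl⟩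
        have e1 := hrot.injOn (by omega) (a := a) (b := n - 1) (by omega) (by omega)
          (by simp only [hc])
        omega
  have conv : ∀ k, ∀ j, R ((k + (j + i) % n) % n) = R ((k + j + i) % n) := by
    intro k j
    rw [Nat.add_mod_mod, Nat.add_assoc]
  have wrap : ∀ k, R ((k + n + i) % n) = R ((k + i) % n) := by
    intro k
    rw [Nat.add_right_comm, Nat.add_mod_right]
  by_cases hlast : v ∈ side r e (R ((n - 1 + i) % n))
  · refine ⟨(n - 2 + i) % n, Nat.mod_lt _ (by omega), ?_, fun a ha hva => ?_⟩
    · rw [conv, show 1 + (n - 2) = n - 1 by omega]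
      exact hlast
    · rw [conv] at hva
      by_contra hc
      rcases Nat.eq_zero_or_pos a with rfl | ha0
      · exact key (0 + (n - 2)) (by omega) (by omega) hva
      · rw [show a + (n - 2) = (a - 2) + n by omega, wrap] at hva
        exact key (a - 2) (by omega) (by omega) hva
  · refine ⟨(n - 1 + i) % n, Nat.mod_lt _ (by omega), ?_, fun a ha hva => ?_⟩
    · rw [conv, show 1 + (n - 1) = 0 + n by omega, wrap]
      simpa [Nat.mod_eq_of_lt hi] using hvi
    · rw [conv] at hva
      by_contra hc
      rcases Nat.eq_zero_or_pos a with rfl | ha0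
      · rw [Nat.zero_add] at hva
        exact hlast hva
      · rw [show a + (n - 1) = (a - 1) + n by omega, wrap] at hva
        exact key (a - 1) (by omega) (by omega) hva

end Cycle

/-! ### Tucker submatrices with at most four rows -/

section Tucker

variable {m : ℕ}

/-- A row as a split of the columns together with an additional point `none`, which lies in no row.
-/
def rowSplit {C : Type*} [DecidableEq C] (R : Finset C) : Option C → Bool
  | none => false
  | some c => decide (c ∈ R)

lemma some_mem_side {C : Type*} [DecidableEq C] {R : Finset C} {c : C} :
    some c ∈ side rowSplit none R ↔ c ∈ R := by
  simp [side, rowSplit]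

/-- No Tucker matrix `τ` with fewer than five rows is formed by members of `rows` and columns. The
choices `R` and `v` need not be injective and `v` may take the value `none`: the conditions on `τ`,
that its rows and columns are distinct and no column is zero, exclude the degenerate choices. -/
def Avoids (rows : Set (Finset (Fin m))) : Prop :=
  ∀ (p q : ℕ) (τ : Matrix (Fin p) (Fin q) Bool), IsTuckerMatrix τ → p < 5 →
    (∀ i j, i ≠ j → ∃ k, (τ i k ^^ τ j k) = true) →
    (∀ i j, (∀ k, τ k i = τ k j) → i = j) → (∀ j, ∃ i, τ i j = true) →
    ∀ (R : Fin p → Finset (Fin m)) (v : Fin q → Option (Fin m)), (∀ i, R i ∈ rows) →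
      ¬ ∀ i j, v j ∈ side rowSplit none (R i) ↔ τ i j = true

lemma avoids_rowList {n : ℕ} {M : Matrix (Fin n) (Fin m) Bool}
    (hT : ∀ (p q : ℕ) (r : Fin p ↪ Fin n) (c : Fin q ↪ Fin m), IsTuckerSubmatrix M r c → 5 ≤ p) :
    Avoids {R | R ∈ rowList M} := by
  intro p q τ hτ hp hrow hcol hne R v hR h
  have hsome : ∀ j, ∃ c, v j = some c := by
    intro j
    obtain ⟨i, hi⟩ := hne j
    have := (h i j).2 hi
    cases hv : v j with
    | none => rw [hv] at this; exact (base_notMem_side this).elim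
    | some c => exact ⟨c, rfl⟩
  choose c hc using hsome
  have hrows : ∀ i, ∃ k, R i = Finset.univ.filter fun j => M k j = true := by
    intro i
    have := hR i
    simp only [Set.mem_ofPred_eq, rowList, List.mem_ofFn] at this
    obtain ⟨k, hk⟩ := this
    exact ⟨k, hk.symm⟩
  choose k hk using hrows
  have hM : ∀ i j, M (k i) (c j) = τ i j := by
    intro i j
    have := h i j
    rw [hc, some_mem_side, hk] at this
    simp only [Finset.mem_filter, Finset.mem_univ, true_and] at this
    exact Bool.eq_iff_iff.2 this
  have hk' : Function.Injective k := fun i j hij => by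
    by_contra hne
    obtain ⟨l, hl⟩ := hrow i j hne
    rw [← hM, ← hM, hij, Bool.xor_self] at hl
    exact Bool.false_ne_true hl
  have hc' : Function.Injective c := fun i j hij => hcol i j fun l => by rw [← hM, ← hM, hij]
  have e : M.submatrix k c = τ := by
    ext i j
    exact hM i j
  rw [← e] at hτ
  have := hT p q ⟨k, hk'⟩ ⟨c, hc'⟩ hτ
  omega

variable {rows : Set (Finset (Fin m))}

/-- Three rows of which any two share a column outside the third form `M_I`. -/
lemma Avoids.false_of_pairs (hr : Avoids rows) {A B D : Finset (Fin m)} (hA : A ∈ rows)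
    (hB : B ∈ rows) (hD : D ∈ rows) {u v w : Option (Fin m)}
    (hu : u ∈ side rowSplit none A ∧ u ∈ side rowSplit none B ∧ u ∉ side rowSplit none D)
    (hv : v ∈ side rowSplit none B ∧ v ∈ side rowSplit none D ∧ v ∉ side rowSplit none A)
    (hw : w ∈ side rowSplit none D ∧ w ∈ side rowSplit none A ∧ w ∉ side rowSplit none B) :
    False := by
  refine hr _ _ (tuckerI 0) (.I 0) (by decide) (by decide) (by decide) (by decide) ![A, B, D]
    ![w, u, v] (fun i => ?_) fun i j => ?_
  · fin_cases i <;> assumption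
  · fin_cases i <;> fin_cases j <;> simp [tuckerI, *]

/-- Any three rows can be ordered. -/
lemma Avoids.arcs_three (hr : Avoids rows) {A B D : Finset (Fin m)} (hA : A ∈ rows)
    (hB : B ∈ rows) (hD : D ∈ rows) : Arcs rowSplit none {A, B, D} := by
  by_contra hc
  have hc' : ¬ ∃ f : Option (Fin m) → ℕ, RankConvex f (side rowSplit none A) ∧
      RankConvex f (side rowSplit none B) ∧ RankConvex f (side rowSplit none D) := by
    rintro ⟨f, h1, h2, h3⟩
    exact hc ⟨f, by rintro i (rfl | rfl | rfl) <;> assumption⟩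
  rcases venn_of_not_exists_rank hc' with ⟨⟨u, hu⟩, ⟨v, hv⟩, ⟨w, hw⟩⟩ |
    ⟨⟨a, ha1, ha2, ha3⟩, ⟨b, hb1, hb2, hb3⟩, ⟨c, hc1, hc2, hc3⟩, ⟨d, hd1, hd2, hd3⟩⟩
  · exact hr.false_of_pairs hA hB hD hu hv hw
  · refine hr _ _ (tuckerIII 0) (.III 0) (by decide) (by decide) (by decide) (by decide) ![A, B, D]
      ![b, a, c, d] (fun i => ?_) fun i j => ?_
    · fin_cases i <;> assumption
    · fin_cases i <;> fin_cases j <;> simp [tuckerIII, *]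

/-- A star pattern is `M_IV`, `M_V` or contains `M_I`, depending on the number of pairs from which
`none` is not separated by the split belonging to the pair. -/
lemma Avoids.false_of_starPattern (hr : Avoids rows) {T : Fin 3 → Finset (Fin m)}
    {B : Finset (Fin m)} {a b : Fin 3 → Option (Fin m)} (hT : ∀ k, T k ∈ rows) (hB : B ∈ rows)
    (h : StarPattern rowSplit T B a b) : False := by
  have main : ∀ {a b : Fin 3 → Option (Fin m)} (t : Fin 3 → Bool),
      (∀ k, a k ∉ side rowSplit none B) →
      (∀ k, b k ∈ side rowSplit none B) →
      (∀ k l, rowSplit (T k) (a l) = (t k ^^ decide (k = l)) ∧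
        rowSplit (T k) (b l) = (t k ^^ decide (k = l))) → False := by
    intro a b t ha hb ht
    -- `t k` is the value of the split `T k` away from its pair, and `none` has the value `false`
    have hma : ∀ k l, a l ∈ side rowSplit none (T k) ↔ (t k ^^ decide (k = l)) = true := by
      intro k l
      rw [mem_side, (ht k l).1]
      simp [rowSplit]
    have hmb : ∀ k l, b l ∈ side rowSplit none (T k) ↔ (t k ^^ decide (k = l)) = true := by
      intro k l
      rw [mem_side, (ht k l).2]
      simp [rowSplit]
    have two : ∀ k₁ k₂ k₃ : Fin 3, k₁ ≠ k₂ → k₁ ≠ k₃ → k₂ ≠ k₃ → t k₁ = true → t k₂ = true →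
        False := by
      intro k₁ k₂ k₃ h12 h13 h23 h1 h2
      exact hr.false_of_pairs (hT k₁) (hT k₂) hB (u := a k₃) (v := b k₁) (w := b k₂)
        (by simp [hma, h1, h2, h13, h23, ha]) (by simp [hmb, h1, h2, h12.symm, hb])
        (by simp [hmb, h1, h2, h12, hb])
    have one : ∀ k₁ k₂ k₃ : Fin 3, k₁ ≠ k₂ → k₁ ≠ k₃ → k₂ ≠ k₃ → t k₁ = true → t k₂ = false →
        t k₃ = false → False := by
      intro k₁ k₂ k₃ h12 h13 h23 h1 h2 h3
      refine hr _ _ tuckerV .V (by decide) (by decide) (by decide) (by decide)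
        ![T k₂, T k₁, T k₃, B] ![b k₂, a k₂, a k₃, b k₃, b k₁] (fun i => ?_) fun i j => ?_
      · fin_cases i <;> simp [hT, hB]
      · fin_cases i <;> fin_cases j <;>
          simp [tuckerV, hma, hmb, ha, hb, h1, h2, h3, h12, h13, h23, h12.symm, h13.symm, h23.symm]
    have zero : t 0 = false → t 1 = false → t 2 = false → False := by
      intro h1 h2 h3
      refine hr _ _ tuckerIV .IV (by decide) (by decide) (by decide) (by decide)
        ![T 0, T 1, T 2, B] ![a 0, b 0, a 1, b 1, a 2, b 2] (fun i => ?_) fun i j => ?_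
      · fin_cases i <;> simp [hT, hB]
      · fin_cases i <;> fin_cases j <;> simp [tuckerIV, hma, hmb, ha, hb, h1, h2, h3]
    cases h0 : t 0 <;> cases h1 : t 1 <;> cases h2 : t 2
    · exact zero h0 h1 h2
    · exact one 2 0 1 (by decide) (by decide) (by decide) h2 h0 h1
    · exact one 1 0 2 (by decide) (by decide) (by decide) h1 h0 h2
    · exact two 1 2 0 (by decide) (by decide) (by decide) h1 h2
    · exact one 0 1 2 (by decide) (by decide) (by decide) h0 h1 h2
    · exact two 0 2 1 (by decide) (by decide) (by decide) h0 h2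
    · exact two 0 1 2 (by decide) (by decide) (by decide) h0 h1
    · exact two 0 1 2 (by decide) (by decide) (by decide) h0 h1
  obtain ⟨t, t', h⟩ := h
  cases t'
  · refine main (a := a) (b := b) t (fun k => ?_) (fun k => ?_) fun k l => (h k).2.2 l
    · rw [notMem_side, (h k).1]; rfl
    · rw [mem_side, (h k).2.1]; simp [rowSplit]
  · refine main (a := b) (b := a) t (fun k => ?_) (fun k => ?_) fun k l => ((h k).2.2 l).symm
    · rw [notMem_side, (h k).2.1]; rfl
    · rw [mem_side, (h k).1]; simp [rowSplit]

/-- Membership in the side that avoids `v`, in terms of the side that avoids `e`. -/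
lemma mem_side_rebase {ι V : Type*} {r : ι → V → Bool} {e v w : V} {i : ι} :
    w ∈ side r v i ↔ ¬ (w ∈ side r e i ↔ v ∈ side r e i) := by
  rw [mem_side_iff_mem_side, mem_side]

/-- A cycle pattern with four splits is `M_I`, `M_II` or `M_III`. -/
lemma Avoids.false_of_cyclePattern_four (hr : Avoids rows) {R : ℕ → Finset (Fin m)}
    {p : ℕ → Option (Fin m)} {e : Option (Fin m)} (hR : ∀ a < 4, R a ∈ rows)
    (h : CyclePattern rowSplit 4 R p e)
    (hv : (∀ a < 4, none ∉ side rowSplit e (R a)) ∨ (∀ a < 4, none ∈ side rowSplit e (R a)) ∨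
      (none ∈ side rowSplit e (R 1) ∧ ∀ a < 4, none ∈ side rowSplit e (R a) → a = 1 ∨ a = 2)) :
    False := by
  have hp : ∀ a < 4, ∀ b < 4, p b ∈ side rowSplit none (R a) ↔
      ¬ ((b = a ∨ b = a + 1 ∨ (a + 1 = 4 ∧ b = 0)) ↔ none ∈ side rowSplit e (R a)) := by
    intro a ha b hb
    rw [mem_side_rebase (e := e), h a ha b hb]
  have he : ∀ a, e ∈ side rowSplit none (R a) ↔ none ∈ side rowSplit e (R a) := by
    intro a
    rw [mem_side_rebase (e := e)]
    simp [base_notMem_side]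
  have hR' := fun a (ha : a < 4) => hR a ha
  rcases hv with hv | hv | ⟨h1, hv⟩
  · refine hr _ _ (tuckerI 1) (.I 1) (by decide) (by decide) (by decide) (by decide)
      ![R 0, R 1, R 2, R 3] ![p 0, p 1, p 2, p 3] (fun i => ?_) fun i j => ?_
    · fin_cases i <;> simp [hR]
    · fin_cases i <;> fin_cases j <;> simp [tuckerI, hp, hv]
  · refine hr _ _ (tuckerI 1) (.I 1) (by decide) (by decide) (by decide) (by decide)
      ![R 2, R 3, R 0, R 1] ![p 0, p 1, p 2, p 3] (fun i => ?_) fun i j => ?_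
    · fin_cases i <;> simp [hR]
    · fin_cases i <;> fin_cases j <;> simp [tuckerI, hp, hv]
  · have h0 : none ∉ side rowSplit e (R 0) := fun hc => by have := hv 0 (by omega) hc; omega
    have h3 : none ∉ side rowSplit e (R 3) := fun hc => by have := hv 3 (by omega) hc; omega
    by_cases h2 : none ∈ side rowSplit e (R 2)
    · refine hr _ _ (tuckerII 0) (.II 0) (by decide) (by decide) (by decide) (by decide)
        ![R 3, R 0, R 1, R 2] ![p 3, p 0, p 1, e] (fun i => ?_) fun i j => ?_
      · fin_cases i <;> simp [hR]
      · fin_cases i <;> fin_cases j <;> simp [tuckerII, hp, he, h0, h1, h2, h3]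
    · refine hr _ _ (tuckerIII 1) (.III 1) (by decide) (by decide) (by decide) (by decide)
        ![R 2, R 3, R 0, R 1] ![p 2, p 3, p 0, p 1, e] (fun i => ?_) fun i j => ?_
      · fin_cases i <;> simp [hR]
      · fin_cases i <;> fin_cases j <;> simp [tuckerIII, hp, he, h0, h1, h2, h3]

/-- A minimal family of rows without the consecutive-ones property is a long cycle pattern. The
point `none` lies in no split of the pattern or in one or two consecutive ones; these are the cases
of `M_I`, `M_III` and `M_II`. -/
theorem Avoids.exists_cyclePattern (hr : Avoids rows) {J : Finset (Finset (Fin m))}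
    (hJr : ∀ R ∈ J, R ∈ rows) (hJ : ¬ Arcs rowSplit none (J : Set (Finset (Fin m))))
    (hmin : ∀ R ∈ J, Arcs rowSplit none ((J.erase R : Finset (Finset (Fin m))) :
      Set (Finset (Fin m)))) :
    ∃ (n : ℕ) (R : ℕ → Finset (Fin m)) (p : ℕ → Option (Fin m)) (e : Option (Fin m)), 5 ≤ n ∧
      J = (Finset.range n).image R ∧ CyclePattern rowSplit n R p e ∧
      ((∀ a < n, none ∉ side rowSplit e (R a)) ∨
        (none ∈ side rowSplit e (R 1) ∧
          ∀ a < n, none ∈ side rowSplit e (R a) → a = 1 ∨ a = 2)) := by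
  have h4 : 4 ≤ J.card := by
    by_contra hc
    have hle : J.card ≤ 3 := by omega
    have : ∃ A ∈ rows, ∃ B ∈ rows, ∃ D ∈ rows, (J : Set (Finset (Fin m))) ⊆ {A, B, D} := by
      rcases J.eq_empty_or_nonempty with rfl | ⟨A, hA⟩
      · exact (hJ ⟨fun _ => 0, by simp⟩).elim
      rcases (J.erase A).eq_empty_or_nonempty with h | ⟨B, hB⟩
      · refine ⟨A, hJr A hA, A, hJr A hA, A, hJr A hA, fun x hx => ?_⟩
        rw [← Finset.insert_erase hA, h] at hx
        simpa using hx
      have hB' := Finset.mem_of_mem_erase hB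
      rcases ((J.erase A).erase B).eq_empty_or_nonempty with h | ⟨D, hD⟩
      · refine ⟨A, hJr A hA, B, hJr B hB', B, hJr B hB', fun x hx => ?_⟩
        rw [← Finset.insert_erase hA, ← Finset.insert_erase hB, h] at hx
        simpa using hx
      have hD' := Finset.mem_of_mem_erase (Finset.mem_of_mem_erase hD)
      refine ⟨A, hJr A hA, B, hJr B hB', D, hJr D hD', fun x hx => ?_⟩
      have c1 := Finset.card_erase_of_mem hA
      have c2 := Finset.card_erase_of_mem hB
      have c3 := Finset.card_erase_of_mem hD
      have c4 : ((J.erase A).erase B).erase D = ∅ := Finset.card_eq_zero.1 (by omega)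
      rw [← Finset.insert_erase hA, ← Finset.insert_erase hB, ← Finset.insert_erase hD, c4] at hx
      simpa using hx
    obtain ⟨A, hA, B, hB, D, hD, hsub⟩ := this
    exact hJ ((hr.arcs_three hA hB hD).mono hsub)
  rcases exists_pattern_of_minimal hJ hmin h4 with ⟨T, B, a, b, hT, hB, h⟩ |
    ⟨n, R, p, e, hn, hR, h⟩
  · exact (hr.false_of_starPattern (fun k => hJr _ (hT k)) (hJr _ hB) h).elim
  have hsub : (Finset.range n).image R ⊆ J := by
    intro x hx
    simp only [Finset.mem_image, Finset.mem_range] at hx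
    obtain ⟨a, ha, rfl⟩ := hx
    exact hR a ha
  have hJR : J = (Finset.range n).image R := by
    refine (Finset.Subset.antisymm hsub fun i hi => ?_).symm
    by_contra hc
    refine h.not_arcs hn ((hmin i hi).rebase.mono ?_)
    rintro _ ⟨a, ha, rfl⟩
    refine Finset.mem_coe.2 (Finset.mem_erase.2 ⟨fun h' => hc ?_, hR a ha⟩)
    exact Finset.mem_image.2 ⟨a, Finset.mem_range.2 ha, h'⟩
  have hcard : J.card = n := by
    rw [hJR, Finset.card_image_of_injOn, Finset.card_range]
    intro a ha b hb hab
    exact h.injOn hn (by simpa using ha) (by simpa using hb) hab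
  have hn4 : 4 ≤ n := by omega
  have harcs : ∀ a < n, Arcs rowSplit e (R '' {b | b < n ∧ b ≠ a}) := by
    intro a ha
    refine (hmin (R a) (hR a ha)).rebase.mono ?_
    rintro _ ⟨b, ⟨hb, hba⟩, rfl⟩
    exact Finset.mem_coe.2 (Finset.mem_erase.2 ⟨fun h' => hba (h.injOn hn hb ha h'), hR b hb⟩)
  have rot : ∀ j < n, J = (Finset.range n).image fun a => R ((a + j) % n) := by
    intro j hj
    have hinj : Set.InjOn (fun a => R ((a + j) % n)) (Finset.range n : Finset ℕ) := by
      intro a ha b hb hab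
      exact (h.rotate hj).injOn hn (by simpa using ha) (by simpa using hb) hab
    refine (Finset.eq_of_subset_of_card_le ?_ ?_).symm
    · intro x hx
      simp only [Finset.mem_image, Finset.mem_range] at hx
      obtain ⟨a, ha, rfl⟩ := hx
      exact hR _ (Nat.mod_lt _ (by omega))
    · rw [Finset.card_image_of_injOn hinj, Finset.card_range, hcard]
  have h5 : n ≠ 4 := by
    rintro rfl
    rcases h.trichotomy hn4 none harcs with hv | hv | ⟨j, hj, hv⟩
    · exact hr.false_of_cyclePattern_four (fun a ha => hJr _ (hR a ha)) h (Or.inl hv)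
    · exact hr.false_of_cyclePattern_four (fun a ha => hJr _ (hR a ha)) h (Or.inr (Or.inl hv))
    · exact hr.false_of_cyclePattern_four (fun a ha => hJr _ (hR _ (Nat.mod_lt _ (by omega))))
        (h.rotate hj) (Or.inr (Or.inr hv))
  rcases h.trichotomy hn4 none harcs with hv | hv | ⟨j, hj, hv⟩
  · exact ⟨n, R, p, e, by omega, hJR, h, Or.inl hv⟩
  · refine (h.false_of_forall_mem (by omega) hv ((harcs 4 (by omega)).mono ?_)).elim
    rintro _ ⟨a, ha, rfl⟩
    have ha : a < 4 := ha
    exact ⟨a, ⟨by omega, by omega⟩, rfl⟩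
  · exact ⟨n, _, _, e, by omega, rot j hj, h.rotate hj, Or.inr hv⟩

end Tucker

/-! ### The rows that lie between the ends of a removed row -/

section Between

variable {ι V : Type*} {r : ι → V → Bool} {n : ℕ} {R : ℕ → ι} {p : ℕ → V} {e : V}

/-- The points `q lo, …, q hi` of a chain of convex sets that avoid `w` lie on the same side of `w`.
-/
lemma chain_lt_iff {V : Type*} {f : V → ℕ} {s : ℕ → Set V} {q : ℕ → V} {w : V} {lo hi : ℕ}
    (h : lo ≤ hi) (hs : ∀ a, lo ≤ a → a < hi → RankConvex f (s a) ∧ q a ∈ s a ∧ q (a + 1) ∈ s a ∧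
      w ∉ s a) : f (q lo) < f w ↔ f (q hi) < f w := by
  induction hi, h using Nat.le_induction with
  | base => exact Iff.rfl
  | succ k hk ih =>
    obtain ⟨h1, h2, h3, h4⟩ := hs k hk (Nat.lt_succ_self k)
    exact (ih fun a ha hak => hs a ha (by omega)).trans (h1.lt_iff_of_notMem h2 h3 h4)

lemma CyclePattern.setOverlap_succ (h : CyclePattern r n R p e) (h4 : 4 ≤ n) {a : ℕ}
    (ha : a + 1 < n) : SetOverlap (side r e (R a)) (side r e (R (a + 1))) := by
  refine ⟨⟨p (a + 1), ?_, ?_⟩, ⟨p a, ?_, ?_⟩, ?_⟩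
  · exact (h a (by omega) _ ha).2 (by omega)
  · exact (h _ ha _ ha).2 (by omega)
  · exact (h a (by omega) _ (by omega)).2 (by omega)
  · rw [h (a + 1) ha _ (by omega)]; omega
  · by_cases hn : a + 2 = n
    · refine ⟨p 0, ?_, ?_⟩
      · exact (h _ ha _ (by omega)).2 (by omega)
      · rw [h a (by omega) _ (by omega)]; omega
    · refine ⟨p (a + 2), ?_, ?_⟩
      · exact (h _ ha _ (by omega)).2 (by omega)
      · rw [h a (by omega) _ (by omega)]; omega

lemma linked_image_of_succ {α : Type*} {s : ι → Set α} {lo hi : ℕ}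
    (h : ∀ a, lo ≤ a → a + 1 < hi → SetOverlap (s (R a)) (s (R (a + 1)))) :
    Linked s (R '' {a | lo ≤ a ∧ a < hi}) := by
  have key : ∀ a b, lo ≤ a → a ≤ b → b < hi →
      Relation.ReflTransGen (fun i j => j ∈ R '' {a | lo ≤ a ∧ a < hi} ∧ SetOverlap (s i) (s j))
        (R a) (R b) ∧
      Relation.ReflTransGen (fun i j => j ∈ R '' {a | lo ≤ a ∧ a < hi} ∧ SetOverlap (s i) (s j))
        (R b) (R a) := by
    intro a b ha hab
    induction b, hab using Nat.le_induction with
    | base => exact fun _ => ⟨.refl, .refl⟩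
    | succ k hk ih =>
      intro hb
      obtain ⟨h1, h2⟩ := ih (by omega)
      have ho := h k (by omega) hb
      exact ⟨h1.tail ⟨⟨k + 1, ⟨by omega, hb⟩, rfl⟩, ho⟩,
        .head ⟨⟨k, ⟨by omega, by omega⟩, rfl⟩, ho.symm⟩ h2⟩
  rintro _ ⟨a, ⟨ha, ha'⟩, rfl⟩ _ ⟨b, ⟨hb, hb'⟩, rfl⟩
  rcases le_total a b with hab | hab
  · exact (key a b ha hab hb').1
  · exact (key b a hb hab ha').2

/-- If `v` lies in none of the splits of the pattern, then `p 3` lies between `p 0` and `p 1` in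
every order of all splits but `R 0`. -/
lemma CyclePattern.between_of_forall_notMem (h : CyclePattern r n R p e) (h5 : 5 ≤ n) {v : V}
    (hv : ∀ a < n, v ∉ side r e (R a)) {f : V → ℕ}
    (hf : ∀ a, 1 ≤ a → a < n → RankConvex f (side r v (R a))) :
    f (p 0) < f (p 3) ∧ f (p 3) < f (p 1) ∨ f (p 1) < f (p 3) ∧ f (p 3) < f (p 0) := by
  have hp : ∀ a < n, ∀ b < n, p b ∈ side r v (R a) ↔ b = a ∨ b = a + 1 ∨ (a + 1 = n ∧ b = 0) := by
    intro a ha b hb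
    rw [mem_side_rebase (e := e), h a ha b hb]
    have := hv a ha
    tauto
  have c1 : f (p 0) < f (p 3) ↔ f (p 4) < f (p 3) := by
    have := chain_lt_iff (f := f) (s := fun a => side r v (R a)) (q := fun b => p (b % n))
      (w := p 3) (lo := 4) (hi := n) (by omega) ?_
    · simp only [Nat.mod_self, Nat.mod_eq_of_lt (show 4 < n by omega)] at this
      exact this.symm
    · intro a ha han
      refine ⟨hf a (by omega) han, ?_, ?_, ?_⟩
      · rw [Nat.mod_eq_of_lt han, hp a han a han]; omega
      · rcases Nat.lt_or_ge (a + 1) n with h' | h'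
        · rw [Nat.mod_eq_of_lt h', hp a han _ h']; omega
        · obtain rfl : n = a + 1 := by omega
          rw [Nat.mod_self, hp a han 0 (by omega)]; omega
      · rw [hp a han 3 (by omega)]; omega
  have c2 := (hf 1 (by omega) (by omega)).lt_iff_of_notMem (x := p 1) (x' := p 2) (y := p 3)
    (by rw [hp] <;> omega) (by rw [hp] <;> omega) (by rw [hp] <;> omega)
  have c3 := (hf 2 (by omega) (by omega)).lt_iff_of_notMem (x := p 2) (x' := p 3) (y := p 4)
    (by rw [hp] <;> omega) (by rw [hp] <;> omega) (by rw [hp] <;> omega)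
  have c4 := (hf 3 (by omega) (by omega)).lt_iff_of_notMem (x := p 3) (x' := p 4) (y := p 2)
    (by rw [hp] <;> omega) (by rw [hp] <;> omega) (by rw [hp] <;> omega)
  have n1 := (hf (n - 1) (by omega) (by omega)).ne (x := p 0) (y := p 3)
    (by rw [hp] <;> omega) (by rw [hp] <;> omega)
  have n2 := (hf 1 (by omega) (by omega)).ne (x := p 1) (y := p 3)
    (by rw [hp] <;> omega) (by rw [hp] <;> omega)
  have n3 := (hf 1 (by omega) (by omega)).ne (x := p 2) (y := p 3)
    (by rw [hp] <;> omega) (by rw [hp] <;> omega)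
  have n4 := (hf 2 (by omega) (by omega)).ne (x := p 3) (y := p 4)
    (by rw [hp] <;> omega) (by rw [hp] <;> omega)
  have n5 := (hf 2 (by omega) (by omega)).ne (x := p 2) (y := p 4)
    (by rw [hp] <;> omega) (by rw [hp] <;> omega)
  omega

/-- If `v` lies exactly in the split `R i` or exactly in `R i` and `R (i + 1)`, none of which is
next to `R 0`, then `e` lies between `p 0` and `p 1` in every order of all splits but `R 0`. -/
lemma CyclePattern.between_of_mem (h : CyclePattern r n R p e) {v : V} {i j : ℕ}
    (hi : 2 ≤ i) (hij : i ≤ j) (hji : j ≤ i + 1) (hj : j + 2 ≤ n)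
    (hv : ∀ a < n, v ∈ side r e (R a) ↔ a = i ∨ a = j) {f : V → ℕ}
    (hf : ∀ a, 1 ≤ a → a < n → RankConvex f (side r v (R a))) :
    f (p 0) < f e ∧ f e < f (p 1) ∨ f (p 1) < f e ∧ f e < f (p 0) := by
  have hp : ∀ a < n, ∀ b < n, p b ∈ side r v (R a) ↔
      ¬ ((b = a ∨ b = a + 1 ∨ (a + 1 = n ∧ b = 0)) ↔ (a = i ∨ a = j)) := by
    intro a ha b hb
    rw [mem_side_rebase (e := e), h a ha b hb, hv a ha]
  have he : ∀ a < n, e ∈ side r v (R a) ↔ a = i ∨ a = j := by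
    intro a ha
    rw [mem_side_rebase (e := e), ← hv a ha]
    simp [base_notMem_side]
  have left : ∀ w, (∀ a, 1 ≤ a → a < i → w ∉ side r v (R a)) → (f (p 1) < f w ↔ f (p i) < f w) := by
    intro w hw
    refine chain_lt_iff (s := fun a => side r v (R a)) (by omega) fun a ha hai => ?_
    refine ⟨hf a ha (by omega), ?_, ?_, hw a ha hai⟩ <;> rw [hp _ (by omega) _ (by omega)] <;> omega
  have right : ∀ w, (∀ a, j < a → a < n → w ∉ side r v (R a)) →
      (f (p (j + 1)) < f w ↔ f (p 0) < f w) := by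
    intro w hw
    have := chain_lt_iff (f := f) (s := fun a => side r v (R a)) (q := fun b => p (b % n)) (w := w)
      (lo := j + 1) (hi := n) (by omega) ?_
    · simpa only [Nat.mod_self, Nat.mod_eq_of_lt (show j + 1 < n by omega)] using this
    · intro a ha han
      refine ⟨hf a (by omega) han, ?_, ?_, hw a (by omega) han⟩
      · rw [Nat.mod_eq_of_lt han, hp a han a han]; omega
      · rcases Nat.lt_or_ge (a + 1) n with h' | h'
        · rw [Nat.mod_eq_of_lt h', hp a han _ h']; omega
        · obtain rfl : n = a + 1 := by omega
          rw [Nat.mod_self, hp a han 0 (by omega)]; omega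
  have l1 := left e fun a ha hai => by rw [he a (by omega)]; omega
  have l2 := left (p 0) fun a ha hai => by rw [hp a (by omega) 0 (by omega)]; omega
  have r1 := right e fun a ha han => by rw [he a (by omega)]; omega
  have r2 := right (p 1) fun a ha han => by rw [hp a (by omega) 1 (by omega)]; omega
  have fi := hf i (by omega) (by omega)
  have fj := hf j (by omega) (by omega)
  have mi : e ∈ side r v (R i) ∧ p 0 ∈ side r v (R i) ∧ p 1 ∈ side r v (R i) ∧
      p i ∉ side r v (R i) := by
    rw [he i (by omega), hp i (by omega) _ (by omega), hp i (by omega) _ (by omega),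
      hp i (by omega) _ (by omega)]
    omega
  have mj : e ∈ side r v (R j) ∧ p 0 ∈ side r v (R j) ∧ p 1 ∈ side r v (R j) ∧
      p (j + 1) ∉ side r v (R j) := by
    rw [he j (by omega), hp j (by omega) _ (by omega), hp j (by omega) _ (by omega),
      hp j (by omega) _ (by omega)]
    omega
  have i1 := fi.lt_iff_of_notMem mi.1 mi.2.1 mi.2.2.2
  have i2 := fi.lt_iff_of_notMem mi.1 mi.2.2.1 mi.2.2.2
  have i3 := fi.ne mi.1 mi.2.2.2
  have i4 := fi.ne mi.2.1 mi.2.2.2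
  have i5 := fi.ne mi.2.2.1 mi.2.2.2
  have j1 := fj.lt_iff_of_notMem mj.1 mj.2.1 mj.2.2.2
  have j2 := fj.lt_iff_of_notMem mj.1 mj.2.2.1 mj.2.2.2
  have j3 := fj.ne mj.1 mj.2.2.2
  have j4 := fj.ne mj.2.1 mj.2.2.2
  have j5 := fj.ne mj.2.2.1 mj.2.2.2
  have n1 := (hf 1 (by omega) (by omega)).ne (x := p 1) (y := p 0)
    (by rw [hp _ (by omega) _ (by omega)]; omega) (by rw [hp _ (by omega) _ (by omega)]; omega)
  have n2 := (hf 1 (by omega) (by omega)).ne (x := p 1) (y := e)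
    (by rw [hp _ (by omega) _ (by omega)]; omega) (by rw [he _ (by omega)]; omega)
  have n3 := (hf (n - 1) (by omega) (by omega)).ne (x := p 0) (y := e)
    (by rw [hp _ (by omega) _ (by omega)]; omega) (by rw [he _ (by omega)]; omega)
  omega

end Between

section Wedge

variable {C : Type*} [DecidableEq C]

lemma RankConvex.option {f : C → ℕ} {R : Finset C} (h : RankConvex f (R : Set C)) :
    RankConvex (fun o : Option C => o.elim 0 fun c => f c + 1) (side rowSplit none R) := by
  rintro (_ | x) (_ | y) (_ | z) hx hz h1 h2
  all_goals first | exact (base_notMem_side hx).elim | exact (base_notMem_side hz).elim | skip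
  · simp at h1
  · rw [some_mem_side] at hx hz ⊢
    simp only [Option.elim_some, Nat.add_le_add_iff_right] at h1 h2
    exact h hx hz h1 h2

lemma RankConvex.some {g : Option C → ℕ} {R : Finset C} (h : RankConvex g (side rowSplit none R)) :
    RankConvex (fun c => g (some c)) (R : Set C) :=
  fun _ _ _ hx hz h1 h2 => some_mem_side.1 (h (some_mem_side.2 hx) (some_mem_side.2 hz) h1 h2)

/-- The consecutive-ones property in terms of ranks of the columns. -/
lemma arcs_rowSplit_none {J : Set (Finset C)} :
    Arcs rowSplit none J ↔ ∃ f : C → ℕ, ∀ R ∈ J, RankConvex f (R : Set C) :=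
  ⟨fun ⟨g, hg⟩ => ⟨fun c => g (some c), fun R hR => (hg R hR).some⟩,
    fun ⟨_, hf⟩ => ⟨_, fun R hR => (hf R hR).option⟩⟩

lemma setOverlap_side_none {R S : Finset C} :
    SetOverlap (side rowSplit none R) (side rowSplit none S) ↔
      SetOverlap (R : Set C) (S : Set C) := by
  constructor
  · rintro ⟨⟨_ | x, hx, hx'⟩, ⟨_ | y, hy, hy'⟩, ⟨_ | z, hz, hz'⟩⟩
    all_goals first | exact (base_notMem_side hx).elim | exact (base_notMem_side hy).elim |
      exact (base_notMem_side hz).elim | skip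
    rw [some_mem_side] at *
    exact ⟨⟨x, hx, hx'⟩, ⟨y, hy, hy'⟩, ⟨z, hz, hz'⟩⟩
  · rintro ⟨⟨x, hx, hx'⟩, ⟨y, hy, hy'⟩, ⟨z, hz, hz'⟩⟩
    exact ⟨⟨some x, some_mem_side.2 hx, some_mem_side.2 hx'⟩,
      ⟨some y, some_mem_side.2 hy, fun h => hy' (some_mem_side.1 h)⟩,
      ⟨some z, some_mem_side.2 hz, fun h => hz' (some_mem_side.1 h)⟩⟩

/-- The linked rows `S` force a column `y` outside `Z` between columns `x` and `z` of `Z`, where `x`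
and `z` are separated from the other two of these columns by members `A` and `B` of `S`. -/
structure Wedge (S : Set (Finset C)) (Z A B : Finset C) (x y z : C) : Prop where
  linked : Linked (fun R : Finset C => (R : Set C)) S
  left_mem : A ∈ S
  right_mem : B ∈ S
  x_mem : x ∈ Z ∧ x ∈ A ∧ x ∉ B
  y_notMem : y ∉ Z ∧ y ∉ A ∧ y ∉ B
  z_mem : z ∈ Z ∧ z ∉ A ∧ z ∈ B
  y_covered : ∃ R ∈ S, y ∈ R
  between : ∀ f : C → ℕ, (∀ R ∈ S, RankConvex f (R : Set C)) →
    f x < f y ∧ f y < f z ∨ f z < f y ∧ f y < f x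

lemma CyclePattern.exists_wedge {n : ℕ} {R : ℕ → Finset C} {p : ℕ → Option C} {e : Option C}
    (h : CyclePattern rowSplit n R p e) (h5 : 5 ≤ n)
    (hv : (∀ a < n, none ∉ side rowSplit e (R a)) ∨
      ∃ i j, 2 ≤ i ∧ i ≤ j ∧ j ≤ i + 1 ∧ j + 2 ≤ n ∧
        ∀ a < n, none ∈ side rowSplit e (R a) ↔ a = i ∨ a = j) :
    ∃ A B x y z, Wedge (R '' {a | 1 ≤ a ∧ a < n}) (R 0) A B x y z := by
  have h0 : ∀ a < n, a = 0 ∨ a = 1 ∨ a = n - 1 → none ∉ side rowSplit e (R a) := by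
    intro a ha h'
    rcases hv with hv | ⟨i, j, hi, hij, hji, hj, hv⟩
    · exact hv a ha
    · rw [hv a ha]; omega
  have hp : ∀ a < n, a = 0 ∨ a = 1 ∨ a = n - 1 → ∀ b < n, p b ∈ side rowSplit none (R a) ↔
      b = a ∨ b = a + 1 ∨ (a + 1 = n ∧ b = 0) := by
    intro a ha h' b hb
    rw [mem_side_rebase (e := e), h a ha b hb]
    have := h0 a ha h'
    tauto
  -- the point between `p 0` and `p 1`
  obtain ⟨y, hy, ⟨a, ha1, han, hay⟩, hb⟩ : ∃ y : Option C,
      (∀ a < n, a = 0 ∨ a = 1 ∨ a = n - 1 → y ∉ side rowSplit none (R a)) ∧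
      (∃ a, 1 ≤ a ∧ a < n ∧ y ∈ side rowSplit none (R a)) ∧ ∀ f : Option C → ℕ,
        (∀ a, 1 ≤ a → a < n → RankConvex f (side rowSplit none (R a))) →
        f (p 0) < f y ∧ f y < f (p 1) ∨ f (p 1) < f y ∧ f y < f (p 0) := by
    rcases hv with hv | ⟨i, j, hi, hij, hji, hj, hv⟩
    · refine ⟨p 3, fun a ha h' => ?_, ⟨2, by omega, by omega, ?_⟩,
        fun f hf => h.between_of_forall_notMem h5 hv hf⟩
      · rw [hp a ha h' _ (by omega)]; omega
      · rw [mem_side_rebase (e := e), h 2 (by omega) 3 (by omega)]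
        have := hv 2 (by omega)
        tauto
    · refine ⟨e, fun a ha h' => ?_, ⟨i, by omega, by omega, ?_⟩,
        fun f hf => h.between_of_mem hi hij hji hj hv hf⟩
      · rw [mem_side_rebase (e := e)]
        have := h0 a ha h'
        simp [base_notMem_side, this]
      · rw [mem_side_rebase (e := e), hv i (by omega)]
        simp [base_notMem_side]
  have real : ∀ {o : Option C} {D : Finset C}, o ∈ side rowSplit none D → ∃ c, o = some c := by
    rintro (_ | c) D ho
    · exact (base_notMem_side ho).elim
    · exact ⟨c, rfl⟩
  obtain ⟨x, hx⟩ := real ((hp 0 (by omega) (by omega) 0 (by omega)).2 (by omega))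
  obtain ⟨z, hz⟩ := real ((hp 0 (by omega) (by omega) 1 (by omega)).2 (by omega))
  obtain ⟨y, rfl⟩ := real hay
  refine ⟨R (n - 1), R 1, x, y, z, ?_, ⟨n - 1, ⟨by omega, by omega⟩, rfl⟩,
    ⟨1, ⟨by omega, by omega⟩, rfl⟩, ?_, ?_, ?_, ⟨R a, ⟨a, ⟨ha1, han⟩, rfl⟩, some_mem_side.1 hay⟩,
    fun f hf => ?_⟩
  · refine linked_image_of_succ fun a ha ha' => ?_
    rw [← setOverlap_side_none, setOverlap_side, ← setOverlap_side (e := e)]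
    exact h.setOverlap_succ (by omega) ha'
  · simp only [← some_mem_side, ← hx]
    rw [hp 0 (by omega) (by omega) _ (by omega), hp (n - 1) (by omega) (by omega) _ (by omega),
      hp 1 (by omega) (by omega) _ (by omega)]
    omega
  · simp only [← some_mem_side]
    exact ⟨hy 0 (by omega) (by omega), hy (n - 1) (by omega) (by omega),
      hy 1 (by omega) (by omega)⟩
  · simp only [← some_mem_side, ← hz]
    rw [hp 0 (by omega) (by omega) _ (by omega), hp (n - 1) (by omega) (by omega) _ (by omega),
      hp 1 (by omega) (by omega) _ (by omega)]
    omega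
  · have := hb _ fun a ha han => (hf (R a) ⟨a, ⟨ha, han⟩, rfl⟩).option
    simpa [hx, hz] using this

/-- Among five members of a minimal family of rows without the consecutive-ones property there is
one that is forced apart by the others: only four members of a cycle pattern are next to the splits
that contain `none`. -/
theorem Avoids.exists_wedge {m : ℕ} {rows : Set (Finset (Fin m))} (hr : Avoids rows)
    {J : Finset (Finset (Fin m))}
    (hJr : ∀ R ∈ J, R ∈ rows) (hJ : ¬ Arcs rowSplit none (J : Set (Finset (Fin m))))
    (hmin : ∀ R ∈ J, Arcs rowSplit none ((J.erase R : Finset (Finset (Fin m))) :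
      Set (Finset (Fin m))))
    {D : Finset (Finset (Fin m))} (hDJ : D ⊆ J) (hD : 5 ≤ D.card) :
    ∃ Z ∈ D, ∃ A B x y z, Wedge ((J.erase Z : Finset (Finset (Fin m))) : Set (Finset (Fin m)))
      Z A B x y z := by
  obtain ⟨n, R, p, e, h5, hJR, h, hv⟩ := hr.exists_cyclePattern hJr hJ hmin
  obtain ⟨Z, hZ, hZ'⟩ : ∃ Z ∈ D, Z ∉ (Finset.range 4).image R := by
    by_contra! hc
    have := (Finset.card_le_card hc).trans Finset.card_image_le
    rw [Finset.card_range] at this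
    omega
  obtain ⟨j, hj, rfl⟩ : ∃ j < n, R j = Z := by
    have := hDJ hZ
    rw [hJR] at this
    simpa using this
  have hj4 : 4 ≤ j := by
    by_contra hc
    exact hZ' (Finset.mem_image.2 ⟨j, by simpa using hc, rfl⟩)
  have hR0 : R ((0 + j) % n) = R j := by rw [zero_add, Nat.mod_eq_of_lt hj]
  have hv' : (∀ a < n, none ∉ side rowSplit e (R ((a + j) % n))) ∨
      ∃ i i', 2 ≤ i ∧ i ≤ i' ∧ i' ≤ i + 1 ∧ i' + 2 ≤ n ∧
        ∀ a < n, none ∈ side rowSplit e (R ((a + j) % n)) ↔ a = i ∨ a = i' := by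
    rcases hv with hv | ⟨h1, hv⟩
    · exact Or.inl fun a ha => hv _ (Nat.mod_lt _ (by omega))
    · right
      have hmod : ∀ a < n, ∀ b < 4, (a + j) % n = b ↔ a = n + b - j := by
        intro a ha b hb
        rcases Nat.lt_or_ge (a + j) n with h' | h'
        · rw [Nat.mod_eq_of_lt h']; omega
        · rw [Nat.mod_eq_sub_mod h', Nat.mod_eq_of_lt (by omega)]; omega
      by_cases h2 : none ∈ side rowSplit e (R 2)
      · refine ⟨n + 1 - j, n + 2 - j, by omega, by omega, by omega, by omega, fun a ha => ?_⟩
        rw [← hmod a ha 1 (by omega), ← hmod a ha 2 (by omega)]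
        exact ⟨hv _ (Nat.mod_lt _ (by omega)), by rintro (h' | h') <;> rw [h'] <;> assumption⟩
      · refine ⟨n + 1 - j, n + 1 - j, by omega, by omega, by omega, by omega, fun a ha => ?_⟩
        rw [← hmod a ha 1 (by omega), or_self]
        refine ⟨fun h' => (hv _ (Nat.mod_lt _ (by omega)) h').resolve_right fun h3 => h2 ?_,
          fun h' => by rw [h']; exact h1⟩
        rwa [h3] at h'
  obtain ⟨A, B, x, y, z, hw⟩ := (h.rotate hj).exists_wedge h5 hv'
  refine ⟨R j, hZ, A, B, x, y, z, ?_⟩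
  convert hw using 1
  · ext X
    rw [Finset.mem_coe, Finset.mem_erase, hJR, Finset.mem_image]
    constructor
    · rintro ⟨hne, b, hb, rfl⟩
      rw [Finset.mem_range] at hb
      have hbj : b ≠ j := fun h' => hne (by rw [h'])
      rcases Nat.lt_or_ge b j with h' | h'
      · refine ⟨b + n - j, ⟨by omega, by omega⟩, ?_⟩
        simp only
        rw [show b + n - j + j = b + n by omega, Nat.add_mod_right, Nat.mod_eq_of_lt hb]
      · refine ⟨b - j, ⟨by omega, by omega⟩, ?_⟩
        simp only
        rw [show b - j + j = b by omega, Nat.mod_eq_of_lt hb]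
    · rintro ⟨a, ⟨ha, han⟩, rfl⟩
      refine ⟨fun h' => ?_, _, Finset.mem_range.2 (Nat.mod_lt (a + j) (by omega)), rfl⟩
      have := (h.rotate hj).injOn (by omega) (a := a) (b := 0) han (by omega) (h'.trans hR0.symm)
      omega
  · exact hR0.symm

end Wedge

/-! ### Orderings of the columns as lists -/

section Orderings

variable {C : Type*}

lemma RankConvex.exists_prefix {f : C → ℕ} {R : Set C} (hR : RankConvex f R) {x : C} (hx : x ∈ R)
    {l : List C} (hl : (x :: l).Pairwise fun a b => f a ≤ f b) :
    ∃ t, t <+: l ∧ ∀ c, c ∈ t ↔ c ∈ l ∧ c ∈ R := by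
  induction l with
  | nil => exact ⟨[], List.nil_prefix, by simp⟩
  | cons b l ih =>
    obtain ⟨h1, h2⟩ := List.pairwise_cons.1 hl
    by_cases hb : b ∈ R
    · obtain ⟨t, ht, htc⟩ := ih (List.pairwise_cons.2 ⟨fun y hy => h1 y (by simp [hy]), h2.tail⟩)
      refine ⟨b :: t, List.cons_prefix_cons.2 ⟨rfl, ht⟩, fun c => ?_⟩
      simp only [List.mem_cons, htc]
      constructor
      · rintro (rfl | h)
        · exact ⟨.inl rfl, hb⟩
        · exact ⟨.inr h.1, h.2⟩
      · rintro ⟨h | h, h'⟩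
        · exact .inl h
        · exact .inr ⟨h, h'⟩
    · refine ⟨[], List.nil_prefix, fun c => ⟨by simp, ?_⟩⟩
      rintro ⟨hc, hcR⟩
      rcases List.mem_cons.1 hc with rfl | hc
      · exact (hb hcR).elim
      · exact (hb (hR hx hcR (h1 b (by simp)) ((List.pairwise_cons.1 h2).1 c hc))).elim

/-- In a list that is sorted by a rank, the members of a convex set are consecutive. -/
lemma RankConvex.exists_infix {f : C → ℕ} {R : Set C} (hR : RankConvex f R) {l : List C}
    (hl : l.Pairwise fun a b => f a ≤ f b) : ∃ t, t <:+: l ∧ ∀ c, c ∈ t ↔ c ∈ l ∧ c ∈ R := by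
  induction l with
  | nil => exact ⟨[], List.nil_infix, by simp⟩
  | cons b l ih =>
    by_cases hb : b ∈ R
    · obtain ⟨t, ht, htc⟩ := hR.exists_prefix hb hl
      refine ⟨b :: t, (List.cons_prefix_cons.2 ⟨rfl, ht⟩).isInfix, fun c => ?_⟩
      simp only [List.mem_cons, htc]
      constructor
      · rintro (rfl | h)
        · exact ⟨.inl rfl, hb⟩
        · exact ⟨.inr h.1, h.2⟩
      · rintro ⟨h | h, h'⟩
        · exact .inl h
        · exact .inr ⟨h, h'⟩
    · obtain ⟨t, ht, htc⟩ := ih hl.tail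
      refine ⟨t, List.infix_cons ht, fun c => ?_⟩
      rw [htc, List.mem_cons]
      constructor
      · exact fun h => ⟨.inr h.1, h.2⟩
      · rintro ⟨rfl | h, h'⟩
        · exact (hb h').elim
        · exact ⟨h, h'⟩

lemma exists_sorted_list [Fintype C] (f : C → ℕ) :
    ∃ l : List C, l.Nodup ∧ (∀ c, c ∈ l) ∧ l.Pairwise fun a b => f a ≤ f b := by
  refine ⟨Finset.univ.toList.insertionSort fun a b => f a ≤ f b, ?_, ?_, ?_⟩
  · exact (List.perm_insertionSort _ _).nodup_iff.2 (Finset.nodup_toList _)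
  · intro c
    rw [(List.perm_insertionSort _ _).mem_iff]
    simp
  · have : Std.Total fun a b : C => f a ≤ f b := ⟨fun a b => le_total _ _⟩
    have : IsTrans C fun a b => f a ≤ f b := ⟨fun a b c => le_trans⟩
    exact List.pairwise_insertionSort _ _

variable [DecidableEq C]

lemma mem_segment_iff_idxOf {s t u : List C} (hl : (s ++ t ++ u).Nodup) (c : C) :
    c ∈ t ↔ s.length ≤ (s ++ t ++ u).idxOf c ∧ (s ++ t ++ u).idxOf c < s.length + t.length := by
  have h1 : c ∈ t → c ∉ s := fun h h' =>
    List.disjoint_of_nodup_append (hl.sublist (List.sublist_append_left _ _)) h' h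
  rw [List.append_assoc]
  by_cases hs : c ∈ s
  · rw [List.idxOf_append_of_mem hs]
    have := List.idxOf_lt_length_iff.2 hs
    exact ⟨fun h => (h1 h hs).elim, fun h => by omega⟩
  · rw [List.idxOf_append_of_notMem hs]
    by_cases ht : c ∈ t
    · rw [List.idxOf_append_of_mem ht]
      have := List.idxOf_lt_length_iff.2 ht
      exact ⟨fun _ => ⟨by omega, by omega⟩, fun _ => ht⟩
    · rw [List.idxOf_append_of_notMem ht]
      exact ⟨fun h => (ht h).elim, fun h => by omega⟩

lemma rankConvex_of_infix {l t : List C} (hl : l.Nodup) (ht : t <:+: l) :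
    RankConvex l.idxOf (t.toFinset : Set C) := by
  obtain ⟨s, u, rfl⟩ := ht
  intro x y z hx hz h1 h2
  simp only [List.coe_toFinset, Set.mem_ofPred_eq, mem_segment_iff_idxOf hl] at hx hz h1 h2 ⊢
  omega

lemma pairwise_idxOf {l : List C} (hl : l.Nodup) : l.Pairwise fun a b => l.idxOf a < l.idxOf b := by
  rw [List.pairwise_iff_getElem]
  intro i j hi hj hij
  rwa [hl.idxOf_getElem, hl.idxOf_getElem]

lemma consecutive_iff {l : List C} (hl : l.Nodup) {R : Finset C} (hR : ∀ c ∈ R, c ∈ l) :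
    (∃ t : List C, t <:+: l ∧ t.toFinset = R) ↔ RankConvex l.idxOf (R : Set C) := by
  constructor
  · rintro ⟨t, ht, rfl⟩
    exact rankConvex_of_infix hl ht
  · intro h
    obtain ⟨t, ht, htc⟩ := h.exists_infix ((pairwise_idxOf hl).imp le_of_lt)
    refine ⟨t, ht, Finset.ext fun c => ?_⟩
    rw [List.mem_toFinset, htc]
    exact ⟨fun h => h.2, fun h => ⟨hR c h, h⟩⟩

lemma isConsecutiveOrdering_iff {S : List (Finset C)} {l : List C} :
    IsConsecutiveOrdering S l ↔
      l.Nodup ∧ (∀ c, c ∈ l) ∧ ∀ R ∈ S, RankConvex l.idxOf (R : Set C) :=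
  and_congr_right fun h1 => and_congr_right fun h2 =>
    forall₂_congr fun _ _ => consecutive_iff h1 fun c _ => h2 c

lemma IsConsecutiveOrdering.exists_rank {S : List (Finset C)} {l : List C}
    (h : IsConsecutiveOrdering S l) :
    ∃ f : C → ℕ, (l.Pairwise fun a b => f a < f b) ∧ ∀ R ∈ S, RankConvex f (R : Set C) :=
  ⟨_, pairwise_idxOf h.1, (isConsecutiveOrdering_iff.1 h).2.2⟩

lemma isConsecutiveOrdering_of_rank {S : List (Finset C)} {l : List C} (hnd : l.Nodup)
    (hall : ∀ c, c ∈ l) {f : C → ℕ} (hl : l.Pairwise fun a b => f a ≤ f b)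
    (hf : ∀ R ∈ S, RankConvex f (R : Set C)) : IsConsecutiveOrdering S l := by
  refine ⟨hnd, hall, fun R hR => ?_⟩
  obtain ⟨t, ht, htc⟩ := (hf R hR).exists_infix hl
  exact ⟨t, ht, Finset.ext fun c => by simp [htc, hall]⟩

lemma hasC1P_iff [Fintype C] {S : List (Finset C)} :
    HasC1P S ↔ ∃ f : C → ℕ, ∀ R ∈ S, RankConvex f (R : Set C) := by
  constructor
  · rintro ⟨l, hl⟩
    exact ⟨_, (isConsecutiveOrdering_iff.1 hl).2.2⟩
  · rintro ⟨f, hf⟩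
    obtain ⟨l, h1, h2, h3⟩ := exists_sorted_list f
    exact ⟨l, isConsecutiveOrdering_of_rank h1 h2 h3 hf⟩

lemma HasC1P.mono [Fintype C] {S S' : List (Finset C)} (h : HasC1P S) (hS : S' ⊆ S) :
    HasC1P S' := by
  rw [hasC1P_iff] at h ⊢
  obtain ⟨f, hf⟩ := h
  exact ⟨f, fun R hR => hf R (hS hR)⟩

lemma hasC1P_iff_arcs [Fintype C] {S : List (Finset C)} :
    HasC1P S ↔ Arcs rowSplit none {R | R ∈ S} := by
  rw [hasC1P_iff, arcs_rowSplit_none]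
  rfl

end Orderings

/-! ### The loop of `initialRows` -/

section Loop

variable {m : ℕ}

lemma hasC1P_nil {C : Type*} [DecidableEq C] [Fintype C] : HasC1P ([] : List (Finset C)) :=
  hasC1P_iff.2 ⟨fun _ => 0, by simp⟩

lemma exists_isFirstFailure {C : Type*} [DecidableEq C] [Fintype C] {L : List (Finset C)}
    (hL : ¬ HasC1P L) : ∃ R' Z, IsFirstFailure L R' Z := by
  classical
  have hex : ∃ k, ¬ HasC1P (L.take k) := ⟨L.length, by rwa [List.take_length]⟩
  obtain ⟨k, hk, hmin⟩ : ∃ k, ¬ HasC1P (L.take k) ∧ ∀ j < k, HasC1P (L.take j) :=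
    ⟨Nat.find hex, Nat.find_spec hex, fun j hj => not_not.1 (Nat.find_min hex hj)⟩
  have hne : L.take k ≠ [] := fun h => hk (h ▸ hasC1P_nil)
  refine ⟨(L.take k).dropLast, (L.take k).getLast hne, ?_, ?_, fun P hP hPC => ?_⟩ <;>
    rw [List.dropLast_append_getLast hne]
  · exact List.take_prefix _ _
  · exact hk
  · rw [List.prefix_iff_eq_take] at hP
    have : k ≤ P.length := by
      by_contra hc
      have := hmin P.length (by omega)
      rw [← hP] at this
      exact hPC this
    rw [hP]
    exact List.take_prefix_take_left this

lemma IsFirstFailure.hasC1P {C : Type*} [DecidableEq C] {L R' : List (Finset C)} {Z : Finset C}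
    (h : IsFirstFailure L R' Z) : HasC1P R' := by
  by_contra hc
  have := (h.minimal R' ((List.prefix_append _ _).trans h.initial) hc).length_le
  simp at this

lemma Avoids.five_le_length {M : List (Finset (Fin m))} (hr : Avoids {R | R ∈ M})
    {L : List (Finset (Fin m))} (hLM : L ⊆ M) (hL : ¬ HasC1P L) : 5 ≤ L.length := by
  rw [hasC1P_iff_arcs] at hL
  have e : {R | R ∈ L} = (L.toFinset : Set (Finset (Fin m))) := by simp
  rw [e] at hL
  obtain ⟨J, hJL, hJ, hmin⟩ := exists_minimal_not_arcs L.toFinset hL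
  obtain ⟨n, R, p, e, h5, hJR, h, -⟩ :=
    hr.exists_cyclePattern (fun R hR => hLM (List.mem_toFinset.1 (hJL hR))) hJ hmin
  have : J.card = n := by
    rw [hJR, Finset.card_image_of_injOn, Finset.card_range]
    intro a ha b hb hab
    exact h.injOn (by omega) (by simpa using ha) (by simpa using hb) hab
  have := (Finset.card_le_card hJL).trans L.toFinset_card_le
  omega

/-- After `i - 1` iterations the current sequence starts with the `i - 1` rows found so far. They
are distinct and are contained in every family of current rows without the consecutive-ones
property. -/
lemma Avoids.exists_loopState {M : List (Finset (Fin m))} (hr : Avoids {R | R ∈ M})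
    (hM : ¬ HasC1P M) (i : ℕ) (hi : i ≤ 5) :
    ∃ Zs L : List (Finset (Fin m)), LoopState 4 M (i + 1) L ∧ ¬ HasC1P L ∧ L ⊆ M ∧
      Zs <+: L ∧ Zs.length = i ∧ Zs.Nodup ∧
      (∀ J : List (Finset (Fin m)), J ⊆ L → ¬ HasC1P J → Zs ⊆ J) ∧
      ∀ Z ∈ Zs, ∃ t R', IsIteration 4 M t R' Z ∧ HasC1P R' ∧ L ⊆ Z :: R' := by
  induction i with
  | zero =>
    exact ⟨[], M, .start, hM, List.Subset.refl _, List.nil_prefix, rfl, List.nodup_nil,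
      fun J _ _ => List.nil_subset _, by simp⟩
  | succ i ih =>
    obtain ⟨Zs, L, hst, hL, hLM, hpre, hlen, hnd, hall, hit⟩ := ih (by omega)
    obtain ⟨R', Z, hf⟩ := exists_isFirstFailure hL
    have hRC := hf.hasC1P
    have hleL : i + 1 - 1 ≤ L.length := by have := hpre.length_le; omega
    have hsub : R' ++ [Z] ⊆ L := hf.initial.subset
    have hperm : Z :: R' ⊆ R' ++ [Z] := by simp
    have hL' : Z :: R' ⊆ L := List.Subset.trans hperm hsub
    have hZR : Z ∉ R' := fun h => hf.fails (hRC.mono (by simp [h]))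
    have hZs : Zs <+: R' := by
      refine List.prefix_of_prefix_length_le hpre
        ((List.prefix_append R' [Z]).trans hf.initial) ?_
      have := hr.five_le_length (List.Subset.trans hsub hLM) hf.fails
      simp at this
      omega
    refine ⟨Z :: Zs, Z :: R', .step hst (by omega) hleL hf, fun h => hf.fails (h.mono (by simp)),
      List.Subset.trans hL' hLM, List.cons_prefix_cons.2 ⟨rfl, hZs⟩, by simp [hlen],
      List.nodup_cons.2 ⟨fun h => hZR (hZs.subset h), hnd⟩, fun J hJ hJC => ?_, ?_⟩
    · refine List.cons_subset.2 ⟨?_, hall J (List.Subset.trans hJ hL') hJC⟩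
      by_contra hc
      refine hJC (hRC.mono fun R hR => (List.mem_cons.1 (hJ hR)).resolve_left ?_)
      rintro rfl
      exact hc hR
    · intro Z' hZ'
      rcases List.mem_cons.1 hZ' with rfl | hZ'
      · exact ⟨i + 1, R', ⟨L, hst, by omega, hleL, hf⟩, hRC, List.Subset.refl _⟩
      · obtain ⟨t, R'', h1, h2, h3⟩ := hit Z' hZ'
        exact ⟨t, R'', h1, h2, List.Subset.trans hL' h3⟩

/-- One of the five iterations finds a row `Z` that is forced apart by the rows before it. -/
theorem Avoids.exists_isIteration {M : List (Finset (Fin m))} (hr : Avoids {R | R ∈ M})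
    (hM : ¬ HasC1P M) :
    ∃ t R' Z, IsIteration 4 M t R' Z ∧ HasC1P R' ∧
      ∃ S A B x y z, (∀ R ∈ S, R ∈ R') ∧ Wedge S Z A B x y z := by
  obtain ⟨Zs, L, -, hL, hLM, -, hlen, hnd, hall, hit⟩ := hr.exists_loopState hM 5 le_rfl
  have e : {R | R ∈ L} = (L.toFinset : Set (Finset (Fin m))) := by simp
  have hL' := hL
  rw [hasC1P_iff_arcs, e] at hL'
  obtain ⟨J, hJL, hJ, hmin⟩ := exists_minimal_not_arcs L.toFinset hL'
  have hZJ : Zs.toFinset ⊆ J := by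
    have := hall J.toList (fun R hR => List.mem_toFinset.1 (hJL (Finset.mem_toList.1 hR)))
      (by rw [hasC1P_iff_arcs]; simpa using hJ)
    intro R hR
    exact Finset.mem_toList.1 (this (List.mem_toFinset.1 hR))
  obtain ⟨Z, hZ, A, B, x, y, z, hw⟩ :=
    hr.exists_wedge (fun R hR => hLM (List.mem_toFinset.1 (hJL hR))) hJ hmin hZJ
      (by rw [List.toFinset_card_of_nodup hnd, hlen])
  obtain ⟨t, R', h1, h2, h3⟩ := hit Z (List.mem_toFinset.1 hZ)
  refine ⟨t, R', Z, h1, h2, _, A, B, x, y, z, fun R hR => ?_, hw⟩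
  have hR' := Finset.mem_erase.1 (Finset.mem_coe.1 hR)
  exact (List.mem_cons.1 (h3 (List.mem_toFinset.1 (hJL hR'.2)))).resolve_left hR'.1

end Loop

/-! ### Leaf orders and nodes of ordered trees -/

section LeafOrders

variable {C : Type*}

lemma flatten_ofFn_update {n : ℕ} (w : Fin n → List C) (i : Fin n) :
    ∃ a b : List C, ∀ u, (List.ofFn (Function.update w i u)).flatten = a ++ u ++ b := by
  induction n with
  | zero => exact i.elim0
  | succ n ih =>
    refine Fin.cases ⟨[], (List.ofFn fun j => w j.succ).flatten, fun u => ?_⟩ (fun i => ?_) i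
    · simp [List.ofFn_succ]
    · obtain ⟨a, b, h⟩ := ih (fun j => w j.succ) i
      refine ⟨w 0 ++ a, b, fun u => ?_⟩
      have e : (fun j : Fin n => Function.update w i.succ u j.succ) =
          Function.update (fun j => w j.succ) i u := by
        ext1 j
        by_cases hj : j = i
        · simp [hj]
        · simp [hj]
      rw [List.ofFn_succ, List.flatten_cons, e, h, Function.update_of_ne (Fin.succ_ne_zero i).symm]
      simp [List.append_assoc]

lemma reverse_flatten_ofFn {n : ℕ} (w : Fin n → List C) :
    (List.ofFn w).flatten.reverse = (List.ofFn fun i => (w i.rev).reverse).flatten := by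
  have e : (List.ofFn w).reverse = List.ofFn fun i => w i.rev := by
    refine List.ext_getElem (by simp) fun i h1 h2 => ?_
    simp only [List.getElem_reverse, List.getElem_ofFn, List.length_ofFn]
    congr 1
    ext
    simp only [Fin.val_rev]
    omega
  rw [List.reverse_flatten, ← List.map_reverse, e, List.map_ofFn]
  rfl

lemma infix_flatten_ofFn {n : ℕ} (w : Fin n → List C) (i : Fin n) :
    w i <:+: (List.ofFn w).flatten := by
  obtain ⟨a, b, h⟩ := flatten_ofFn_update w i
  have := h (w i)
  rw [Function.update_eq_self] at this
  exact ⟨a, b, this.symm⟩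

namespace PQTree

lemma exists_isLeafOrder (T : PQTree C) : ∃ l, T.IsLeafOrder l := by
  induction T with
  | leaf c => exact ⟨[c], rfl⟩
  | pnode child ih =>
    choose w hw using ih
    exact ⟨_, Equiv.refl _, w, hw, rfl⟩
  | qnode child ih =>
    choose w hw using ih
    exact ⟨_, w, hw, .inl rfl⟩

lemma IsLeafOrder.reverse {T : PQTree C} {l : List C} (h : T.IsLeafOrder l) :
    T.IsLeafOrder l.reverse := by
  induction T generalizing l with
  | leaf c =>
    obtain rfl : l = [c] := h
    exact rfl
  | pnode child ih =>
    obtain ⟨σ, w, hw, rfl⟩ := h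
    refine ⟨Fin.revPerm.trans σ, fun i => (w i).reverse, fun i => ih i (hw i), ?_⟩
    rw [reverse_flatten_ofFn]
    rfl
  | qnode child ih =>
    obtain ⟨w, hw, rfl | rfl⟩ := h
    · refine ⟨fun i => (w i).reverse, fun i => ih i (hw i), .inr ?_⟩
      rw [reverse_flatten_ofFn]
    · refine ⟨fun i => (w i).reverse, fun i => ih i (hw i), .inl ?_⟩
      rw [reverse_flatten_ofFn]
      simp

lemma IsLeafOrder.mem_iff [DecidableEq C] {T : PQTree C} {l : List C} (h : T.IsLeafOrder l)
    (c : C) :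
    c ∈ l ↔ c ∈ T.leafSet := by
  induction T generalizing l with
  | leaf d =>
    obtain rfl : l = [d] := h
    simp [leafSet]
  | pnode child ih =>
    obtain ⟨σ, w, hw, rfl⟩ := h
    simp only [List.mem_flatten, List.mem_ofFn, leafSet, Finset.mem_biUnion, Finset.mem_univ,
      true_and, exists_exists_eq_and]
    simp only [ih _ (hw _)]
    exact ⟨fun ⟨i, hi⟩ => ⟨_, hi⟩, fun ⟨i, hi⟩ => ⟨σ.symm i, by simpa using hi⟩⟩
  | qnode child ih =>
    obtain ⟨w, hw, rfl | rfl⟩ := h <;>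
    simp only [List.mem_flatten, List.mem_ofFn, leafSet, Finset.mem_biUnion, Finset.mem_univ,
      true_and, exists_exists_eq_and] <;>
    simp only [ih _ (hw _)]
    exact ⟨fun ⟨i, hi⟩ => ⟨_, hi⟩, fun ⟨i, hi⟩ => ⟨i.rev, by simpa using hi⟩⟩

/-- The leaf orders of a node can be substituted for one another. -/
lemma IsNode.exists_isLeafOrder {s T : PQTree C} (h : IsNode s T) :
    ∃ a b : List C, ∀ t, s.IsLeafOrder t → T.IsLeafOrder (a ++ t ++ b) := by
  induction h with
  | root => exact ⟨[], [], fun t ht => by simpa using ht⟩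
  | @below_pnode n child i _ ih =>
    obtain ⟨a, b, h⟩ := ih
    choose w hw using fun j => (child j).exists_isLeafOrder
    obtain ⟨a', b', h'⟩ := flatten_ofFn_update w i
    refine ⟨a' ++ a, b ++ b', fun t ht => ⟨Equiv.refl _, Function.update w i (a ++ t ++ b),
      fun j => ?_, ?_⟩⟩
    · by_cases hj : j = i
      · subst hj; simpa using h t ht
      · simpa [hj] using hw j
    · have := h' (a ++ t ++ b)
      simp only [Equiv.refl_apply]
      rw [this]
      simp [List.append_assoc]
  | @below_qnode n child i _ ih =>
    obtain ⟨a, b, h⟩ := ih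
    choose w hw using fun j => (child j).exists_isLeafOrder
    obtain ⟨a', b', h'⟩ := flatten_ofFn_update w i
    refine ⟨a' ++ a, b ++ b', fun t ht => ⟨Function.update w i (a ++ t ++ b), fun j => ?_, .inl ?_⟩⟩
    · by_cases hj : j = i
      · subst hj; simpa using h t ht
      · simpa [hj] using hw j
    · rw [h']
      simp [List.append_assoc]

lemma IsNode.exists_infix {s T : PQTree C} (h : IsNode s T) {l : List C} (hl : T.IsLeafOrder l) :
    ∃ t, t <:+: l ∧ s.IsLeafOrder t := by
  induction h generalizing l with
  | root => exact ⟨l, List.infix_refl l, hl⟩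
  | @below_pnode n child i _ ih =>
    obtain ⟨σ, w, hw, rfl⟩ := hl
    obtain ⟨t, ht, hst⟩ := ih (hw i)
    refine ⟨t, ht.trans ?_, hst⟩
    simpa using infix_flatten_ofFn (fun j => w (σ j)) (σ.symm i)
  | @below_qnode n child i _ ih =>
    obtain ⟨w, hw, rfl | rfl⟩ := hl
    · obtain ⟨t, ht, hst⟩ := ih (hw i)
      exact ⟨t, ht.trans (infix_flatten_ofFn w i), hst⟩
    · obtain ⟨t, ht, hst⟩ := ih (hw i)
      refine ⟨t, ht.trans ?_, hst⟩
      simpa using infix_flatten_ofFn (fun j => w j.rev) i.rev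

lemma IsNode.trans {s t T : PQTree C} (h : IsNode s t) (h' : IsNode t T) : IsNode s T := by
  induction h' with
  | root => exact h
  | below_pnode i _ ih => exact .below_pnode i ih
  | below_qnode i _ ih => exact .below_qnode i ih

/-- A set of leaves lies in a lowest node. -/
lemma exists_lowest_node [DecidableEq C] {T : PQTree C} {U : Set C} (hU : U ⊆ T.leafSet) :
    (∃ c, U ⊆ {c}) ∨
    (∃ (n : ℕ) (X : Fin n → PQTree C), IsNode (pnode X) T ∧ U ⊆ (pnode X).leafSet ∧
      ∀ i, ¬ U ⊆ (X i).leafSet) ∨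
    ∃ (n : ℕ) (X : Fin n → PQTree C), IsNode (qnode X) T ∧ U ⊆ (qnode X).leafSet ∧
      ∀ i, ¬ U ⊆ (X i).leafSet := by
  induction T with
  | leaf c => exact .inl ⟨c, by simpa [leafSet] using hU⟩
  | @pnode n X ih =>
    by_cases h : ∃ i, U ⊆ (X i).leafSet
    · obtain ⟨i, hi⟩ := h
      rcases ih i hi with h | ⟨n, Y, h, h'⟩ | ⟨n, Y, h, h'⟩
      · exact .inl h
      · exact .inr (.inl ⟨n, Y, .below_pnode i h, h'⟩)
      · exact .inr (.inr ⟨n, Y, .below_pnode i h, h'⟩)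
    · exact .inr (.inl ⟨n, X, .root, hU, fun i hi => h ⟨i, hi⟩⟩)
  | @qnode n X ih =>
    by_cases h : ∃ i, U ⊆ (X i).leafSet
    · obtain ⟨i, hi⟩ := h
      rcases ih i hi with h | ⟨n, Y, h, h'⟩ | ⟨n, Y, h, h'⟩
      · exact .inl h
      · exact .inr (.inl ⟨n, Y, .below_qnode i h, h'⟩)
      · exact .inr (.inr ⟨n, Y, .below_qnode i h, h'⟩)
    · exact .inr (.inr ⟨n, X, .root, hU, fun i hi => h ⟨i, hi⟩⟩)

end PQTree

lemma pairwise_of_flatten_ofFn {n : ℕ} {w : Fin n → List C} {P : C → C → Prop}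
    (h : (List.ofFn w).flatten.Pairwise P) {p q : Fin n} (hpq : p < q) {u v : C} (hu : u ∈ w p)
    (hv : v ∈ w q) : P u v :=
  List.pairwise_ofFn.1 (List.pairwise_flatten.1 h).2 hpq u hu v hv

lemma pairwise_or {P : C → C → Prop} {l : List C} (h : l.Pairwise P) {u v : C} (hu : u ∈ l)
    (hv : v ∈ l) (huv : u ≠ v) : P u v ∨ P v u := by
  have : Std.Symm fun u v => P u v ∨ P v u := ⟨fun _ _ => Or.symm⟩
  exact (h.imp (S := fun u v => P u v ∨ P v u) .inl).forall hu hv huv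

/-- In a leaf order, the children of a Q node appear in their order or in the reverse order. -/
lemma PQTree.IsNode.qnode_order [DecidableEq C] {n : ℕ} {X : Fin n → PQTree C} {T : PQTree C}
    (h : IsNode (qnode X) T) {l : List C} (hl : T.IsLeafOrder l) {P : C → C → Prop}
    (hP : l.Pairwise P) :
    (∀ p q u v, p < q → u ∈ (X p).leafSet → v ∈ (X q).leafSet → P u v) ∨
    ∀ p q u v, p < q → u ∈ (X p).leafSet → v ∈ (X q).leafSet → P v u := by
  obtain ⟨t, ht, w, hw, rfl | rfl⟩ := h.exists_infix hl
  · have := hP.sublist ht.sublist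
    exact .inl fun p q u v hpq hu hv => pairwise_of_flatten_ofFn this hpq
      (((hw p).mem_iff u).2 hu) (((hw q).mem_iff v).2 hv)
  · have := hP.sublist ht.sublist
    exact .inr fun p q u v hpq hu hv => pairwise_of_flatten_ofFn this (Fin.rev_lt_rev.2 hpq)
      (by simpa using ((hw q).mem_iff v).2 hv) (by simpa using ((hw p).mem_iff u).2 hu)

end LeafOrders

/-! ### The Q node of an overlap component -/

section Reversal

variable {α : Type*} {f : α → ℕ}

/-- The rank obtained from `f` by reversing the segment of the values from `lo` to `hi`, which are
the values on `U`. -/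
noncomputable def reverseOn (f : α → ℕ) (U : Set α) (lo hi : ℕ) (c : α) : ℕ :=
  open Classical in if c ∈ U then lo + hi - f c else f c

variable {U : Set α} {lo hi : ℕ}

lemma reverseOn_mem (hU : ∀ c, c ∈ U ↔ lo ≤ f c ∧ f c ≤ hi) {c : α} (hc : c ∈ U) :
    lo ≤ f c ∧ f c ≤ hi ∧ lo ≤ reverseOn f U lo hi c ∧ reverseOn f U lo hi c ≤ hi ∧
      reverseOn f U lo hi c + f c = lo + hi := by
  have := (hU c).1 hc
  simp only [reverseOn, hc, if_true]
  omega

lemma reverseOn_notMem (hU : ∀ c, c ∈ U ↔ lo ≤ f c ∧ f c ≤ hi) {c : α} (hc : c ∉ U) :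
    (f c < lo ∨ hi < f c) ∧ reverseOn f U lo hi c = f c := by
  rw [hU] at hc
  refine ⟨by omega, ?_⟩
  rw [← hU] at hc
  simp [reverseOn, hc]

/-- Reversing the segment `U` keeps the sets convex that do not overlap `U`. -/
lemma RankConvex.reverseOn (hU : ∀ c, c ∈ U ↔ lo ≤ f c ∧ f c ≤ hi) {R : Set α}
    (hR : RankConvex f R) (h : R ⊆ U ∨ U ⊆ R ∨ Disjoint R U) :
    RankConvex (reverseOn f U lo hi) R := by
  intro x y z hx hz h1 h2
  rcases h with h | h | h
  · have mx := reverseOn_mem hU (h hx)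
    have mz := reverseOn_mem hU (h hz)
    by_cases hy : y ∈ U
    · have my := reverseOn_mem hU hy
      exact hR hz hx (by omega) (by omega)
    · have my := reverseOn_notMem hU hy
      omega
  · by_cases hy : y ∈ U
    · exact h hy
    have my := reverseOn_notMem hU hy
    refine hR hx hz ?_ ?_
    · by_cases hxU : x ∈ U
      · have := reverseOn_mem hU hxU; omega
      · have := reverseOn_notMem hU hxU; omega
    · by_cases hzU : z ∈ U
      · have := reverseOn_mem hU hzU; omega
      · have := reverseOn_notMem hU hzU; omega
  · have mx := reverseOn_notMem hU (Set.disjoint_left.1 h hx)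
    have mz := reverseOn_notMem hU (Set.disjoint_left.1 h hz)
    refine hR hx hz ?_ ?_
    · by_cases hy : y ∈ U
      · have := reverseOn_mem hU hy; omega
      · have := reverseOn_notMem hU hy; omega
    · by_cases hy : y ∈ U
      · have := reverseOn_mem hU hy; omega
      · have := reverseOn_notMem hU hy; omega

/-- The union of a linked family of convex sets is a segment. -/
lemma Linked.exists_segment [Finite α] {ι : Type*} {s : ι → Set α} {J : Set ι} (hJ : Linked s J)
    (hf : ∀ i ∈ J, RankConvex f (s i)) (hne : ∃ i ∈ J, (s i).Nonempty) :
    ∃ lo hi, ∀ c, (∃ i ∈ J, c ∈ s i) ↔ lo ≤ f c ∧ f c ≤ hi := by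
  let U : Set α := {c | ∃ i ∈ J, c ∈ s i}
  have hne : U.Nonempty := let ⟨i, hi, c, hc⟩ := hne; ⟨c, i, hi, hc⟩
  obtain ⟨u, hu, hmin⟩ := Set.exists_min_image U f (Set.toFinite U) hne
  obtain ⟨v, hv, hmax⟩ := Set.exists_max_image U f (Set.toFinite U) hne
  refine ⟨f u, f v, fun c => ⟨fun hc => ⟨hmin c hc, hmax c hc⟩, fun ⟨h1, h2⟩ => ?_⟩⟩
  by_contra hc
  push Not at hc
  obtain ⟨i, hi, hui⟩ := hu
  obtain ⟨j, hj, hvj⟩ := hv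
  have := hJ.lt_iff_of_notMem hf hc hi hj hui hvj
  have := (hf i hi).ne hui (hc i hi)
  omega

end Reversal

section QNode

variable {C : Type*} [DecidableEq C] {S : List (Finset C)}

namespace PQTree

variable {T : PQTree C}

/-- No row overlaps a node, as the leaves of the node can be reversed on their own. -/
lemma IsPQTreeOf.not_setOverlap_node (hT : T.IsPQTreeOf S) {s : PQTree C} (hs : IsNode s T)
    {R : Finset C} (hR : R ∈ S) : ¬ SetOverlap (R : Set C) (s.leafSet : Set C) := by
  rintro ⟨⟨x, hxR, hxV⟩, ⟨c, hcR, hcV⟩, ⟨v, hvV, hvR⟩⟩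
  obtain ⟨a, b, h⟩ := hs.exists_isLeafOrder
  obtain ⟨t, ht⟩ := s.exists_isLeafOrder
  have h1 := (hT.2 _).1 (h t ht)
  have h2 := (hT.2 _).1 (h _ ht.reverse)
  have hxt := (ht.mem_iff x).2 hxV
  have hvt := (ht.mem_iff v).2 hvV
  have hct : c ∉ t := fun h => hcV ((ht.mem_iff c).1 h)
  obtain ⟨f₁, p1, c1⟩ := h1.exists_rank
  obtain ⟨f₂, p2, c2⟩ := h2.exists_rank
  replace c1 := c1 R hR
  replace c2 := c2 R hR
  simp only [List.pairwise_append, List.pairwise_reverse, List.mem_append,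
    List.mem_reverse] at p1 p2
  have hxv : x ≠ v := fun h => hvR (h ▸ hxR)
  have key := pairwise_or (List.Pairwise.and p1.1.2.1 p2.1.2.1) hxt hvt hxv
  have hc := h1.2.1 c
  simp only [List.mem_append, hct, or_false] at hc
  rcases hc with hc | hc
  · have e1 := p1.1.2.2 c hc v hvt
    have e2 := p2.1.2.2 c hc v hvt
    rcases key with k | k
    · exact hvR (c2 hcR hxR e2.le k.2.le)
    · exact hvR (c1 hcR hxR e1.le k.1.le)
  · have e1 := p1.2.2 v (.inr hvt) c hc
    have e2 := p2.2.2 v (.inr hvt) c hc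
    rcases key with k | k
    · exact hvR (c1 hxR hcR k.1.le e1.le)
    · exact hvR (c2 hxR hcR k.2.le e2.le)

lemma IsPQTreeOf.mem_leafSet (hT : T.IsPQTreeOf S) (c : C) : c ∈ T.leafSet := by
  obtain ⟨l, hl⟩ := T.exists_isLeafOrder
  exact (hl.mem_iff c).1 (((hT.2 l).1 hl).2.1 c)

/-- A child of a node is contained in or disjoint from the members of a linked family of rows that
is not contained in the child. -/
lemma IsPQTreeOf.child_subset_or_disjoint (hT : T.IsPQTreeOf S) {K : Set (Finset C)}
    (hKS : ∀ R ∈ K, R ∈ S) (hK : Linked (fun R : Finset C => (R : Set C)) K) {s : PQTree C}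
    (hs : IsNode s T) (hne : ¬ {c | ∃ R ∈ K, c ∈ R} ⊆ (s.leafSet : Set C)) :
    ∀ R ∈ K, s.leafSet ⊆ R ∨ Disjoint R s.leafSet := by
  rcases hK.union_subset_or (R := (s.leafSet : Set C))
    (fun R hR => hT.not_setOverlap_node hs (hKS R hR)) with h | h
  · exact (hne fun c ⟨R, hR, hc⟩ => h R hR hc).elim
  · intro R hR
    rcases h R hR with h | h
    · exact .inl (by exact_mod_cast h)
    · exact .inr (by exact_mod_cast h.symm)

/-- If the rows force some column between two others, then their lowest common node is not a P
node. -/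
lemma IsPQTreeOf.not_between_pnode (hT : T.IsPQTreeOf S) {n : ℕ} {X : Fin n → PQTree C}
    (hX : IsNode (pnode X) T) {h i j : Fin n} (hhi : h ≠ i) (hij : i ≠ j) (hhj : h ≠ j) {x y z : C}
    (hx : x ∈ (X h).leafSet) (hy : y ∈ (X i).leafSet) (hz : z ∈ (X j).leafSet)
    (hb : ∀ f : C → ℕ, (∀ R ∈ S, RankConvex f (R : Set C)) →
      f x < f y ∧ f y < f z ∨ f z < f y ∧ f y < f x) : False := by
  choose w hw using fun k => (X k).exists_isLeafOrder
  have mem : ∀ k c, c ∈ (X k).leafSet → c ∈ w k := fun k c => ((hw k).mem_iff c).2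
  have key : ∀ σ : Equiv.Perm (Fin n), (σ h < σ i ∧ σ i < σ j) ∨ (σ j < σ i ∧ σ i < σ h) := by
    intro σ
    obtain ⟨a, b, hab⟩ := hX.exists_isLeafOrder
    obtain ⟨f, hp, hf⟩ := ((hT.2 _).1 (hab _ ⟨σ.symm, w, hw, rfl⟩)).exists_rank
    replace hf := hb f hf
    replace hp := (List.pairwise_append.1 (List.pairwise_append.1 hp).1).2.1
    have lt : ∀ k k' u v, σ k < σ k' → u ∈ (X k).leafSet → v ∈ (X k').leafSet → f u < f v :=
      fun k k' u v hk hu hv => pairwise_of_flatten_ofFn hp hk (by simpa using mem k u hu)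
        (by simpa using mem k' v hv)
    have n1 : σ h ≠ σ i := σ.injective.ne hhi
    have n2 : σ i ≠ σ j := σ.injective.ne hij
    have l1 := lt h i x y
    have l2 := lt i h y x
    have l3 := lt i j y z
    have l4 := lt j i z y
    simp only [hx, hy, hz, forall_const] at l1 l2 l3 l4
    rcases lt_or_gt_of_ne n1 with h1 | h1 <;> rcases lt_or_gt_of_ne n2 with h2 | h2
    · exact .inl ⟨h1, h2⟩
    · have := l1 h1; have := l4 h2; omega
    · have := l2 h1; have := l3 h2; omega
    · exact .inr ⟨h2, h1⟩
  have k1 := key (Equiv.refl _)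
  have k2 := key (Equiv.swap i j)
  rw [Equiv.swap_apply_left, Equiv.swap_apply_right, Equiv.swap_apply_of_ne_of_ne hhi hhj] at k2
  simp only [Equiv.refl_apply] at k1
  omega

/-- The lowest node of an overlap component is the union of the component if it is a Q node:
otherwise the union could be reversed while some leaf of the node stays in its place. -/
lemma IsPQTreeOf.qnode_subset_union [Fintype C] (hT : T.IsPQTreeOf S) {K : Set (Finset C)}
    (hKS : ∀ R ∈ K, R ∈ S) (hK : Linked (fun R : Finset C => (R : Set C)) K)
    (hKo : ∀ R ∈ S, R ∉ K → ∀ R' ∈ K, ¬ SetOverlap (R' : Set C) (R : Set C))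
    {n : ℕ} {X : Fin n → PQTree C} (hX : IsNode (qnode X) T) {h j k : Fin n} (hhj : h ≠ j)
    (hhk : h ≠ k) {x z c : C} (hx : x ∈ (X h).leafSet) (hz : z ∈ (X j).leafSet)
    (hc : c ∈ (X k).leafSet) (hxK : ∃ R ∈ K, x ∈ R) (hzK : ∃ R ∈ K, z ∈ R) : ∃ R ∈ K, c ∈ R := by
  by_contra hcK
  obtain ⟨l, hl⟩ := T.exists_isLeafOrder
  obtain ⟨f, hp, hf⟩ := ((hT.2 _).1 hl).exists_rank
  obtain ⟨lo, hi, hU⟩ := hK.exists_segment (f := f) (fun R hR => hf R (hKS R hR))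
    (let ⟨R, hR, hx⟩ := hxK; ⟨R, hR, x, hx⟩)
  set U : Set C := {c | ∃ R ∈ K, c ∈ (R : Set C)} with hUdef
  have hU : ∀ c, c ∈ U ↔ lo ≤ f c ∧ f c ≤ hi := hU
  have hrev : ∀ R ∈ S, RankConvex (reverseOn f U lo hi) (R : Set C) := by
    intro R hR
    refine (hf R hR).reverseOn hU ?_
    by_cases hRK : R ∈ K
    · exact .inl fun c hc => ⟨R, hRK, hc⟩
    rcases hK.union_subset_or (R := (R : Set C)) (fun R' hR' => hKo R hR hRK R' hR') with h | h
    · exact .inr (.inl fun c ⟨R', hR', hc⟩ => h R' hR' hc)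
    · by_cases hsub : ∃ R' ∈ K, (R : Set C) ⊆ (R' : Set C)
      · obtain ⟨R', hR', hsub⟩ := hsub
        exact .inl fun c hc => ⟨R', hR', hsub hc⟩
      · refine .inr (.inr (Set.disjoint_left.2 ?_))
        rintro c hcR ⟨R', hR', hc⟩
        exact Set.disjoint_left.1 ((h R' hR').resolve_left fun h => hsub ⟨R', hR', h⟩) hcR hc
  obtain ⟨l', hnd, hall, hpw⟩ := exists_sorted_list (reverseOn f U lo hi)
  have hl' : T.IsLeafOrder l' := (hT.2 _).2 (isConsecutiveOrdering_of_rank hnd hall hpw hrev)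
  have mx := reverseOn_mem hU (c := x) hxK
  have mz := reverseOn_mem hU (c := z) hzK
  have mc := reverseOn_notMem hU (c := c) hcK
  rcases hX.qnode_order hl hp with o | o <;> rcases hX.qnode_order hl' hpw with o' | o' <;>
  rcases lt_or_gt_of_ne hhj with p1 | p1 <;> rcases lt_or_gt_of_ne hhk with p2 | p2 <;>
  · have e1 := o _ _ _ _ p1 (by assumption) (by assumption)
    have e2 := o _ _ _ _ p2 (by assumption) (by assumption)
    have e3 := o' _ _ _ _ p1 (by assumption) (by assumption)
    have e4 := o' _ _ _ _ p2 (by assumption) (by assumption)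
    clear o o' p1 p2
    omega

end PQTree

end QNode

/-! ### The 1-0-1 configuration -/

section Configuration

variable {C : Type*} {S : List (Finset C)}

/-- The rows in the connected component of `A` in the overlap graph. -/
def component (S : List (Finset C)) (A : Finset C) : Set (Finset C) :=
  {R ∈ {R | R ∈ S} | Relation.ReflTransGen
    (fun R R' : Finset C => R' ∈ {R | R ∈ S} ∧ SetOverlap (R : Set C) (R' : Set C)) A R}

lemma Linked.subset_component {K : Set (Finset C)} (hK : Linked (fun R : Finset C => (R : Set C)) K)
    (hKS : ∀ R ∈ K, R ∈ S) {A : Finset C} (hA : A ∈ K) : K ⊆ component S A :=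
  fun R hR => ⟨hKS R hR, (hK A hA R hR).lift id fun _ _ h => ⟨hKS _ h.1, h.2⟩⟩

variable [DecidableEq C]

lemma overlap_iff {A B : Finset C} : Overlap A B ↔ SetOverlap (A : Set C) (B : Set C) := by
  simp only [Overlap, SetOverlap, ← Finset.coe_inter, ← Finset.coe_sdiff, Finset.coe_nonempty,
    Finset.sdiff_nonempty]

lemma mem_supp_iff {A : Finset C} (hA : A ∈ S) (R : {R : Finset C // R ∈ S}) :
    R ∈ ((overlapGraph S).connectedComponentMk ⟨A, hA⟩).supp ↔ R.1 ∈ component S A := by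
  rw [SimpleGraph.ConnectedComponent.mem_supp_iff, SimpleGraph.ConnectedComponent.eq,
    SimpleGraph.reachable_comm, SimpleGraph.reachable_iff_reflTransGen]
  constructor
  · intro h
    refine ⟨R.2, ?_⟩
    have := h.lift (p := fun R R' : Finset C => R' ∈ {R | R ∈ S} ∧
      SetOverlap (R : Set C) (R' : Set C)) Subtype.val fun R R' h => ⟨R'.2, overlap_iff.1 h⟩
    exact this
  · rintro ⟨hR, h⟩
    have key : ∀ D, Relation.ReflTransGen (fun R R' : Finset C => R' ∈ {R | R ∈ S} ∧
        SetOverlap (R : Set C) (R' : Set C)) A D → ∃ hD : D ∈ S,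
        Relation.ReflTransGen (overlapGraph S).Adj ⟨A, hA⟩ ⟨D, hD⟩ := by
      intro D hD
      induction hD with
      | refl => exact ⟨hA, .refl⟩
      | tail _ h ih =>
        obtain ⟨_, ih⟩ := ih
        exact ⟨h.1, ih.tail (overlap_iff.2 h.2)⟩
    exact (key R.1 h).2

namespace PQTree

/-- The lowest node that contains the overlap component of the rows of a wedge is a Q node with the
1-0-1 configuration at the children that contain the columns of the wedge. -/
theorem IsPQTreeOf.exists_qnode [Fintype C] {T : PQTree C} (hT : T.IsPQTreeOf S)
    {S' : Set (Finset C)} (hS' : ∀ R ∈ S', R ∈ S) {Z A B : Finset C} {x y z : C}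
    (hw : Wedge S' Z A B x y z) :
    ∃ (s : ℕ) (X : Fin s → PQTree C), IsNode (.qnode X) T ∧
      ∃ h i j : Fin s, Is101 X Z h i j ∧ ∃ K : (overlapGraph S).ConnectedComponent,
        (∀ c : C, c ∈ (qnode X).leafSet ↔ ∃ R ∈ K.supp, c ∈ R.1) ∧
        ∃ A ∈ K.supp, ∃ B ∈ K.supp,
          ((X h).leafSet ⊆ A.1 ∧ Disjoint A.1 (X i).leafSet ∧ Disjoint A.1 (X j).leafSet) ∧
          ((X j).leafSet ⊆ B.1 ∧ Disjoint B.1 (X h).leafSet ∧ Disjoint B.1 (X i).leafSet) := by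
  have hAS := hS' A hw.left_mem
  have hSK := hw.linked.subset_component hS' hw.left_mem
  have hK : Linked (fun R : Finset C => (R : Set C)) (component S A) := linked_component _ _ hAS
  have hKS : ∀ R ∈ component S A, R ∈ S := fun R hR => hR.1
  have hAK := hSK hw.left_mem
  have hBK := hSK hw.right_mem
  have hyK : ∃ R ∈ component S A, y ∈ R := let ⟨R, hR, hy⟩ := hw.y_covered; ⟨R, hSK hR, hy⟩
  have hKo : ∀ R ∈ S, R ∉ component S A → ∀ R' ∈ component S A,
      ¬ SetOverlap (R' : Set C) (R : Set C) := fun R hR hRK R' hR' ho =>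
    hRK ⟨hR, hR'.2.tail ⟨hR, ho⟩⟩
  have hxy : x ≠ y := fun h => hw.y_notMem.2.1 (h ▸ hw.x_mem.2.1)
  have hb : ∀ f : C → ℕ, (∀ R ∈ S, RankConvex f (R : Set C)) →
      f x < f y ∧ f y < f z ∨ f z < f y ∧ f y < f x :=
    fun f hf => hw.between f fun R hR => hf R (hS' R hR)
  obtain ⟨hxZ, hxA, hxB⟩ := hw.x_mem
  obtain ⟨hyZ, hyA, hyB⟩ := hw.y_notMem
  obtain ⟨hzZ, hzA, hzB⟩ := hw.z_mem
  -- the children of the lowest node are separated by the rows `A` and `B`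
  have child : ∀ {n : ℕ} {X : Fin n → PQTree C}, (∀ i, IsNode (X i) T) →
      (∀ i, ¬ {c | ∃ R ∈ component S A, c ∈ R} ⊆ ((X i).leafSet : Set C)) → ∀ {h i j : Fin n},
      x ∈ (X h).leafSet → y ∈ (X i).leafSet → z ∈ (X j).leafSet →
      ((X h).leafSet ⊆ A ∧ Disjoint A (X i).leafSet ∧ Disjoint A (X j).leafSet) ∧
      ((X j).leafSet ⊆ B ∧ Disjoint B (X h).leafSet ∧ Disjoint B (X i).leafSet) ∧
      h ≠ i ∧ i ≠ j ∧ h ≠ j := by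
    intro n X hX hne h i j hx hy hz
    have sub : ∀ {R : Finset C} {k c}, R ∈ component S A → c ∈ (X k).leafSet → c ∈ R →
        (X k).leafSet ⊆ R := fun {R k c} hR hc hcR =>
      (hT.child_subset_or_disjoint hKS hK (hX k) (hne k) R hR).resolve_right
        fun h => Finset.disjoint_left.1 h hcR hc
    have dis : ∀ {R : Finset C} {k c}, R ∈ component S A → c ∈ (X k).leafSet → c ∉ R →
        Disjoint R (X k).leafSet := fun {R k c} hR hc hcR =>
      (hT.child_subset_or_disjoint hKS hK (hX k) (hne k) R hR).resolve_left fun h => hcR (h hc)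
    have hA := sub hAK hx hxA
    have hB := sub hBK hz hzB
    refine ⟨⟨hA, dis hAK hy hyA, dis hAK hz hzA⟩, ⟨hB, dis hBK hx hxB, dis hBK hy hyB⟩, ?_, ?_, ?_⟩
    · rintro rfl; exact hyA (hA hy)
    · rintro rfl; exact hyB (hB hy)
    · rintro rfl; exact hzA (hA hz)
  rcases exists_lowest_node (T := T) (U := {c | ∃ R ∈ component S A, c ∈ R})
    (fun c _ => hT.mem_leafSet c) with ⟨c, hc⟩ | ⟨n, X, hX, hU, hne⟩ | ⟨n, X, hX, hU, hne⟩
  · have h1 : x = c := hc ⟨A, hAK, hxA⟩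
    have h2 : y = c := hc hyK
    exact (hxy (h1.trans h2.symm)).elim
  · have mem : ∀ {c}, (∃ R ∈ component S A, c ∈ R) → ∃ i, c ∈ (X i).leafSet := fun hc => by
      simpa [leafSet] using hU hc
    obtain ⟨h, hx⟩ := mem ⟨A, hAK, hxA⟩
    obtain ⟨i, hy⟩ := mem hyK
    obtain ⟨j, hz⟩ := mem ⟨B, hBK, hzB⟩
    obtain ⟨-, -, h1, h2, h3⟩ := child (fun i => (IsNode.below_pnode i .root).trans hX) hne hx hy hz
    exact (hT.not_between_pnode hX h1 h2 h3 hx hy hz hb).elim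
  · have mem : ∀ {c}, c ∈ (qnode X).leafSet → ∃ i, c ∈ (X i).leafSet := fun hc => by
      simpa [leafSet] using hc
    obtain ⟨h, hx⟩ := mem (hU ⟨A, hAK, hxA⟩)
    obtain ⟨i, hy⟩ := mem (hU hyK)
    obtain ⟨j, hz⟩ := mem (hU ⟨B, hBK, hzB⟩)
    obtain ⟨hA, hB, h1, h2, h3⟩ :=
      child (fun i => (IsNode.below_qnode i .root).trans hX) hne hx hy hz
    have hleaf : ∀ c, c ∈ (qnode X).leafSet ↔ ∃ R ∈ component S A, c ∈ R := by
      refine fun c => ⟨fun hc => ?_, fun hc => hU hc⟩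
      obtain ⟨k, hk⟩ := mem hc
      by_contra hcK
      have hkk : ∀ {l w}, w ∈ (X l).leafSet → (∃ R ∈ component S A, w ∈ R) → l ≠ k := by
        rintro l w hw ⟨R, hR, hwR⟩ rfl
        rcases hT.child_subset_or_disjoint hKS hK ((IsNode.below_qnode l .root).trans hX) (hne l)
          R hR with h | h
        · exact hcK ⟨R, hR, h hk⟩
        · exact Finset.disjoint_left.1 h hwR hw
      exact hcK (hT.qnode_subset_union hKS hK hKo hX h3 (hkk hx ⟨A, hAK, hxA⟩) hx hz hk
        ⟨A, hAK, hxA⟩ ⟨B, hBK, hzB⟩)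
    have hsupp := mem_supp_iff hAS
    have hleaf' : ∀ c, c ∈ (qnode X).leafSet ↔
        ∃ R ∈ ((overlapGraph S).connectedComponentMk ⟨A, hAS⟩).supp, c ∈ R.1 := by
      intro c
      rw [hleaf]
      exact ⟨fun ⟨R, hR, hc⟩ => ⟨⟨R, hR.1⟩, (hsupp _).2 hR, hc⟩,
        fun ⟨R, hR, hc⟩ => ⟨R.1, (hsupp _).1 hR, hc⟩⟩
    have hA' : ⟨A, hAS⟩ ∈ ((overlapGraph S).connectedComponentMk ⟨A, hAS⟩).supp :=
      (hsupp _).2 hAK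
    have hB' : ⟨B, hKS B hBK⟩ ∈ ((overlapGraph S).connectedComponentMk ⟨A, hAS⟩).supp :=
      (hsupp _).2 hBK
    refine ⟨n, X, hX, ?_⟩
    have hij : h < i ∧ i < j ∨ j < i ∧ i < h := by
      obtain ⟨l, hl⟩ := T.exists_isLeafOrder
      obtain ⟨f, hp, hf⟩ := ((hT.2 l).1 hl).exists_rank
      have hb := hb f hf
      rcases hX.qnode_order hl hp with o | o <;>
      rcases lt_or_gt_of_ne h1 with p1 | p1 <;> rcases lt_or_gt_of_ne h2 with p2 | p2 <;>
      · have e1 := o _ _ _ _ p1 (by assumption) (by assumption)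
        have e2 := o _ _ _ _ p2 (by assumption) (by assumption)
        clear o
        omega
    rcases hij with ⟨p1, p2⟩ | ⟨p1, p2⟩
    · exact ⟨h, i, j, ⟨p1, p2, ⟨x, hx, hxZ⟩, ⟨y, hy, hyZ⟩, ⟨z, hz, hzZ⟩⟩, _, hleaf',
        _, hA', _, hB', hA, hB⟩
    · exact ⟨j, i, h, ⟨p1, p2, ⟨z, hz, hzZ⟩, ⟨y, hy, hyZ⟩, ⟨x, hx, hxZ⟩⟩, _, hleaf',
        _, hB', _, hA', ⟨hB.1, hB.2.2, hB.2.1⟩, ⟨hA.1, hA.2.2, hA.2.1⟩⟩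

end PQTree

end Configuration

/-! ### Existence of PQ trees -/

section Blocks

variable {C : Type*} {S : List (Finset C)} {V : Finset C} {l : List C} {g : C → ℕ}

variable (V g) in
/-- The columns of `V` that have the `i`-th smallest of the labels which `g` gives to columns of
`V`. -/
def block (i : Fin (V.image g).card) : Finset C :=
  V.filter fun c => g c = (V.image g).orderEmbOfFin rfl i

lemma mem_block {i : Fin (V.image g).card} {c : C} :
    c ∈ block V g i ↔ c ∈ V ∧ g c = (V.image g).orderEmbOfFin rfl i := by
  simp [block]

lemma exists_mem_block {c : C} (hc : c ∈ V) : ∃ i, c ∈ block V g i := by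
  have : g c ∈ Set.range ((V.image g).orderEmbOfFin rfl) := by
    rw [Finset.range_orderEmbOfFin]
    exact Finset.mem_coe.2 (Finset.mem_image_of_mem g hc)
  obtain ⟨i, hi⟩ := this
  exact ⟨i, mem_block.2 ⟨hc, hi.symm⟩⟩

lemma block_nonempty (i : Fin (V.image g).card) : (block V g i).Nonempty := by
  have := (V.image g).orderEmbOfFin_mem rfl i
  obtain ⟨c, hc, hgc⟩ := Finset.mem_image.1 this
  exact ⟨c, mem_block.2 ⟨hc, hgc⟩⟩

lemma lt_iff_of_mem_block {i j : Fin (V.image g).card} {c d : C} (hc : c ∈ block V g i)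
    (hd : d ∈ block V g j) : i < j ↔ g c < g d := by
  rw [(mem_block.1 hc).2, (mem_block.1 hd).2, OrderEmbedding.lt_iff_lt]

lemma eq_iff_of_mem_block {i j : Fin (V.image g).card} {c d : C} (hc : c ∈ block V g i)
    (hd : d ∈ block V g j) : i = j ↔ g c = g d := by
  rw [(mem_block.1 hc).2, (mem_block.1 hd).2, OrderEmbedding.eq_iff_eq]

lemma block_ssubset (h2 : 2 ≤ (V.image g).card) (i : Fin (V.image g).card) : block V g i ⊂ V := by
  refine ⟨Finset.filter_subset _ _, fun h => ?_⟩
  have : Nontrivial (Fin (V.image g).card) := Fin.nontrivial_iff_two_le.2 h2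
  obtain ⟨j, hj⟩ := exists_ne i
  obtain ⟨c, hc⟩ := block_nonempty j
  have hci := h (mem_block.1 hc).1
  exact hj ((eq_iff_of_mem_block hc hci).2 rfl)

variable [DecidableEq C]

/-- `l` is an ordering of the columns in `V` in which the rows that are strictly contained in `V`
are consecutive. -/
def IsOrderingOf (S : List (Finset C)) (V : Finset C) (l : List C) : Prop :=
  l.Nodup ∧ (∀ c, c ∈ l ↔ c ∈ V) ∧ ∀ R ∈ S, R ⊂ V → ∃ t : List C, t <:+: l ∧ t.toFinset = R

lemma IsOrderingOf.exists_rank (h : IsOrderingOf S V l) :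
    ∃ f : C → ℕ, (l.Pairwise fun a b => f a < f b) ∧
      ∀ R ∈ S, R ⊂ V → RankConvex f (R : Set C) :=
  ⟨_, pairwise_idxOf h.1, fun R hR hRV =>
    (consecutive_iff h.1 fun c hc => (h.2.1 c).2 (hRV.1 hc)).1 (h.2.2 R hR hRV)⟩

lemma exists_infix_of_rank {R : Finset C} {f : C → ℕ} (hl : l.Pairwise fun a b => f a ≤ f b)
    (hf : RankConvex f (R : Set C)) (hR : ∀ c ∈ R, c ∈ l) :
    ∃ t : List C, t <:+: l ∧ t.toFinset = R := by
  obtain ⟨t, ht, htc⟩ := hf.exists_infix hl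
  refine ⟨t, ht, Finset.ext fun c => ?_⟩
  rw [List.mem_toFinset, htc]
  exact ⟨fun h => h.2, fun h => ⟨hR c h, h⟩⟩

lemma eq_of_pairwise {f : C → ℕ} {l l' : List C} (h : l.Pairwise fun a b => f a < f b)
    (h' : l'.Pairwise fun a b => f a < f b) (hm : ∀ c, c ∈ l ↔ c ∈ l') : l = l' := by
  have nd : ∀ {l : List C}, (l.Pairwise fun a b => f a < f b) → l.Nodup := fun h =>
    h.imp fun {a b} hab he => by rw [he] at hab; exact lt_irrefl _ hab
  exact ((List.perm_ext_iff_of_nodup (nd h) (nd h')).2 hm).eq_of_pairwise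
    (fun a b _ _ h1 h2 => by omega) h h'

/-- A concatenation of orderings of the blocks is an ordering of `V` if the rows that are not
contained in a block are consecutive in it. -/
lemma isOrderingOf_flatten {w : Fin (V.image g).card → List C}
    (hw : ∀ i, IsOrderingOf S (block V g i) (w i)) (σ : Equiv.Perm (Fin (V.image g).card))
    (hS : ∀ R ∈ S, R ⊂ V → (∃ c ∈ R, ∃ d ∈ R, g c ≠ g d) →
      ∃ t : List C, t <:+: (List.ofFn fun i => w (σ i)).flatten ∧ t.toFinset = R) :
    IsOrderingOf S V (List.ofFn fun i => w (σ i)).flatten := by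
  refine ⟨?_, fun c => ?_, fun R hR hRV => ?_⟩
  · rw [List.nodup_flatten]
    refine ⟨fun l hl => ?_, List.pairwise_ofFn.2 fun i j hij c hci hcj => ?_⟩
    · obtain ⟨i, rfl⟩ := List.mem_ofFn.1 hl
      exact (hw _).1
    · have := (eq_iff_of_mem_block (((hw _).2.1 c).1 hci) (((hw _).2.1 c).1 hcj)).2 rfl
      exact hij.ne (σ.injective this)
  · simp only [List.mem_flatten, List.mem_ofFn, exists_exists_eq_and, (hw _).2.1]
    constructor
    · rintro ⟨i, hi⟩
      exact (mem_block.1 hi).1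
    · intro hc
      obtain ⟨i, hi⟩ := exists_mem_block (g := g) hc
      exact ⟨σ.symm i, by simpa using hi⟩
  · by_cases h : ∃ c ∈ R, ∃ d ∈ R, g c ≠ g d
    · exact hS R hR hRV h
    push Not at h
    rcases R.eq_empty_or_nonempty with rfl | ⟨c, hc⟩
    · exact ⟨[], List.nil_infix, rfl⟩
    obtain ⟨i, hi⟩ := exists_mem_block (g := g) (hRV.1 hc)
    have hsub : R ⊆ block V g i := fun d hd =>
      mem_block.2 ⟨hRV.1 hd, (h d hd c hc).trans (mem_block.1 hi).2⟩
    have hin : w i <:+: (List.ofFn fun i => w (σ i)).flatten := by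
      simpa using infix_flatten_ofFn (fun i => w (σ i)) (σ.symm i)
    rcases hsub.ssubset_or_eq with h' | h'
    · obtain ⟨t, ht, htR⟩ := (hw i).2.2 R hR h'
      exact ⟨t, ht.trans hin, htR⟩
    · exact ⟨w i, hin, by rw [h']; ext d; simp [(hw i).2.1]⟩

lemma IsOrderingOf.filter (hl : IsOrderingOf S V l) (h2 : 2 ≤ (V.image g).card)
    (i : Fin (V.image g).card) :
    IsOrderingOf S (block V g i) (l.filter fun c => c ∈ block V g i) := by
  obtain ⟨f, hf, hfS⟩ := hl.exists_rank
  have hm : ∀ c, c ∈ l.filter (fun c => c ∈ block V g i) ↔ c ∈ block V g i := by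
    intro c
    simp only [List.mem_filter, hl.2.1, decide_eq_true_eq, and_iff_right_iff_imp]
    exact fun h => (mem_block.1 h).1
  refine ⟨hl.1.filter _, hm, fun R hR hRb => ?_⟩
  exact exists_infix_of_rank ((hf.imp le_of_lt).filter _)
    (hfS R hR (hRb.trans (block_ssubset h2 i))) fun c hc => (hm c).2 (hRb.1 hc)

/-- An ordering of `V` in which the blocks follow one another is a concatenation. -/
lemma IsOrderingOf.eq_flatten (hl : IsOrderingOf S V l) {f : C → ℕ}
    (hf : l.Pairwise fun a b => f a < f b) (σ : Equiv.Perm (Fin (V.image g).card))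
    (hσ : ∀ p q, p < q → ∀ c ∈ block V g (σ p), ∀ d ∈ block V g (σ q), f c < f d) :
    l = (List.ofFn fun p => l.filter fun c => c ∈ block V g (σ p)).flatten := by
  refine eq_of_pairwise hf (List.pairwise_flatten.2 ⟨fun l' hl' => ?_, ?_⟩) fun c => ?_
  · obtain ⟨p, rfl⟩ := List.mem_ofFn.1 hl'
    exact hf.filter _
  · refine List.pairwise_ofFn.2 fun p q hpq c hc d hd => hσ p q hpq c ?_ d ?_
    · simpa using (List.mem_filter.1 hc).2
    · simpa using (List.mem_filter.1 hd).2
  · simp only [List.mem_flatten, List.mem_ofFn, exists_exists_eq_and, List.mem_filter, hl.2.1,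
      decide_eq_true_eq]
    constructor
    · intro hc
      obtain ⟨i, hi⟩ := exists_mem_block (g := g) hc
      exact ⟨σ.symm i, hc, by simpa using hi⟩
    · exact fun ⟨_, hc, _⟩ => hc

end Blocks

section Trees

variable {C : Type*} {S : List (Finset C)} {V : Finset C} {g : C → ℕ}

/-- The columns `c` and `d` are joined by a chain of intersecting rows that are strictly contained
in `V`. -/
def Joined (S : List (Finset C)) (V : Finset C) (c d : C) : Prop :=
  Relation.ReflTransGen (fun c d => ∃ R ∈ S, R ⊂ V ∧ c ∈ R ∧ d ∈ R) c d

lemma Joined.symm {c d : C} (h : Joined S V c d) : Joined S V d c := by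
  induction h with
  | refl => exact .refl
  | tail _ h ih =>
    obtain ⟨R, h1, h2, h3, h4⟩ := h
    exact .head ⟨R, h1, h2, h4, h3⟩ ih

lemma Joined.trans {b c d : C} (h : Joined S V b c) (h' : Joined S V c d) : Joined S V b d :=
  Relation.ReflTransGen.trans h h'

/-- A class of joined columns lies on one side of any other column. -/
lemma Joined.lt_iff {f : C → ℕ} (hf : ∀ R ∈ S, R ⊂ V → RankConvex f (R : Set C)) {x y z : C}
    (h : Joined S V x z) (hy : ¬ Joined S V x y) : f x < f y ↔ f z < f y := by
  induction h with
  | refl => exact Iff.rfl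
  | tail h h' ih =>
    obtain ⟨R, h1, h2, h3, h4⟩ := h'
    exact ih.trans ((hf R h1 h2).lt_iff_of_notMem h3 h4 fun h5 =>
      hy (Relation.ReflTransGen.tail h ⟨R, h1, h2, h3, h5⟩))

/-- If all columns of `V` are joined, then the rows of some overlap component cover `V`: a row that
leaves a largest component has a larger one. -/
lemma exists_covering_component [Finite C] (hJ : ∀ c ∈ V, ∀ d ∈ V, Joined S V c d) {a b : C}
    (ha : a ∈ V) (hb : b ∈ V) (hab : a ≠ b) :
    ∃ (K : Set (Finset C)) (A B : Finset C), (∀ R ∈ K, R ∈ S ∧ R ⊂ V) ∧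
      Linked (fun R : Finset C => (R : Set C)) K ∧ A ∈ K ∧ B ∈ K ∧
      SetOverlap (A : Set C) (B : Set C) ∧ (∀ c ∈ V, ∃ R ∈ K, c ∈ R) ∧
      ∀ R ∈ S, R ⊂ V → R ∉ K → ∀ R' ∈ K, ¬ SetOverlap (R' : Set C) (R : Set C) := by
  let J : Set (Finset C) := {R | R ∈ S ∧ R ⊂ V}
  let comp (A : Finset C) : Set (Finset C) := {k ∈ J | Relation.ReflTransGen
    (fun R R' : Finset C => R' ∈ J ∧ SetOverlap (R : Set C) (R' : Set C)) A k}
  let U (A : Finset C) : Set C := {c | ∃ R ∈ comp A, c ∈ R}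
  have hcomp : ∀ {A}, A ∈ J → A ∈ comp A := fun h => ⟨h, .refl⟩
  have hlink : ∀ {A}, A ∈ J → Linked (fun R : Finset C => (R : Set C)) (comp A) :=
    fun h => linked_component _ _ h
  have hout : ∀ {A R}, R ∈ J → R ∉ comp A → ∀ R' ∈ comp A, ¬ SetOverlap (R' : Set C) (R : Set C) :=
    fun hR hRK R' hR' ho => hRK ⟨hR, hR'.2.tail ⟨hR, ho⟩⟩
  have hne : {A | A ∈ J ∧ A.Nonempty}.Nonempty := by
    rcases Relation.ReflTransGen.cases_head (hJ a ha b hb) with h | ⟨_, ⟨R, h1, h2, h3, -⟩, -⟩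
    · exact (hab h).elim
    · exact ⟨R, ⟨h1, h2⟩, a, h3⟩
  obtain ⟨A, ⟨hAJ, u, hu⟩, hmax⟩ :=
    Set.exists_max_image _ (fun A => (U A).ncard) (Set.toFinite _) hne
  have huU : u ∈ U A := ⟨A, hcomp hAJ, hu⟩
  have hcov : ∀ c ∈ V, c ∈ U A := by
    intro v hv
    by_contra hvU
    have hstep : ∀ w, Joined S V u w → w ∉ U A → ∃ D ∈ J, ∃ c ∈ D, c ∈ U A ∧ ∃ d ∈ D, d ∉ U A := by
      intro w hw
      induction hw with
      | refl => exact fun h => (h huU).elim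
      | @tail c d _ h ih =>
        intro hd
        by_cases hc : c ∈ U A
        · obtain ⟨D, h1, h2, h3, h4⟩ := h
          exact ⟨D, ⟨h1, h2⟩, c, h3, hc, d, h4, hd⟩
        · exact ih hc
    obtain ⟨D, hDJ, c, hcD, ⟨R, hR, hcR⟩, d, hdD, hdU⟩ := hstep v (hJ u (hAJ.2.1 hu) v hv) hvU
    have hDA : D ∉ comp A := fun h => hdU ⟨D, h, hdD⟩
    rcases (hlink hAJ).union_subset_or (hout hDJ hDA) with h | h
    · have hlt : (U A).ncard < (U D).ncard := by
        refine Set.ncard_lt_ncard ⟨?_, fun h' => hdU (h' ⟨D, hcomp hDJ, hdD⟩)⟩ (Set.toFinite _)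
        rintro x ⟨R, hR, hx⟩
        exact ⟨D, hcomp hDJ, h R hR hx⟩
      have := hmax D ⟨hDJ, c, hcD⟩
      omega
    · rcases h R hR with h | h
      · exact hdU ⟨R, hR, h hdD⟩
      · exact Set.disjoint_left.1 h hcD hcR
  obtain ⟨v, hv, hvA⟩ := Finset.exists_of_ssubset hAJ.2
  obtain ⟨R, hR, hvR⟩ := hcov v hv
  obtain ⟨B, hB, hAB⟩ := (hlink hAJ).exists_overlap (hcomp hAJ) hR fun h => hvA (h ▸ hvR)
  exact ⟨comp A, A, B, fun R hR => hR.1, hlink hAJ, hcomp hAJ, hB, hAB, hcov,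
    fun R hR hRV => hout ⟨hR, hRV⟩⟩

variable [DecidableEq C]

namespace PQTree

/-- If no row leaves a class of joined columns, then the classes can be permuted arbitrarily. -/
lemma isLeafOrder_pnode_iff (hg : ∀ c d, g c = g d ↔ Joined S V c d)
    (h2 : 2 ≤ (V.image g).card) {X : Fin (V.image g).card → PQTree C}
    (hX : ∀ i l, (X i).IsLeafOrder l ↔ IsOrderingOf S (block V g i) l) (l : List C) :
    (pnode X).IsLeafOrder l ↔ IsOrderingOf S V l := by
  constructor
  · rintro ⟨σ, w, hw, rfl⟩
    refine isOrderingOf_flatten (fun i => (hX i _).1 (hw i)) σ fun R hR hRV ⟨c, hc, d, hd, h⟩ => ?_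
    exact (h ((hg c d).2 (.single ⟨R, hR, hRV, hc, hd⟩))).elim
  · intro hl
    obtain ⟨f, hf, hfS⟩ := hl.exists_rank
    choose c hc using fun i => block_nonempty (V := V) (g := g) i
    have hne : ∀ {x y}, x ∈ V → y ∈ V → x ≠ y → f x ≠ f y := by
      intro x y hx hy hxy
      rcases pairwise_or hf ((hl.2.1 x).2 hx) ((hl.2.1 y).2 hy) hxy with h | h <;> omega
    have hV : ∀ {i x}, x ∈ block V g i → x ∈ V := fun h => (mem_block.1 h).1
    have hcinj : Function.Injective fun i => f (c i) := by
      intro i j hij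
      by_contra h
      refine hne (hV (hc i)) (hV (hc j)) (fun h' => h ?_) hij
      exact (eq_iff_of_mem_block (hc i) (hc j)).2 (by rw [h'])
    let σ := Tuple.sort fun i => f (c i)
    have hmono : StrictMono ((fun i => f (c i)) ∘ σ) :=
      (Tuple.monotone_sort fun i => f (c i)).strictMono_of_injective (hcinj.comp σ.injective)
    have hnj : ∀ {i j x y}, i ≠ j → x ∈ block V g i → y ∈ block V g j → ¬ Joined S V x y :=
      fun hij hx hy h => hij ((eq_iff_of_mem_block hx hy).2 ((hg _ _).2 h))
    have hj : ∀ {i x y}, x ∈ block V g i → y ∈ block V g i → Joined S V x y :=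
      fun hx hy => (hg _ _).1 ((eq_iff_of_mem_block hx hy).1 rfl)
    refine ⟨σ, fun i => l.filter fun c => c ∈ block V g i,
      fun i => (hX i _).2 (hl.filter h2 i), hl.eq_flatten hf σ ?_⟩
    intro p q hpq x hx y hy
    have hpq' : σ p ≠ σ q := σ.injective.ne hpq.ne
    have e1 := (hj (hc (σ p)) hx).lt_iff hfS (hnj hpq' (hc (σ p)) (hc (σ q)))
    have e2 := (hj (hc (σ q)) hy).lt_iff hfS (hnj hpq'.symm (hc (σ q)) hx)
    have e3 : f (c (σ p)) < f (c (σ q)) := hmono hpq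
    have e4 : f x ≠ f y := hne (hV hx) (hV hy) fun h => hnj hpq' hx (h ▸ hy) .refl
    omega

/-- If the linked rows `K` cover `V`, then their atoms can only be reversed as a whole. -/
lemma isLeafOrder_qnode_iff [Finite C] {K : Set (Finset C)} (hKS : ∀ R ∈ K, R ∈ S ∧ R ⊂ V)
    (hK : Linked (fun R : Finset C => (R : Set C)) K) {A B : Finset C} (hA : A ∈ K) (hB : B ∈ K)
    (hAB : SetOverlap (A : Set C) (B : Set C)) (hcov : ∀ c ∈ V, ∃ R ∈ K, c ∈ R)
    (hKo : ∀ R ∈ S, R ⊂ V → R ∉ K → ∀ R' ∈ K, ¬ SetOverlap (R' : Set C) (R : Set C))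
    (hg : ∀ R ∈ K, RankConvex g (R : Set C))
    (hgs : ∀ c d, ¬ Separated (fun R : Finset C => (R : Set C)) K c d → g c = g d)
    (h2 : 2 ≤ (V.image g).card) {X : Fin (V.image g).card → PQTree C}
    (hX : ∀ i l, (X i).IsLeafOrder l ↔ IsOrderingOf S (block V g i) l) (l : List C) :
    (qnode X).IsLeafOrder l ↔ IsOrderingOf S V l := by
  have hRK : ∀ R ∈ S, R ⊂ V → (∃ c ∈ R, ∃ d ∈ R, g c ≠ g d) → R ∈ K := by
    rintro R hR hRV ⟨c, hc, d, hd, hcd⟩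
    by_contra hRK
    rcases hK.union_subset_or (R := (R : Set C)) (hKo R hR hRV hRK) with h | h
    · exact hRV.2 fun v hv => let ⟨R', hR', hv'⟩ := hcov v hv; h R' hR' hv'
    · refine hcd (hgs c d ?_)
      rintro ⟨R', hR', h'⟩
      rcases h R' hR' with h | h
      · exact h' ⟨fun _ => h hd, fun _ => h hc⟩
      · exact h' ⟨fun h'' => (Set.disjoint_left.1 h hc h'').elim,
          fun h'' => (Set.disjoint_left.1 h hd h'').elim⟩
  constructor
  · rintro ⟨w, hw, h⟩
    have hw := fun i => (hX i _).1 (hw i)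
    have mem : ∀ {i c}, c ∈ w i → c ∈ block V g i := fun {i c} hc => ((hw i).2.1 c).1 hc
    have hVw : ∀ (σ : Equiv.Perm (Fin (V.image g).card)), ∀ c ∈ V,
        c ∈ (List.ofFn fun i => w (σ i)).flatten := by
      intro σ c hc
      simp only [List.mem_flatten, List.mem_ofFn, exists_exists_eq_and]
      obtain ⟨i, hi⟩ := exists_mem_block (g := g) hc
      exact ⟨σ.symm i, by simpa using ((hw i).2.1 c).2 hi⟩
    rcases h with rfl | rfl
    · refine isOrderingOf_flatten hw (Equiv.refl _) fun R hR hRV h => ?_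
      refine exists_infix_of_rank (f := g) (List.pairwise_flatten.2 ⟨fun l' hl' => ?_, ?_⟩)
        (hg R (hRK R hR hRV h)) fun c hc => hVw (Equiv.refl _) c (hRV.1 hc)
      · obtain ⟨i, rfl⟩ := List.mem_ofFn.1 hl'
        exact List.pairwise_of_forall_mem_list fun c hc d hd =>
          ((eq_iff_of_mem_block (mem hc) (mem hd)).1 rfl).le
      · exact List.pairwise_ofFn.2 fun i j hij c hc d hd =>
          ((lt_iff_of_mem_block (mem hc) (mem hd)).1 hij).le
    · refine isOrderingOf_flatten hw Fin.revPerm fun R hR hRV h => ?_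
      obtain ⟨N, hN⟩ := exists_bound g
      refine exists_infix_of_rank (f := fun c => N - g c)
        (List.pairwise_flatten.2 ⟨fun l' hl' => ?_, ?_⟩)
        ((hg R (hRK R hR hRV h)).sub fun c => (hN c).le) fun c hc => hVw Fin.revPerm c (hRV.1 hc)
      · obtain ⟨i, rfl⟩ := List.mem_ofFn.1 hl'
        refine List.pairwise_of_forall_mem_list fun c hc d hd => ?_
        have := (eq_iff_of_mem_block (mem hc) (mem hd)).1 rfl
        omega
      · refine List.pairwise_ofFn.2 fun i j hij c hc d hd => ?_
        have := (lt_iff_of_mem_block (mem hd) (mem hc)).1 (Fin.rev_lt_rev.2 hij)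
        omega
  · intro hl
    obtain ⟨f, hf, hfS⟩ := hl.exists_rank
    have hV : ∀ {i x}, x ∈ block V g i → x ∈ V := fun h => (mem_block.1 h).1
    have hsep : ∀ {c d}, g c ≠ g d → Separated (fun R : Finset C => (R : Set C)) K c d :=
      fun h => by_contra fun h' => h (hgs _ _ h')
    refine ⟨fun i => l.filter fun c => c ∈ block V g i, fun i => (hX i _).2 (hl.filter h2 i), ?_⟩
    rcases hK.order_unique (f₁ := f) (f₂ := g) (fun R hR => hfS R (hKS R hR).1 (hKS R hR).2) hg
      hA hB hAB with h | h
    · refine .inl (hl.eq_flatten hf (Equiv.refl _) fun p q hpq c hc d hd => ?_)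
      have hcd := (lt_iff_of_mem_block hc hd).1 hpq
      exact (h c d (hcov c (hV hc)) (hcov d (hV hd)) (hsep hcd.ne)).2 hcd
    · refine .inr (hl.eq_flatten hf Fin.revPerm fun p q hpq c hc d hd => ?_)
      have hcd := (lt_iff_of_mem_block hd hc).1 (Fin.rev_lt_rev.2 hpq)
      exact (h c d (hcov c (hV hc)) (hcov d (hV hd)) (hsep hcd.ne')).2 hcd

lemma isLeafOrder_leaf_iff (c : C) (l : List C) :
    (leaf c).IsLeafOrder l ↔ IsOrderingOf S {c} l := by
  constructor
  · rintro rfl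
    refine ⟨List.nodup_singleton c, by simp, fun R _ hR => ⟨[], List.nil_infix, ?_⟩⟩
    exact (Finset.ssubset_singleton_iff.1 hR).symm
  · rintro ⟨h1, h2, -⟩
    exact List.perm_singleton.1 ((List.perm_ext_iff_of_nodup h1 (List.nodup_singleton c)).2
      fun d => by simp [h2])

end PQTree

/-- Rows with the consecutive-ones property have a tree for every nonempty set of columns. If the
rows inside it do not join all of its columns, the root is a P node, and otherwise a Q node. -/
theorem exists_isLeafOrder_iff [Finite C] (hS : ∃ f : C → ℕ, ∀ R ∈ S, RankConvex f (R : Set C))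
    (hV : V.Nonempty) : ∃ T : PQTree C, T.Proper ∧ ∀ l, T.IsLeafOrder l ↔ IsOrderingOf S V l := by
  induction V using Finset.strongInduction with
  | H V ih =>
  have trees : ∀ g : C → ℕ, 2 ≤ (V.image g).card →
      ∃ X : Fin (V.image g).card → PQTree C, (∀ i, (X i).Proper) ∧
        ∀ i l, (X i).IsLeafOrder l ↔ IsOrderingOf S (block V g i) l := by
    intro g h2
    choose X h1 h3 using fun i => ih (block V g i) (block_ssubset h2 i) (block_nonempty i)
    exact ⟨X, h1, h3⟩
  by_cases hJ : ∀ c ∈ V, ∀ d ∈ V, Joined S V c d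
  · obtain ⟨a, ha⟩ := hV
    by_cases hb : ∃ b ∈ V, a ≠ b
    · obtain ⟨b, hb, hab⟩ := hb
      obtain ⟨K, A, B, hKS, hK, hA, hB, hAB, hcov, hKo⟩ := exists_covering_component hJ ha hb hab
      obtain ⟨f, hf⟩ := hS
      obtain ⟨g, hg, -, hgs⟩ := exists_tight_rank (s := fun R : Finset C => (R : Set C)) (J := K)
        (f := f) fun R hR => hf R (hKS R hR).1
      have h3 : 3 ≤ (V.image g).card := by
        -- the three regions of two overlapping rows have different labels
        obtain ⟨⟨x, hxA, hxB⟩, ⟨y, hyA, hyB⟩, ⟨z, hzB, hzA⟩⟩ := hAB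
        have h1 : g x ≠ g y := (hg B hB).ne hxB hyB
        have h2 : g x ≠ g z := (hg A hA).ne hxA hzA
        have h3 : g y ≠ g z := (hg A hA).ne hyA hzA
        have hsub : ({g x, g y, g z} : Finset ℕ) ⊆ V.image g := by
          intro k hk
          simp only [Finset.mem_insert, Finset.mem_singleton] at hk
          rcases hk with rfl | rfl | rfl
          · exact Finset.mem_image_of_mem g ((hKS A hA).2.1 hxA)
          · exact Finset.mem_image_of_mem g ((hKS A hA).2.1 hyA)
          · exact Finset.mem_image_of_mem g ((hKS B hB).2.1 hzB)
        exact (Finset.card_eq_three.2 ⟨_, _, _, h1, h2, h3, rfl⟩).symm.le.trans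
          (Finset.card_le_card hsub)
      obtain ⟨X, hX, hXl⟩ := trees g (by omega)
      exact ⟨.qnode X, ⟨h3, hX⟩, PQTree.isLeafOrder_qnode_iff hKS hK hA hB hAB hcov hKo hg hgs
        (by omega) hXl⟩
    · push Not at hb
      have : V = {a} := Finset.eq_singleton_iff_unique_mem.2 ⟨ha, fun x hx => (hb x hx).symm⟩
      subst this
      exact ⟨.leaf a, trivial, PQTree.isLeafOrder_leaf_iff a⟩
  · push Not at hJ
    obtain ⟨c, hc, d, hd, hcd⟩ := hJ
    obtain ⟨g, hg⟩ : ∃ g : C → ℕ, ∀ c d, g c = g d ↔ Joined S V c d := by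
      let s : Setoid C := ⟨Joined S V, fun _ => .refl, Joined.symm, Joined.trans⟩
      refine ⟨fun c => Finite.equivFin (Quotient s) (Quotient.mk s c), fun c d => ?_⟩
      rw [Fin.val_inj, Equiv.apply_eq_iff_eq, Quotient.eq]
      rfl
    have h2 : 2 ≤ (V.image g).card :=
      Finset.one_lt_card.2 ⟨g c, Finset.mem_image_of_mem g hc, g d, Finset.mem_image_of_mem g hd,
        fun h => hcd ((hg c d).1 h)⟩
    obtain ⟨X, hX, hXl⟩ := trees g h2
    exact ⟨.pnode X, ⟨h2, hX⟩, PQTree.isLeafOrder_pnode_iff hg h2 hXl⟩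

lemma isOrderingOf_univ_iff [Fintype C] {l : List C} :
    IsOrderingOf S Finset.univ l ↔ IsConsecutiveOrdering S l := by
  constructor
  · rintro ⟨h1, h2, h3⟩
    refine ⟨h1, by simpa using h2, fun R hR => ?_⟩
    by_cases hRV : R = Finset.univ
    · exact ⟨l, List.infix_refl l, by rw [hRV]; ext c; simp [h2]⟩
    · exact h3 R hR (Finset.ssubset_univ_iff.2 hRV)
  · rintro ⟨h1, h2, h3⟩
    exact ⟨h1, by simpa using h2, fun R hR _ => h3 R hR⟩

/-- Rows with the consecutive-ones property have a PQ tree. -/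
theorem HasC1P.exists_isPQTreeOf [Fintype C] [Nonempty C] (hS : HasC1P S) :
    ∃ T : PQTree C, T.IsPQTreeOf S := by
  obtain ⟨T, hT, h⟩ := exists_isLeafOrder_iff (hasC1P_iff.1 hS) Finset.univ_nonempty
  exact ⟨T, hT, fun l => (h l).trans isOrderingOf_univ_iff⟩

end Trees

end TuckerPQ

theorem mainTheorem5 {n m : ℕ} (M : Matrix (Fin n) (Fin m) Bool)
    (hM : ¬ TuckerPQ.HasC1P (TuckerPQ.rowList M))
    (hT : ∀ (p q : ℕ) (r : Fin p ↪ Fin n) (c : Fin q ↪ Fin m),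
      TuckerPQ.IsTuckerSubmatrix M r c → 5 ≤ p) :
    ∃ (t : ℕ) (R' : List (Finset (Fin m))) (Z : Finset (Fin m)),
      TuckerPQ.IsIteration 4 (TuckerPQ.rowList M) t R' Z ∧
      (∃ T : TuckerPQ.PQTree (Fin m), T.IsPQTreeOf R') ∧
      ∀ T : TuckerPQ.PQTree (Fin m), T.IsPQTreeOf R' →
        ∃ (s : ℕ) (X : Fin s → TuckerPQ.PQTree (Fin m)),
          TuckerPQ.PQTree.IsNode (.qnode X) T ∧
          ∃ h i j : Fin s, TuckerPQ.PQTree.Is101 X Z h i j ∧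
            ∃ K : (TuckerPQ.overlapGraph R').ConnectedComponent,
              (∀ c : Fin m, c ∈ (TuckerPQ.PQTree.qnode X).leafSet ↔ ∃ R ∈ K.supp, c ∈ R.1) ∧
              ∃ A ∈ K.supp, ∃ B ∈ K.supp,
                ((X h).leafSet ⊆ A.1 ∧ Disjoint A.1 (X i).leafSet ∧ Disjoint A.1 (X j).leafSet) ∧
                ((X j).leafSet ⊆ B.1 ∧ Disjoint B.1 (X h).leafSet ∧ Disjoint B.1 (X i).leafSet) := by
  obtain ⟨t, R', Z, hit, hC, S, A, B, x, y, z, hS, hw⟩ :=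
    (TuckerPQ.avoids_rowList hT).exists_isIteration hM
  have : Nonempty (Fin m) := ⟨x⟩
  exact ⟨t, R', Z, hit, hC.exists_isPQTreeOf, fun T h => h.exists_qnode hS hw⟩
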